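/- Let $\ell$ be a prime and $G=\{(g,h)\in \mathrm{GSp}_4\times\mathrm{GL}_2:\mu(g)=\det h\}$, where $\mathrm{GSp}_4$ is taken for the form with antidiagonal $(1,1,-1,-1)$ and $\mu$ is its multiplier. Let $\sigma'$ and $\tau'$ be irreducible admissible representations of $\mathrm{GSp}_4(\mathbb Q_\ell)$ and $\mathrm{GL}_2(\mathbb Q_\ell)$, regard $\sigma'\otimes\tau'$ as a representation of $G(\mathbb Q_\ell)$, and let $\Psi$ be an additive character of $\mathbb Q_\ell$ that is trivial on $\mathbb Z_\ell$ and non-trivial on $\ell^{-1}\mathbb Z_\ell$. Let $W_{\sigma'}$ be a Whittaker functional of $\sigma'$, so that $W_{\sigma'}(n v)=\Psi(n_{12}+n_{23})W_{\sigma'}(v)$ for all upper unitriangular $n\in\mathrm{GSp}_4(\mathbb Q_\ell)$, and let $W_{\tau'}$ be a Whittaker functional of $\tau'$ for $\Psi^{-1}$. Let $\varphi_0=v_0\otimes w_0$ be a $G(\mathbb Z_\ell)$-invariant vector with $W_{\sigma'}(v_0)W_{\tau'}(w_0)=1$, and let $\eta$ be an unramified character of $\mathbb Q_\ell^\times$.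 For $s\in\mathbb C$ put $X=\eta(\ell)\ell^{-s}$, and for $i,j\in\mathbb Z$ put $$W_{\sigma'}(i,j)=W_{\sigma'}(\mathrm{diag}(\ell^{i+2j},\ell^{i+j},\ell^j,1)v_0),\qquad W_{\tau'}(i,j)=W_{\tau'}(\mathrm{diag}(\ell^{i+j},\ell^j)w_0).$$ For $\Phi\in\sigma'\otimes\tau'$ let $$l(\Phi,\eta,s)=\int_{\mathbb Q_\ell^\times\times\mathbb Q_\ell^\times}(W_{\sigma'}\otimes W_{\tau'})\bigl((\mathrm{diag}(xy,x,y,1),\mathrm{diag}(x,y))\Phi\bigr)\,|x|^{s-2}|y|^s\eta(xy)\,d^\times x\,d^\times y,$$ where $\mathbb Z_\ell^\times$ has volume $1$. For integers $m\ge 0$, $n\ge 1$ let $K_{m,n}\subset G(\mathbb Z_\ell)$ be the subgroup of elements whose $\mathrm{GSp}_4$-component modulo $\ell^n$ has zeros at the positions $(2,1),(3,1),(4,1),(4,2),(4,3)$ and whose multiplier is $\equiv 1$ modulo $\ell^m$. Let $U_i$ $(0\le i\le 6)$ be the characteristic function of $K_{m,n}u_iG(\mathbb Z_\ell)$, where $$\begin{aligned}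 u_0&=1,& u_1&=(\mathrm{diag}(\ell,\ell,1,1),\mathrm{diag}(\ell,1)),\\ u_2&=(\mathrm{diag}(\ell^2,\ell,\ell,1),\mathrm{diag}(\ell,\ell)),& u_3&=(\mathrm{diag}(\ell^2,\ell,\ell,1),\mathrm{diag}(\ell^2,1)),\\ u_4&=(\mathrm{diag}(\ell^2,\ell^2,1,1),\mathrm{diag}(\ell,\ell)),& u_5&=(\mathrm{diag}(\ell^3,\ell^2,\ell,1),\mathrm{diag}(\ell^2,\ell)),\\ u_6&=(\mathrm{diag}(\ell^4,\ell^2,\ell^2,1),\mathrm{diag}(\ell^2,\ell^2)). \end{aligned}$$ A locally constant compactly supported function $\xi$ on $G(\mathbb Q_\ell)$ acts on $\sigma'\otimes\tau'$ by $\xi\Phi=\int\xi(g)\,g\Phi\,dg$, where $G(\mathbb Z_\ell)$ has volume $1$. Put $$\xi_s=U_0-\frac{\eta(\ell)}{\ell^{s+2}}U_1+\frac{2\eta(\ell)^2}{\ell^{2s+3}}U_2+\frac{\eta(\ell)^2}{\ell^{2s+3}}(U_3+U_4)-\frac{\eta(\ell)^3}{\ell^{3s+4}}U_5+\frac{\eta(\ell)^4}{\ell^{4s+4}}U_6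 .$$ Write $$\begin{aligned} A_{a,b}&=\sum_{i\ge a}\sum_{j\ge b}W_{\sigma'}(i,j)W_{\tau'}(i,j)\ell^{2(i+j)}X^{i+2j},\\ B_{a,b}&=\sum_{i\ge a}\sum_{j\ge b}W_{\sigma'}(i,j)W_{\tau'}(i-2,j+1)\ell^{2(i+j)}X^{i+2j},\\ C_{a,b}&=\sum_{i\ge a}\sum_{j\ge b}W_{\sigma'}(i,j)W_{\tau'}(i+2,j-1)\ell^{2(i+j)}X^{i+2j}. \end{aligned}$$ Then there is a real number $s_0$ such that for all $s$ with $\mathrm{Re}(s)>s_0$ the integrals and double sums below, and the integrals $l(U_i\varphi_0,\eta,s)$ for $0\le i\le 6$, converge absolutely, and $$\begin{aligned} l(U_1\varphi_0,\eta,s)&=\ell^2X^{-1}(A_{0,1}+A_{1,0})+\ell X^{-1}B_{2,0}+\ell^3X^{-1}C_{0,1},\\ l(U_2\varphi_0,\eta,s)&=\ell^2X^{-2}A_{0,1},\\ l((U_3+U_2)\varphi_0,\eta,s)&=\ell^3X^{-2}A_{1,1}+\ell^2X^{-2}B_{2,1}+\ell^4X^{-2}C_{0,1},\\ l((U_4+U_2)\varphi_0,\eta,s)&=\ell^3X^{-2}A_{1,1}+\ell^2X^{-2}B_{2,0}+\ell^4X^{-2}C_{0,2},\\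 l(U_5\varphi_0,\eta,s)&=\ell^4X^{-3}(A_{1,1}+A_{0,2})+\ell^3X^{-3}B_{2,1}+\ell^5X^{-3}C_{0,2},\\ l(U_6\varphi_0,\eta,s)&=\ell^4X^{-4}A_{0,2},\\ l(\xi_s\varphi_0,\eta,s)&=1 . \end{aligned}$$ The last identity persists under analytic continuation. Suppose that $D\subset\mathbb C$ is open and connected and contains some half plane $\mathrm{Re}(s)>s_1$, and that holomorphic functions $M_0,\dots,M_6$ on $D$ satisfy $M_i(s)=l(U_i\varphi_0,\eta,s)$ for all $s$ in this half plane. Then $\sum_i c_i(s)M_i(s)=1$ for all $s\in D$, where $c_i(s)$ is the coefficient of $U_i$ in $\xi_s$. -/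

import Mathlib

open scoped TensorProduct MatrixGroups
open MeasureTheory

noncomputable section

namespace GSp4GL2

/-! ### The groups -/

section Groups

variable (R : Type*) [CommRing R]

/-- The antidiagonal skew-symmetric form. -/
def J : Matrix (Fin 4) (Fin 4) R :=
  !![0, 0, 0, 1; 0, 0, 1, 0; 0, -1, 0, 0; -1, 0, 0, 0]

/-- `GSp₄(R)`: the pairs `(g, μ)` in `GL₄(R) × Rˣ` with `gᵀ J g = μ J`. -/
def GSp4 : Subgroup (GL (Fin 4) R × Rˣ) where
  carrier := {p | (p.1 : Matrix (Fin 4) (Fin 4) R).transpose * J R * (p.1 : Matrix _ _ R)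
    = (p.2 : R) • J R}
  one_mem' := by simp
  mul_mem' := by
    intro p q hp hq
    simp only [Set.mem_ofPred_eq, Prod.fst_mul, Prod.snd_mul, Units.val_mul,
      Matrix.transpose_mul] at hp hq ⊢
    calc _ = (q.1 : Matrix (Fin 4) (Fin 4) R).transpose
          * ((p.1 : Matrix (Fin 4) (Fin 4) R).transpose * J R * (p.1 : Matrix _ _ R))
          * (q.1 : Matrix (Fin 4) (Fin 4) R) := by simp only [Matrix.mul_assoc]
      _ = _ := by
        rw [hp, Matrix.mul_smul, Matrix.smul_mul, hq, smul_smul]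
  inv_mem' := by
    intro p hp
    simp only [Set.mem_ofPred_eq, Prod.fst_inv, Prod.snd_inv] at hp ⊢
    have h1 : (p.1 : Matrix (Fin 4) (Fin 4) R) * ((p.1⁻¹ : GL (Fin 4) R) : Matrix _ _ R) = 1 := by
      rw [← Units.val_mul, mul_inv_cancel, Units.val_one]
    have h2 : ((p.1⁻¹ : GL (Fin 4) R) : Matrix (Fin 4) (Fin 4) R).transpose
        * (p.1 : Matrix (Fin 4) (Fin 4) R).transpose = 1 := by
      rw [← Matrix.transpose_mul, h1, Matrix.transpose_one]
    have h3 : J R = ((p.2⁻¹ : Rˣ) : R) • ((p.1 : Matrix (Fin 4) (Fin 4) R).transpose * J R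
        * (p.1 : Matrix _ _ R)) := by
      rw [hp, smul_smul, Units.inv_mul, one_smul]
    calc _ = ((p.1⁻¹ : GL (Fin 4) R) : Matrix (Fin 4) (Fin 4) R).transpose
          * (((p.2⁻¹ : Rˣ) : R) • ((p.1 : Matrix (Fin 4) (Fin 4) R).transpose * J R
            * (p.1 : Matrix _ _ R)))
          * ((p.1⁻¹ : GL (Fin 4) R) : Matrix (Fin 4) (Fin 4) R) := by rw [← h3]
      _ = ((p.2⁻¹ : Rˣ) : R) • ((((p.1⁻¹ : GL (Fin 4) R) : Matrix (Fin 4) (Fin 4) R).transpose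
            * (p.1 : Matrix (Fin 4) (Fin 4) R).transpose) * J R
            * ((p.1 : Matrix (Fin 4) (Fin 4) R)
              * ((p.1⁻¹ : GL (Fin 4) R) : Matrix (Fin 4) (Fin 4) R))) := by
        simp only [Matrix.mul_smul, Matrix.smul_mul, Matrix.mul_assoc]
      _ = _ := by rw [h1, h2, Matrix.one_mul, Matrix.mul_one]

/-- The symplectic multiplier. -/
def mult : GSp4 R →* Rˣ := (MonoidHom.snd _ _).comp (GSp4 R).subtype

/-- `G = GSp₄ ×_{GL₁} GL₂`, the fibre product over the multiplier and the determinant. -/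
def G : Subgroup (GSp4 R × GL (Fin 2) R) :=
  ((mult R).comp (MonoidHom.fst _ _)).eqLocus
    ((Matrix.GeneralLinearGroup.det).comp (MonoidHom.snd _ _))

/-- The projection of `G` to `GSp₄`. -/
def pr₁ : G R →* GSp4 R := (MonoidHom.fst _ _).comp (G R).subtype

/-- The projection of `G` to `GL₂`. -/
def pr₂ : G R →* GL (Fin 2) R := (MonoidHom.snd _ _).comp (G R).subtype

variable {R}

/-- The matrix underlying an element of `GSp₄`. -/
def mat (g : GSp4 R) : Matrix (Fin 4) (Fin 4) R := (g.1.1 : Matrix (Fin 4) (Fin 4) R)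

/-- An invertible diagonal matrix. -/
def diagGL {n : Type*} [Fintype n] [DecidableEq n] (a : n → Rˣ) : GL n R where
  val := Matrix.diagonal fun i => (a i : R)
  inv := Matrix.diagonal fun i => ((a i)⁻¹ : Rˣ)
  val_inv := by simp [Matrix.diagonal_mul_diagonal]
  inv_val := by simp [Matrix.diagonal_mul_diagonal]

/-- `diag(a, b, c, d)` in `GSp₄`, where `ad = bc`. -/
def diagGSp4 (a b c d : Rˣ) (h : a * d = b * c) : GSp4 R :=
  ⟨(diagGL ![a, b, c, d], a * d), by
    have h' : (a : R) * d = b * c := by exact_mod_cast congrArg Units.val h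
    change (Matrix.diagonal _).transpose * J R * Matrix.diagonal _ = _
    ext i j
    rw [Matrix.mul_diagonal, Matrix.diagonal_transpose, Matrix.diagonal_mul]
    fin_cases i <;> fin_cases j <;> simp [J, h', mul_comm]⟩

/-- `(diag(a, b, c, d), diag(e, f))` in `G`, where `ad = bc = ef`. -/
def diagG (a b c d e f : Rˣ) (h : a * d = b * c) (h' : a * d = e * f) : G R :=
  ⟨(diagGSp4 a b c d h, diagGL ![e, f]), by
    change a * d = Matrix.GeneralLinearGroup.det (diagGL ![e, f])
    rw [h']
    ext
    simp [diagGL, Matrix.det_diagonal]⟩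

end Groups

/-! ### Smooth representations and the action of the Hecke algebra -/

section Reps

variable {Γ : Type*} [Group Γ] {V : Type*} [AddCommGroup V] [Module ℂ V]

/-- Every vector is fixed by an open subgroup. -/
def IsSmooth [TopologicalSpace Γ] (ρ : Representation ℂ Γ V) : Prop :=
  ∀ v : V, ∃ U : Subgroup Γ, IsOpen (U : Set Γ) ∧ ∀ g ∈ U, ρ g v = v

/-- A smooth representation in which every open subgroup has a finite-dimensional space of fixed
vectors. -/
def IsAdmissible [TopologicalSpace Γ] (ρ : Representation ℂ Γ V) : Prop :=
  IsSmooth ρ ∧ ∀ U : Subgroup Γ, IsOpen (U : Set Γ) →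
    FiniteDimensional ℂ (Representation.invariants (MonoidHom.comp ρ U.subtype))

/-- The subgroup of those `k ∈ K` that fix `v` and under whose right translation `ξ` is
invariant. -/
def heckeStab (K : Subgroup Γ) (ρ : Representation ℂ Γ V) (ξ : Γ → ℂ) (v : V) : Subgroup Γ where
  carrier := {k | k ∈ K ∧ (∀ g, ξ (g * k) = ξ g) ∧ ρ k v = v}
  one_mem' := ⟨K.one_mem, by simp, by simp⟩
  mul_mem' := by
    rintro a b ⟨ha, ha', ha''⟩ ⟨hb, hb', hb''⟩
    refine ⟨K.mul_mem ha hb, fun g => ?_, ?_⟩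
    · rw [← mul_assoc, hb', ha']
    · rw [map_mul, Module.End.mul_apply, hb'', ha'']
  inv_mem' := by
    rintro a ⟨ha, ha', ha''⟩
    refine ⟨K.inv_mem ha, fun g => ?_, ?_⟩
    · rw [← ha' (g * a⁻¹), inv_mul_cancel_right]
    · conv_lhs => rw [← ha'']
      rw [← Module.End.mul_apply, ← map_mul, inv_mul_cancel, map_one, Module.End.one_apply]

/-- The action `ξ · v = ∫ ξ(g) (g · v) dg` of a locally constant compactly supported function `ξ` on
a vector `v` of a smooth representation, for the Haar measure that gives the compact open subgroup
`K` volume `1`. The integrand `g ↦ ξ(g) (g · v)` is constant on the left cosets of the open subgroup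
`U = heckeStab K ρ ξ v` of `K`, whose volume is `1 / [K : U]`, and vanishes on all but finitely many
of them, so that the integral is the following finite sum. -/
def heckeAct (K : Subgroup Γ) (ρ : Representation ℂ Γ V) (ξ : Γ → ℂ) (v : V) : V :=
  ((heckeStab K ρ ξ v).relIndex K : ℂ)⁻¹ •
    ∑ᶠ q : Γ ⧸ heckeStab K ρ ξ v, ξ q.out • ρ q.out v

end Reps

/-! ### Compact open subgroups and Hecke operators at `ℓ` -/

section Local

variable (ℓ : ℕ) [Fact ℓ.Prime]

/-- The points of `G` over `ℤ_ℓ`, as a subgroup of the points over `ℚ_ℓ`. -/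
def GZ : Subgroup (G ℚ_[ℓ]) :=
  (((Matrix.GeneralLinearGroup.map (n := Fin 4) (algebraMap ℤ_[ℓ] ℚ_[ℓ])).range.comap
      ((MonoidHom.fst _ _).comp (GSp4 ℚ_[ℓ]).subtype)).comap (pr₁ ℚ_[ℓ])) ⊓
    ((Matrix.GeneralLinearGroup.map (n := Fin 2) (algebraMap ℤ_[ℓ] ℚ_[ℓ])).range.comap
      (pr₂ ℚ_[ℓ]))

/-- `K_{m,n}`: the `g ∈ G(ℤ_ℓ)` whose `GSp₄`-component is modulo `ℓ ^ n` in the Klingen parabolic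
subgroup, and whose multiplier is `1` modulo `ℓ ^ m`. -/
def Kmn (m n : ℕ) : Set (G ℚ_[ℓ]) :=
  {g | g ∈ GZ ℓ ∧
    (∀ p ∈ ({(1, 0), (2, 0), (3, 0), (3, 1), (3, 2)} : Set (Fin 4 × Fin 4)),
      ‖mat (pr₁ ℚ_[ℓ] g) p.1 p.2‖ ≤ (ℓ : ℝ) ^ (-(n : ℤ))) ∧
    ‖((mult ℚ_[ℓ] (pr₁ ℚ_[ℓ] g) : ℚ_[ℓ]ˣ) : ℚ_[ℓ]) - 1‖ ≤ (ℓ : ℝ) ^ (-(m : ℤ))}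

/-- The prime `ℓ` as a unit of `ℚ_ℓ`. -/
def ϖ : ℚ_[ℓ]ˣ :=
  Units.mk0 (ℓ : ℚ_[ℓ]) (Nat.cast_ne_zero.mpr (Fact.out : ℓ.Prime).ne_zero)

/-- The elements `u₀, …, u₆` of `G(ℚ_ℓ)`. -/
def u : Fin 7 → G ℚ_[ℓ]
  | 0 => diagG 1 1 1 1 1 1 (by simp) (by simp)
  | 1 => diagG (ϖ ℓ) (ϖ ℓ) 1 1 (ϖ ℓ) 1 (by simp) (by simp)
  | 2 => diagG (ϖ ℓ ^ 2) (ϖ ℓ) (ϖ ℓ) 1 (ϖ ℓ) (ϖ ℓ) (by simp [pow_two]) (by simp [pow_two])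
  | 3 => diagG (ϖ ℓ ^ 2) (ϖ ℓ) (ϖ ℓ) 1 (ϖ ℓ ^ 2) 1 (by simp [pow_two]) (by simp [pow_two])
  | 4 => diagG (ϖ ℓ ^ 2) (ϖ ℓ ^ 2) 1 1 (ϖ ℓ) (ϖ ℓ) (by simp [pow_two]) (by simp [pow_two])
  | 5 => diagG (ϖ ℓ ^ 3) (ϖ ℓ ^ 2) (ϖ ℓ) 1 (ϖ ℓ ^ 2) (ϖ ℓ) (by simp [pow_succ, mul_assoc]) (by simp [pow_succ, mul_assoc])
  | 6 => diagG (ϖ ℓ ^ 4) (ϖ ℓ ^ 2) (ϖ ℓ ^ 2) 1 (ϖ ℓ ^ 2) (ϖ ℓ ^ 2) (by simp [pow_succ, mul_assoc]) (by simp [pow_succ, mul_assoc])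

/-- `U_i(ℓ)`: the characteristic function of the double coset `K_{m,n} u_i G(ℤ_ℓ)`. -/
def U (m n : ℕ) (i : Fin 7) : G ℚ_[ℓ] → ℂ :=
  Set.indicator (DoubleCoset.doubleCoset (u ℓ i) (Kmn ℓ m n) (GZ ℓ : Set (G ℚ_[ℓ]))) 1

/-- A character of `ℚ_ℓˣ` is unramified if it is trivial on `ℤ_ℓˣ`. -/
def IsUnramifiedChar (η : ℚ_[ℓ]ˣ →* ℂˣ) : Prop :=
  ∀ x : ℚ_[ℓ]ˣ, ‖(x : ℚ_[ℓ])‖ = 1 → η x = 1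

/-- An additive character of `ℚ_ℓ` is unramified if it is trivial on `ℤ_ℓ` and non-trivial on
`ℓ⁻¹ ℤ_ℓ`. -/
def IsUnramifiedAddChar (Ψ : AddChar ℚ_[ℓ] ℂ) : Prop :=
  (∀ x : ℚ_[ℓ], ‖x‖ ≤ 1 → Ψ x = 1) ∧ ∃ x : ℚ_[ℓ], ‖x‖ ≤ ℓ ∧ Ψ x ≠ 1

/-- The coefficients of the `U_i(ℓ)` in `ξ_s(ℓ)`. -/
def ξcoeff (η : ℚ_[ℓ]ˣ →* ℂˣ) (s : ℂ) : Fin 7 → ℂ :=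
  ![1,
    -((η (ϖ ℓ) : ℂ) / (ℓ : ℂ) ^ (s + 2)),
    2 * (η (ϖ ℓ) : ℂ) ^ 2 / (ℓ : ℂ) ^ (2 * s + 3),
    (η (ϖ ℓ) : ℂ) ^ 2 / (ℓ : ℂ) ^ (2 * s + 3),
    (η (ϖ ℓ) : ℂ) ^ 2 / (ℓ : ℂ) ^ (2 * s + 3),
    -((η (ϖ ℓ) : ℂ) ^ 3 / (ℓ : ℂ) ^ (3 * s + 4)),
    (η (ϖ ℓ) : ℂ) ^ 4 / (ℓ : ℂ) ^ (4 * s + 4)]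

/-- The element `ξ_s(ℓ)` of the Hecke algebra. -/
def ξ (m n : ℕ) (η : ℚ_[ℓ]ˣ →* ℂˣ) (s : ℂ) : G ℚ_[ℓ] → ℂ :=
  ∑ i, ξcoeff ℓ η s i • U ℓ m n i

/-! ### Haar measure on `ℚ_ℓˣ` -/

instance : MeasurableSpace ℚ_[ℓ]ˣ := borel _

instance : BorelSpace ℚ_[ℓ]ˣ := ⟨rfl⟩

/-- `ℤ_ℓˣ` as a compact subset of `ℚ_ℓˣ` with non-empty interior. -/
def unitsPC : TopologicalSpace.PositiveCompacts ℚ_[ℓ]ˣ where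
  carrier := {x | ‖(x : ℚ_[ℓ])‖ = 1}
  isCompact' := by
    have hc : Continuous (Units.map (algebraMap ℤ_[ℓ] ℚ_[ℓ] : ℤ_[ℓ] →* ℚ_[ℓ])) :=
      Continuous.units_map _ continuous_subtype_val
    have hr := isCompact_range hc
    convert hr using 1
    ext x
    constructor
    · intro hx
      have hx' : ‖(x : ℚ_[ℓ])‖ = 1 := hx
      have hi : ‖((x⁻¹ : ℚ_[ℓ]ˣ) : ℚ_[ℓ])‖ = 1 := by
        rw [Units.val_inv_eq_inv_val, norm_inv, hx', inv_one]
      refine ⟨⟨⟨x, hx'.le⟩, ⟨(x⁻¹ : ℚ_[ℓ]ˣ), hi.le⟩, ?_, ?_⟩, ?_⟩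
      · exact Subtype.ext x.mul_inv
      · exact Subtype.ext x.inv_mul
      · ext; rfl
    · rintro ⟨y, rfl⟩
      exact PadicInt.norm_units y
  interior_nonempty' := by
    have ho : IsOpen {x : ℚ_[ℓ]ˣ | ‖(x : ℚ_[ℓ])‖ = 1} := by
      have : {x : ℚ_[ℓ]ˣ | ‖(x : ℚ_[ℓ])‖ = 1}
          = Units.val ⁻¹' Metric.sphere (0 : ℚ_[ℓ]) 1 := by
        ext x; simp
      rw [this]
      exact (IsUltrametricDist.isOpen_sphere _ one_ne_zero).preimage Units.continuous_val
    rw [ho.interior_eq]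
    exact ⟨1, by simp⟩

/-- The Haar measure `d^×x` on `ℚ_ℓˣ` for which `ℤ_ℓˣ` has volume `1`. -/
def mulHaar : Measure ℚ_[ℓ]ˣ := Measure.haarMeasure (unitsPC ℓ)

end Local

/-! ### Whittaker functionals and the zeta integral -/

section Whittaker

variable {ℓ : ℕ} [Fact ℓ.Prime]
variable {V₁ V₂ : Type*} [AddCommGroup V₁] [Module ℂ V₁] [AddCommGroup V₂] [Module ℂ V₂]

/-- Whittaker functionals on a representation of `GSp₄(ℚ_ℓ)`: for upper unitriangular `n` with
entries `y` at `(1,2)` and `x` at `(2,3)` (counting from `1`), `W(n v) = Ψ(x + y) W(v)`. -/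
def IsWhittaker₁ (ρ : Representation ℂ (GSp4 ℚ_[ℓ]) V₁) (Ψ : AddChar ℚ_[ℓ] ℂ)
    (W : V₁ →ₗ[ℂ] ℂ) : Prop :=
  ∀ n : GSp4 ℚ_[ℓ], (∀ i, mat n i i = 1) → (∀ i j, j < i → mat n i j = 0) →
    ∀ v, W (ρ n v) = Ψ (mat n 1 2 + mat n 0 1) * W v

/-- Whittaker functionals on a representation of `GL₂(ℚ_ℓ)`, for the character `Ψ⁻¹`. -/
def IsWhittaker₂ (ρ : Representation ℂ (GL (Fin 2) ℚ_[ℓ]) V₂) (Ψ : AddChar ℚ_[ℓ] ℂ)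
    (W : V₂ →ₗ[ℂ] ℂ) : Prop :=
  ∀ n : GL (Fin 2) ℚ_[ℓ], (∀ i, n i i = 1) → (∀ i j, j < i → n i j = 0) →
    ∀ v, W (ρ n v) = (Ψ (n 0 1))⁻¹ * W v

/-- The representation `σ' ⊗ τ'` of `G(ℚ_ℓ)`. -/
def boxRep (ρ₁ : Representation ℂ (GSp4 ℚ_[ℓ]) V₁)
    (ρ₂ : Representation ℂ (GL (Fin 2) ℚ_[ℓ]) V₂) :
    Representation ℂ (G ℚ_[ℓ]) (V₁ ⊗[ℂ] V₂) :=
  Representation.tprod (MonoidHom.comp ρ₁ (pr₁ ℚ_[ℓ])) (MonoidHom.comp ρ₂ (pr₂ ℚ_[ℓ]))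

/-- The functional `v ⊗ w ↦ W₁(v) W₂(w)`. -/
def boxFunctional (W₁ : V₁ →ₗ[ℂ] ℂ) (W₂ : V₂ →ₗ[ℂ] ℂ) : V₁ ⊗[ℂ] V₂ →ₗ[ℂ] ℂ :=
  LinearMap.mul' ℂ ℂ ∘ₗ TensorProduct.map W₁ W₂

/-- The integrand of `l(Φ, η, s)`. -/
def lIntegrand (ρ₁ : Representation ℂ (GSp4 ℚ_[ℓ]) V₁)
    (ρ₂ : Representation ℂ (GL (Fin 2) ℚ_[ℓ]) V₂)
    (W₁ : V₁ →ₗ[ℂ] ℂ) (W₂ : V₂ →ₗ[ℂ] ℂ)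
    (Φ : V₁ ⊗[ℂ] V₂) (η : ℚ_[ℓ]ˣ →* ℂˣ) (s : ℂ) (z : ℚ_[ℓ]ˣ × ℚ_[ℓ]ˣ) : ℂ :=
  boxFunctional W₁ W₂
      (boxRep ρ₁ ρ₂ (diagG (z.1 * z.2) z.1 z.2 1 z.1 z.2 (by group) (by group)) Φ)
    * ((‖(z.1 : ℚ_[ℓ])‖ : ℝ) : ℂ) ^ (s - 2) * ((‖(z.2 : ℚ_[ℓ])‖ : ℝ) : ℂ) ^ s
    * (η (z.1 * z.2) : ℂ)

/-- The simplified zeta integral `l(Φ, η, s)`. -/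
def l (ρ₁ : Representation ℂ (GSp4 ℚ_[ℓ]) V₁)
    (ρ₂ : Representation ℂ (GL (Fin 2) ℚ_[ℓ]) V₂)
    (W₁ : V₁ →ₗ[ℂ] ℂ) (W₂ : V₂ →ₗ[ℂ] ℂ)
    (Φ : V₁ ⊗[ℂ] V₂) (η : ℚ_[ℓ]ˣ →* ℂˣ) (s : ℂ) : ℂ :=
  ∫ z, lIntegrand ρ₁ ρ₂ W₁ W₂ Φ η s z ∂((mulHaar ℓ).prod (mulHaar ℓ))

/-- `W_{σ'}(i, j)`, the value of the Whittaker function of `v` at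
`diag(ℓ^(i+2j), ℓ^(i+j), ℓ^j, 1)`. -/
def wGSp4 (ρ₁ : Representation ℂ (GSp4 ℚ_[ℓ]) V₁) (W₁ : V₁ →ₗ[ℂ] ℂ) (v : V₁) (i j : ℤ) : ℂ :=
  W₁ (ρ₁ (diagGSp4 (ϖ ℓ ^ (i + 2 * j)) (ϖ ℓ ^ (i + j)) (ϖ ℓ ^ j) 1 (by group)) v)

/-- `W_{τ'}(i, j)`, the value of the Whittaker function of `w` at `diag(ℓ^(i+j), ℓ^j)`. -/
def wGL2 (ρ₂ : Representation ℂ (GL (Fin 2) ℚ_[ℓ]) V₂) (W₂ : V₂ →ₗ[ℂ] ℂ) (w : V₂)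
    (i j : ℤ) : ℂ :=
  W₂ (ρ₂ (diagGL ![ϖ ℓ ^ (i + j), ϖ ℓ ^ j]) w)

/-- `X = η(ℓ) ℓ^(-s)`. -/
def X (η : ℚ_[ℓ]ˣ →* ℂˣ) (s : ℂ) : ℂ := (η (ϖ ℓ) : ℂ) * (ℓ : ℂ) ^ (-s)

/-- The term `W_{σ'}(i, j) W_{τ'}(i + a, j + b) ℓ^(2(i+j)) X^(i+2j)`. -/
def term (ρ₁ : Representation ℂ (GSp4 ℚ_[ℓ]) V₁)
    (ρ₂ : Representation ℂ (GL (Fin 2) ℚ_[ℓ]) V₂)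
    (W₁ : V₁ →ₗ[ℂ] ℂ) (W₂ : V₂ →ₗ[ℂ] ℂ) (v : V₁) (w : V₂)
    (η : ℚ_[ℓ]ˣ →* ℂˣ) (s : ℂ) (a b : ℤ) (i j : ℤ) : ℂ :=
  wGSp4 ρ₁ W₁ v i j * wGL2 ρ₂ W₂ w (i + a) (j + b) * (ℓ : ℂ) ^ (2 * (i + j))
    * X η s ^ (i + 2 * j)

/-- The double sum of `F i j` over `i ≥ a`, `j ≥ b`. -/
def dsum (a b : ℤ) (F : ℤ → ℤ → ℂ) : ℂ := ∑' i : ℕ, ∑' j : ℕ, F (a + i) (b + j)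

end Whittaker

end GSp4GL2

end

/-!
The Whittaker function `F(g) = (W_{σ'} ⊗ W_{τ'})(g (v₀ ⊗ w₀))` on `G(ℚ_ℓ)` is right invariant
under `G(ℤ_ℓ)` and transforms under upper unitriangular elements through `Ψ`. The translate of
`v₀ ⊗ w₀` by the characteristic function of a double coset `K_{m,n} u G(ℤ_ℓ)` is the sum of its
translates by representatives of the left cosets of `G(ℤ_ℓ)` contained in the double coset
(`heckeAct_cosetUnion`).

The left cosets are found by Hermite reduction. The lower triangular part of an element of
`K_{m,n}` becomes integral when it is moved across `u`, so that each coset has a representative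
in the Klingen parabolic subgroup, given by a pair of Hermite normal forms of `2 × 2` matrices,
scaled by `ℓ ^ e` and `ℓ ^ e'`, and a unipotent part (`doubleCoset_subset_cosetUnion`).
Conversely, by elementary divisors, all these representatives lie in the double coset if the two
normal forms are primitive (`klG_mem_doubleCoset`). This describes `U_i` for `i ≠ 3, 4`. For `U₃`
and `U₄` one of the normal forms has determinant `ℓ ^ 2` and can be imprimitive, namely the
scalar `ℓ`, and what is described is the union with the double coset of `u₂`; hence the sums `U₃
+ U₂` and `U₄ + U₂`.

At a diagonal element times a representative, `F` is its value at a diagonal element times a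
value of `Ψ`. Summation of the latter over the representatives gives their number or `0`, and
puts a condition on the valuations of the diagonal element
(`IsSphericalWhittaker.sum_cosetRep_aux`). As the integrand depends on valuations only, the zeta
integral becomes a sum over `ℤ × ℤ`, and a shift of the summation variables turns it into the
double sums `A`, `B`, `C` (`l_cosetUnion`). In `ξ_s` the sums `B` and `C` cancel, and what is
left of `A` is the alternating sum over the four quadrants with corners in `{0, 1}²`, that is,
the term at the origin, which is `W_{σ'}(v₀) W_{τ'}(w₀) = 1` (`hasZeta_ξ`).

The convergence rests on admissibility. On the dominant diagonal elements the Whittaker functions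
are given by powers of two Hecke operators of an Iwahori subgroup, intersected with the
stabilizer of the vector, acting on a finite-dimensional space (`exists_norm_apply_le`), because
elements of the Iwahori subgroup are products of an upper unitriangular element, which the
Whittaker functional absorbs, and a lower triangular one, which is contracted by the diagonal
elements. So the values grow at most exponentially, while `F` vanishes off the dominant cone, and
the sums converge absolutely for small `X`, which means in a right half plane. The persistence
under continuation is the identity theorem.
-/

namespace GSp4GL2

/-! ### Elements of `GSp₄` and `G` -/

section Algebra

variable {R : Type*} [CommRing R]

lemma J_mul_J : J R * J R = -1 := by
  ext i j
  fin_cases i <;> fin_cases j <;> simp [J, Matrix.mul_apply, Fin.sum_univ_four]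

/-- A matrix that preserves the form up to a unit is automatically invertible. -/
def mkGSp4 (A : Matrix (Fin 4) (Fin 4) R) (μ : Rˣ) (h : A.transpose * J R * A = (μ : R) • J R) :
    GSp4 R :=
  have h₁ : (((μ⁻¹ : Rˣ) : R) • (-(J R * A.transpose * J R))) * A = 1 := by
    rw [Matrix.smul_mul, neg_mul, Matrix.mul_assoc, Matrix.mul_assoc, ← Matrix.mul_assoc _ _ A, h,
      Matrix.mul_smul, J_mul_J, smul_neg, smul_smul, Units.inv_mul, one_smul, neg_neg]
  ⟨(⟨A, _, mul_eq_one_comm.mp h₁, h₁⟩, μ), h⟩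

@[simp] lemma mat_mkGSp4 (A : Matrix (Fin 4) (Fin 4) R) (μ : Rˣ) (h) :
    mat (mkGSp4 A μ h) = A := rfl

@[simp] lemma mult_mkGSp4 (A : Matrix (Fin 4) (Fin 4) R) (μ : Rˣ) (h) :
    mult R (mkGSp4 A μ h) = μ := rfl

lemma GSp4_ext {g h : GSp4 R} (h₁ : mat g = mat h) (h₂ : mult R g = mult R h) : g = h :=
  Subtype.ext (Prod.ext (Units.ext h₁) h₂)

@[simp] lemma mat_mul (g h : GSp4 R) : mat (g * h) = mat g * mat h := rfl

@[simp] lemma mat_one : mat (1 : GSp4 R) = 1 := rfl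

lemma mat_form (g : GSp4 R) : (mat g).transpose * J R * mat g = ((mult R g : Rˣ) : R) • J R := g.2

/-- The relations between the columns `i` and `j` of a symplectic similitude. -/
lemma mat_pairing (g : GSp4 R) (i j : Fin 4) :
    mat g 0 i * mat g 3 j + mat g 1 i * mat g 2 j - mat g 2 i * mat g 1 j - mat g 3 i * mat g 0 j
      = ((mult R g : Rˣ) : R) * J R i j := by
  have h := congrFun (congrFun (mat_form g) i) j
  rw [Matrix.smul_apply, smul_eq_mul] at h
  rw [← h]
  simp [J, Matrix.mul_apply, Fin.sum_univ_four]
  ring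

lemma mat_diagGSp4 (a b c d : Rˣ) (h) :
    mat (diagGSp4 a b c d h) = Matrix.diagonal fun i => ((![a, b, c, d] i : Rˣ) : R) := rfl

lemma mult_diagGSp4 (a b c d : Rˣ) (h) : mult R (diagGSp4 a b c d h) = a * d := rfl

lemma coe_diagGL {n : Type*} [Fintype n] [DecidableEq n] (a : n → Rˣ) :
    (diagGL a : Matrix n n R) = Matrix.diagonal fun i => (a i : R) := rfl

/-- The element of `G` with given components. -/
def mkG (g : GSp4 R) (N : GL (Fin 2) R) (h : mult R g = Matrix.GeneralLinearGroup.det N) : G R :=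
  ⟨(g, N), h⟩

@[simp] lemma pr₁_mkG (g : GSp4 R) (N : GL (Fin 2) R) (h) : pr₁ R (mkG g N h) = g := rfl

@[simp] lemma pr₂_mkG (g : GSp4 R) (N : GL (Fin 2) R) (h) : pr₂ R (mkG g N h) = N := rfl

lemma G_ext {g h : G R} (h₁ : pr₁ R g = pr₁ R h) (h₂ : pr₂ R g = pr₂ R h) : g = h :=
  Subtype.ext (Prod.ext h₁ h₂)

lemma mult_pr₁ (g : G R) : mult R (pr₁ R g) = Matrix.GeneralLinearGroup.det (pr₂ R g) := g.2

lemma G_ext_mat {g h : G R} (h₁ : mat (pr₁ R g) = mat (pr₁ R h)) (h₂ : pr₂ R g = pr₂ R h) :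
    g = h :=
  G_ext (GSp4_ext h₁ (by rw [mult_pr₁, mult_pr₁, h₂])) h₂

/-- The element of the Klingen parabolic subgroup of `GSp₄` with middle block `M`, last column
`(z, v₁, v₂, 1)` and multiplier `det M`; the rest of the first row is determined by these. -/
def kl (M : GL (Fin 2) R) (v₁ v₂ z : R) : GSp4 R :=
  mkGSp4 !![(M : Matrix (Fin 2) (Fin 2) R).det, M 1 0 * v₁ - M 0 0 * v₂, M 1 1 * v₁ - M 0 1 * v₂, z;
      0, M 0 0, M 0 1, v₁; 0, M 1 0, M 1 1, v₂; 0, 0, 0, 1]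
    (Matrix.GeneralLinearGroup.det M) (by
      ext i j
      fin_cases i <;> fin_cases j <;>
        simp [J, Matrix.mul_apply, Fin.sum_univ_four, Matrix.det_fin_two] <;> ring)

lemma mat_kl (M : GL (Fin 2) R) (v₁ v₂ z : R) : mat (kl M v₁ v₂ z) =
    !![(M : Matrix (Fin 2) (Fin 2) R).det, M 1 0 * v₁ - M 0 0 * v₂, M 1 1 * v₁ - M 0 1 * v₂, z;
      0, M 0 0, M 0 1, v₁; 0, M 1 0, M 1 1, v₂; 0, 0, 0, 1] := rfl

@[simp] lemma mult_kl (M : GL (Fin 2) R) (v₁ v₂ z : R) :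
    mult R (kl M v₁ v₂ z) = Matrix.GeneralLinearGroup.det M := rfl

lemma kl_mul (M M' : GL (Fin 2) R) (v₁ v₂ z v₁' v₂' z' : R) :
    kl M v₁ v₂ z * kl M' v₁' v₂' z' =
      kl (M * M') (M 0 0 * v₁' + M 0 1 * v₂' + v₁) (M 1 0 * v₁' + M 1 1 * v₂' + v₂)
        ((M : Matrix (Fin 2) (Fin 2) R).det * z' + (M 1 0 * v₁ - M 0 0 * v₂) * v₁'
          + (M 1 1 * v₁ - M 0 1 * v₂) * v₂' + z) := by
  refine GSp4_ext ?_ (by simp)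
  rw [mat_mul, mat_kl, mat_kl, mat_kl]
  ext i j
  fin_cases i <;> fin_cases j <;>
    simp [Matrix.mul_apply, Fin.sum_univ_four, Matrix.det_fin_two, Fin.sum_univ_two] <;> ring

/-- The element of `G` with components `kl M v₁ v₂ z` and `N`. -/
def klG (M N : GL (Fin 2) R)
    (h : Matrix.GeneralLinearGroup.det M = Matrix.GeneralLinearGroup.det N) (v₁ v₂ z : R) : G R :=
  mkG (kl M v₁ v₂ z) N h

@[simp] lemma pr₁_klG (M N : GL (Fin 2) R) (h) (v₁ v₂ z : R) :
    pr₁ R (klG M N h v₁ v₂ z) = kl M v₁ v₂ z := rfl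

@[simp] lemma pr₂_klG (M N : GL (Fin 2) R) (h) (v₁ v₂ z : R) :
    pr₂ R (klG M N h v₁ v₂ z) = N := rfl

lemma kl_diag (a b : Rˣ) : kl (diagGL ![a, b]) 0 0 0 = diagGSp4 (a * b) a b 1 (by simp) := by
  refine GSp4_ext ?_ ?_
  · rw [mat_kl, mat_diagGSp4]
    ext i j
    fin_cases i <;> fin_cases j <;> simp [coe_diagGL]
  · ext
    simp [mult_diagGSp4, coe_diagGL]

lemma klG_diag (a b c d : Rˣ) (h) (h' : a * b * 1 = c * d) :
    klG (diagGL ![a, b]) (diagGL ![c, d]) h 0 0 0 = diagG (a * b) a b 1 c d (by simp) h' :=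
  G_ext (kl_diag a b) rfl

end Algebra

/-! ### Integral elements -/

section Integral

variable {ℓ : ℕ} [Fact ℓ.Prime]

/-- Integral matrices in `GSp₄(ℚ_ℓ)` whose multiplier is a unit come from `GL₄(ℤ_ℓ)`. -/
lemma exists_map_eq_mat (g : GSp4 ℚ_[ℓ]) (h₁ : ∀ i j, ‖mat g i j‖ ≤ 1)
    (h₂ : ‖((mult ℚ_[ℓ] g : ℚ_[ℓ]ˣ) : ℚ_[ℓ])‖ = 1) :
    ∃ k : GL (Fin 4) ℤ_[ℓ],
      Matrix.GeneralLinearGroup.map (n := Fin 4) (algebraMap ℤ_[ℓ] ℚ_[ℓ]) k = g.1.1 := by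
  let A : Matrix (Fin 4) (Fin 4) ℤ_[ℓ] := Matrix.of fun i j => ⟨mat g i j, h₁ i j⟩
  have hA : A.map (algebraMap ℤ_[ℓ] ℚ_[ℓ]) = mat g := by ext i j; rfl
  let μ : ℤ_[ℓ]ˣ := PadicInt.mkUnits h₂
  have hJ : (J ℤ_[ℓ]).map (algebraMap ℤ_[ℓ] ℚ_[ℓ]) = J ℚ_[ℓ] := by
    ext i j; fin_cases i <;> fin_cases j <;> simp [J]
  have hinj : Function.Injective
      (fun B : Matrix (Fin 4) (Fin 4) ℤ_[ℓ] => B.map (algebraMap ℤ_[ℓ] ℚ_[ℓ])) :=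
    Matrix.map_injective (FaithfulSMul.algebraMap_injective ℤ_[ℓ] ℚ_[ℓ])
  have h : A.transpose * J ℤ_[ℓ] * A = (μ : ℤ_[ℓ]) • J ℤ_[ℓ] := by
    apply hinj
    simp only [Matrix.map_mul, Matrix.transpose_map, hA, hJ, mat_form]
    rw [← hJ]
    ext i j
    simp only [Matrix.smul_apply, Matrix.map_apply, smul_eq_mul, map_mul]
    rfl
  refine ⟨(mkGSp4 A μ h).1.1, ?_⟩
  ext i j
  rfl

lemma exists_map_eq_GL2 (N : GL (Fin 2) ℚ_[ℓ]) (h₁ : ∀ i j, ‖N i j‖ ≤ 1)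
    (h₂ : ‖(N : Matrix (Fin 2) (Fin 2) ℚ_[ℓ]).det‖ = 1) :
    ∃ k : GL (Fin 2) ℤ_[ℓ],
      Matrix.GeneralLinearGroup.map (n := Fin 2) (algebraMap ℤ_[ℓ] ℚ_[ℓ]) k = N := by
  let A : Matrix (Fin 2) (Fin 2) ℤ_[ℓ] := Matrix.of fun i j => ⟨N i j, h₁ i j⟩
  have hA : A.map (algebraMap ℤ_[ℓ] ℚ_[ℓ]) = N := by ext i j; rfl
  have hd : IsUnit A.det := by
    rw [PadicInt.isUnit_iff, ← h₂, ← hA, ← RingHom.mapMatrix_apply, ← RingHom.map_det]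
    rfl
  refine ⟨Matrix.GeneralLinearGroup.mk'' A hd, ?_⟩
  ext i j
  rfl

lemma norm_map_le {n : Type*} [Fintype n] [DecidableEq n] (k : GL n ℤ_[ℓ]) (i j : n) :
    ‖Matrix.GeneralLinearGroup.map (n := n) (algebraMap ℤ_[ℓ] ℚ_[ℓ]) k i j‖ ≤ 1 :=
  PadicInt.norm_le_one _

lemma norm_det_map {n : Type*} [Fintype n] [DecidableEq n] (k : GL n ℤ_[ℓ]) :
    ‖(Matrix.GeneralLinearGroup.map (n := n) (algebraMap ℤ_[ℓ] ℚ_[ℓ]) k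
      : Matrix n n ℚ_[ℓ]).det‖ = 1 := by
  have h : (Matrix.GeneralLinearGroup.map (n := n) (algebraMap ℤ_[ℓ] ℚ_[ℓ]) k
      : Matrix n n ℚ_[ℓ]).det = algebraMap ℤ_[ℓ] ℚ_[ℓ] (k : Matrix n n ℤ_[ℓ]).det := by
    rw [RingHom.map_det]; rfl
  rw [h]
  exact PadicInt.norm_units (Matrix.GeneralLinearGroup.det k)

/-- Integrality in `G` can be read off the entries and the multiplier. -/
lemma mem_GZ_iff (g : G ℚ_[ℓ]) : g ∈ GZ ℓ ↔ (∀ i j, ‖mat (pr₁ _ g) i j‖ ≤ 1) ∧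
    (∀ i j, ‖pr₂ _ g i j‖ ≤ 1) ∧ ‖((mult ℚ_[ℓ] (pr₁ _ g) : ℚ_[ℓ]ˣ) : ℚ_[ℓ])‖ = 1 := by
  constructor
  · rintro ⟨⟨k, hk⟩, ⟨k', hk'⟩⟩
    refine ⟨fun i j => ?_, fun i j => ?_, ?_⟩
    · have : mat (pr₁ _ g) i j =
        Matrix.GeneralLinearGroup.map (n := Fin 4) (algebraMap ℤ_[ℓ] ℚ_[ℓ]) k i j := by rw [hk]; rfl
      rw [this]; exact norm_map_le k i j
    · rw [← hk']; exact norm_map_le k' i j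
    · rw [mult_pr₁, ← hk']; exact norm_det_map k'
  · rintro ⟨h₁, h₂, h₃⟩
    refine ⟨exists_map_eq_mat _ h₁ h₃, exists_map_eq_GL2 _ h₂ ?_⟩
    rw [mult_pr₁] at h₃
    exact h₃

end Integral

/-! ### Arithmetic of `ℤ_ℓ` inside `ℚ_ℓ` -/

section Arithmetic

variable {ℓ : ℕ} [Fact ℓ.Prime]

lemma cast_ne_zero : (ℓ : ℚ_[ℓ]) ≠ 0 := Nat.cast_ne_zero.mpr (Fact.out : ℓ.Prime).ne_zero

lemma one_lt_cast : (1 : ℝ) < ℓ := by exact_mod_cast (Fact.out : ℓ.Prime).one_lt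

lemma norm_pow_ℓ (n : ℕ) : ‖(ℓ : ℚ_[ℓ]) ^ n‖ = (ℓ : ℝ) ^ (-(n : ℤ)) := by
  simp [zpow_neg]

lemma norm_add_le_of {x y : ℚ_[ℓ]} {r : ℝ} (hx : ‖x‖ ≤ r) (hy : ‖y‖ ≤ r) : ‖x + y‖ ≤ r :=
  (Padic.nonarchimedean x y).trans (max_le hx hy)

lemma norm_sub_le_of {x y : ℚ_[ℓ]} {r : ℝ} (hx : ‖x‖ ≤ r) (hy : ‖y‖ ≤ r) : ‖x - y‖ ≤ r := by
  rw [sub_eq_add_neg]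
  exact norm_add_le_of hx (by rwa [norm_neg])

lemma norm_mul_le_of {x y : ℚ_[ℓ]} {r : ℝ} (hx : ‖x‖ ≤ r) (hy : ‖y‖ ≤ 1) : ‖x * y‖ ≤ r := by
  rw [norm_mul]
  exact (mul_le_of_le_one_right (norm_nonneg _) hy).trans hx

lemma norm_mul_le_of' {x y : ℚ_[ℓ]} {r : ℝ} (hx : ‖x‖ ≤ 1) (hy : ‖y‖ ≤ r) : ‖x * y‖ ≤ r := by
  rw [mul_comm]
  exact norm_mul_le_of hy hx

lemma norm_natCast_le (c : ℕ) : ‖(c : ℚ_[ℓ])‖ ≤ 1 := Padic.norm_int_le_one (c : ℤ)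

lemma norm_ℓ_pow_le (n : ℕ) : ‖(ℓ : ℚ_[ℓ]) ^ n‖ ≤ 1 := by
  rw [norm_pow]
  exact pow_le_one₀ (norm_nonneg _) (norm_natCast_le ℓ)

lemma exists_eq_pow_mul {x : ℚ_[ℓ]} {n : ℕ} (h : ‖x‖ ≤ (ℓ : ℝ) ^ (-(n : ℤ))) :
    ∃ y, ‖y‖ ≤ 1 ∧ x = ℓ ^ n * y := by
  have h0 : (ℓ : ℚ_[ℓ]) ^ n ≠ 0 := pow_ne_zero _ cast_ne_zero
  refine ⟨x / ℓ ^ n, ?_, by field_simp⟩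
  rw [norm_div, norm_pow_ℓ]
  exact div_le_one_of_le₀ h (by positivity)

lemma exists_natCast_add {x : ℚ_[ℓ]} (h : ‖x‖ ≤ 1) (n : ℕ) :
    ∃ c < ℓ ^ n, ∃ y, ‖y‖ ≤ 1 ∧ x = (c : ℚ_[ℓ]) + ℓ ^ n * y := by
  obtain ⟨y, hy⟩ := Ideal.mem_span_singleton.mp (PadicInt.appr_spec n ⟨x, h⟩)
  refine ⟨PadicInt.appr ⟨x, h⟩ n, PadicInt.appr_lt _ _, y, y.2, ?_⟩
  have := congrArg (Subtype.val : ℤ_[ℓ] → ℚ_[ℓ]) hy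
  change x - ((PadicInt.appr ⟨x, h⟩ n : ℤ_[ℓ]) : ℚ_[ℓ]) = _ at this
  simp only [PadicInt.coe_mul, PadicInt.coe_pow, PadicInt.coe_natCast] at this
  linear_combination this

lemma natCast_unique {c c' n : ℕ} (hc : c < ℓ ^ n) (hc' : c' < ℓ ^ n) {y : ℚ_[ℓ]} (hy : ‖y‖ ≤ 1)
    (h : (c' : ℚ_[ℓ]) = c + ℓ ^ n * y) : c' = c := by
  have h1 : ‖((c' - c : ℤ) : ℚ_[ℓ])‖ ≤ (ℓ : ℝ) ^ (-(n : ℤ)) := by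
    push_cast
    rw [h, add_sub_cancel_left, ← norm_pow_ℓ]
    exact norm_mul_le_of le_rfl hy
  rw [Padic.norm_int_le_pow_iff_dvd] at h1
  have h2 : ((c : ℤ)) ≡ c' [ZMOD (ℓ ^ n : ℕ)] := by
    rw [Int.modEq_iff_dvd]; exact_mod_cast h1
  rw [Int.natCast_modEq_iff] at h2
  exact (Nat.ModEq.eq_of_lt_of_lt h2 hc hc').symm

lemma exists_norm_eq {x : ℚ_[ℓ]} (h : ‖x‖ ≤ 1) (h0 : x ≠ 0) :
    ∃ n : ℕ, ‖x‖ = (ℓ : ℝ) ^ (-(n : ℤ)) := by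
  have h1 := Padic.norm_eq_zpow_neg_valuation h0
  rw [h1] at h ⊢
  have h2 : 0 ≤ x.valuation := by
    have := (zpow_le_one_iff_right₀ (one_lt_cast (ℓ := ℓ))).mp h
    omega
  obtain ⟨n, hn⟩ := Int.eq_ofNat_of_zero_le h2
  exact ⟨n, by rw [hn]⟩

lemma zpow_neg_le_iff {a b : ℕ} : (ℓ : ℝ) ^ (-(a : ℤ)) ≤ (ℓ : ℝ) ^ (-(b : ℤ)) ↔ b ≤ a := by
  rw [zpow_le_zpow_iff_right₀ one_lt_cast]
  omega

lemma pow_eq_mul_le {a b : ℕ} {y : ℚ_[ℓ]} (hy : ‖y‖ ≤ 1) (h : (ℓ : ℚ_[ℓ]) ^ a = ℓ ^ b * y) :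
    b ≤ a := by
  rw [← zpow_neg_le_iff (ℓ := ℓ), ← norm_pow_ℓ, ← norm_pow_ℓ, h]
  exact norm_mul_le_of le_rfl hy

/-! ### Hermite and Smith normal forms -/

/-- The matrix `ℓ ^ e * (ℓ ^ p, c; 0, ℓ ^ r)`, the Hermite normal form of its left coset modulo
`GL₂(ℤ_ℓ)`. -/
noncomputable def herm (ℓ : ℕ) [Fact ℓ.Prime] (e p r c : ℕ) : GL (Fin 2) ℚ_[ℓ] :=
  Matrix.GeneralLinearGroup.mkOfDetNeZero
    !![(ℓ : ℚ_[ℓ]) ^ (e + p), (ℓ : ℚ_[ℓ]) ^ e * c; 0, (ℓ : ℚ_[ℓ]) ^ (e + r)]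
    (by simp [Matrix.det_fin_two_of, (Fact.out : ℓ.Prime).ne_zero])

lemma coe_herm (e p r c : ℕ) : (herm ℓ e p r c : Matrix (Fin 2) (Fin 2) ℚ_[ℓ]) =
    !![(ℓ : ℚ_[ℓ]) ^ (e + p), (ℓ : ℚ_[ℓ]) ^ e * c; 0, (ℓ : ℚ_[ℓ]) ^ (e + r)] := rfl

lemma det_herm (e p r c : ℕ) :
    (herm ℓ e p r c : Matrix (Fin 2) (Fin 2) ℚ_[ℓ]).det = (ℓ : ℚ_[ℓ]) ^ (2 * e + (p + r)) := by
  rw [coe_herm, Matrix.det_fin_two_of]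
  ring

/-- Column reduction of an integral matrix whose lower right entry divides the lower left one. -/
lemma exists_hermite_entries_of_le {a b c d : ℚ_[ℓ]} (ha : ‖a‖ ≤ 1) (hb : ‖b‖ ≤ 1)
    (hd : ‖d‖ ≤ 1) (hcd : ‖c‖ ≤ ‖d‖) {f : ℕ}
    (hdet : ‖a * d - b * c‖ = (ℓ : ℝ) ^ (-(f : ℤ))) :
    ∃ p r m : ℕ, p + r = f ∧ m < ℓ ^ p ∧ ∃ x y z t : ℚ_[ℓ], ‖x‖ ≤ 1 ∧ ‖y‖ ≤ 1 ∧ ‖z‖ ≤ 1 ∧ ‖t‖ ≤ 1 ∧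
      a = ℓ ^ p * x + m * z ∧ b = ℓ ^ p * y + m * t ∧ c = ℓ ^ r * z ∧ d = ℓ ^ r * t := by
  have hℓ : (0 : ℝ) < ℓ := zero_lt_one.trans one_lt_cast
  have hd0 : d ≠ 0 := by
    rintro rfl
    have hc : c = 0 := by simpa using hcd
    subst hc
    simp only [mul_zero, sub_zero, norm_zero] at hdet
    exact (zpow_pos hℓ _).ne hdet
  obtain ⟨r, hr⟩ := exists_norm_eq hd hd0
  have hrf : r ≤ f := by
    rw [← zpow_neg_le_iff (ℓ := ℓ), ← hdet, ← hr]
    exact norm_sub_le_of (norm_mul_le_of' ha le_rfl) (norm_mul_le_of' hb hcd)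
  obtain ⟨p, rfl⟩ := Nat.exists_eq_add_of_le' hrf
  obtain ⟨z, hz, rfl⟩ := exists_eq_pow_mul (hcd.trans hr.le)
  obtain ⟨t, ht, rfl⟩ := exists_eq_pow_mul hr.le
  have ht1 : ‖t‖ = 1 := by
    rw [norm_mul, norm_pow_ℓ] at hr
    exact mul_eq_left₀ (zpow_pos hℓ _).ne' |>.mp hr
  have ht0 : t ≠ 0 := by rintro rfl; simp at ht1
  obtain ⟨m, hm, y, hy, hbm⟩ := exists_natCast_add (x := b / t) (by simpa [ht1] using hb) p
  have hdet' : ‖a * t - b * z‖ = (ℓ : ℝ) ^ (-(p : ℤ)) := by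
    have : a * (ℓ ^ r * t) - b * (ℓ ^ r * z) = ℓ ^ r * (a * t - b * z) := by ring
    rw [this, norm_mul, norm_pow_ℓ] at hdet
    apply mul_left_cancel₀ (zpow_pos hℓ (-(r : ℤ))).ne'
    rw [hdet, ← zpow_add₀ hℓ.ne']
    congr 1
    push_cast
    ring
  obtain ⟨x, hx, hx'⟩ := exists_eq_pow_mul hdet'.le
  have hb' : b = ℓ ^ p * (y * t) + m * t := by
    field_simp at hbm
    linear_combination hbm
  refine ⟨p, r, m, rfl, hm, x / t + y * z, y * t, z, t, ?_, norm_mul_le_of hy ht, hz, ht, ?_, hb',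
    rfl, rfl⟩
  · exact norm_add_le_of (by simpa [ht1] using hx) (norm_mul_le_of hy hz)
  · field_simp
    linear_combination hx' + z * hb'

lemma exists_hermite_entries {a b c d : ℚ_[ℓ]} (ha : ‖a‖ ≤ 1) (hb : ‖b‖ ≤ 1)
    (hc : ‖c‖ ≤ 1) (hd : ‖d‖ ≤ 1) {f : ℕ}
    (hdet : ‖a * d - b * c‖ = (ℓ : ℝ) ^ (-(f : ℤ))) :
    ∃ p r m : ℕ, p + r = f ∧ m < ℓ ^ p ∧ ∃ x y z t : ℚ_[ℓ], ‖x‖ ≤ 1 ∧ ‖y‖ ≤ 1 ∧ ‖z‖ ≤ 1 ∧ ‖t‖ ≤ 1 ∧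
      a = ℓ ^ p * x + m * z ∧ b = ℓ ^ p * y + m * t ∧ c = ℓ ^ r * z ∧ d = ℓ ^ r * t := by
  rcases le_total ‖c‖ ‖d‖ with h | h
  · exact exists_hermite_entries_of_le ha hb hd h hdet
  · rw [norm_sub_rev] at hdet
    obtain ⟨p, r, m, h1, h2, x, y, z, t, hx, hy, hz, ht, e1, e2, e3, e4⟩ :=
      exists_hermite_entries_of_le hb ha hc h hdet
    exact ⟨p, r, m, h1, h2, y, x, t, z, hy, hx, ht, hz, e2, e1, e4, e3⟩

/-- Every matrix is a Hermite normal form times an integral matrix. -/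
lemma exists_hermite (M : GL (Fin 2) ℚ_[ℓ]) {e f : ℕ}
    (hM : ∀ i j, ‖M i j‖ ≤ (ℓ : ℝ) ^ (-(e : ℤ)))
    (hdet : ‖(M : Matrix (Fin 2) (Fin 2) ℚ_[ℓ]).det‖ = (ℓ : ℝ) ^ (-((2 * e + f : ℕ) : ℤ))) :
    ∃ p r m : ℕ, p + r = f ∧ m < ℓ ^ p ∧ ∃ κ : GL (Fin 2) ℚ_[ℓ], (∀ i j, ‖κ i j‖ ≤ 1) ∧
      M = herm ℓ e p r m * κ := by
  have hℓ : (0 : ℝ) < ℓ := zero_lt_one.trans one_lt_cast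
  choose N hN hMN using fun i j => exists_eq_pow_mul (hM i j)
  have hdet' : ‖N 0 0 * N 1 1 - N 0 1 * N 1 0‖ = (ℓ : ℝ) ^ (-(f : ℤ)) := by
    have : (M : Matrix (Fin 2) (Fin 2) ℚ_[ℓ]).det
        = ℓ ^ (2 * e) * (N 0 0 * N 1 1 - N 0 1 * N 1 0) := by
      rw [Matrix.det_fin_two, hMN, hMN, hMN, hMN]; ring
    rw [this, norm_mul, norm_pow_ℓ] at hdet
    apply mul_left_cancel₀ (zpow_pos hℓ (-((2 * e : ℕ) : ℤ))).ne'
    rw [hdet, ← zpow_add₀ hℓ.ne']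
    congr 1
    push_cast
    ring
  obtain ⟨p, r, m, h1, h2, x, y, z, t, hx, hy, hz, ht, e1, e2, e3, e4⟩ :=
    exists_hermite_entries (hN 0 0) (hN 0 1) (hN 1 0) (hN 1 1) hdet'
  have hκ : ((herm ℓ e p r m)⁻¹ * M : GL (Fin 2) ℚ_[ℓ]).1 = !![x, y; z, t] := by
    have : M.1 = (herm ℓ e p r m).1 * !![x, y; z, t] := by
      ext i j
      fin_cases i <;> fin_cases j
      · simp [coe_herm, hMN, e1]; ring
      · simp [coe_herm, hMN, e2]; ring
      · simp [coe_herm, hMN, e3]; ring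
      · simp [coe_herm, hMN, e4]; ring
    rw [Units.val_mul, this, Units.inv_mul_cancel_left]
  refine ⟨p, r, m, h1, h2, (herm ℓ e p r m)⁻¹ * M, ?_, by group⟩
  intro i j
  rw [hκ]
  fin_cases i <;> fin_cases j <;> simpa

/-- Hermite normal forms of equal determinant that differ by an integral matrix are equal. -/
lemma herm_unique {e p r c p' r' c' : ℕ} (hpr : p + r = p' + r') (hc : c < ℓ ^ p)
    (hc' : c' < ℓ ^ p') {κ : Matrix (Fin 2) (Fin 2) ℚ_[ℓ]} (hκ : ∀ i j, ‖κ i j‖ ≤ 1)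
    (h : (herm ℓ e p' r' c' : Matrix (Fin 2) (Fin 2) ℚ_[ℓ]) = herm ℓ e p r c * κ) :
    p' = p ∧ r' = r ∧ c' = c := by
  have hℓ := cast_ne_zero (ℓ := ℓ)
  rw [coe_herm, coe_herm] at h
  have h10 := congrFun (congrFun h 1) 0
  have h11 := congrFun (congrFun h 1) 1
  have h00 := congrFun (congrFun h 0) 0
  have h01 := congrFun (congrFun h 0) 1
  simp [Matrix.mul_apply, hℓ] at h10 h11 h00 h01
  rw [h10, mul_zero, add_zero] at h00
  have hr := pow_eq_mul_le (hκ 1 1) h11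
  have hp := pow_eq_mul_le (hκ 0 0) h00
  obtain rfl : p' = p := by omega
  obtain rfl : r' = r := by omega
  refine ⟨rfl, rfl, natCast_unique hc hc' (hκ 0 1) ?_⟩
  have h1 : κ 1 1 = 1 := by
    have := pow_ne_zero (e + r') hℓ
    field_simp at h11
    exact h11.symm
  rw [h1] at h01
  have := pow_ne_zero e hℓ
  apply mul_left_cancel₀ this
  rw [h01]
  ring

/-- Smith normal form of a primitive Hermite normal form, with factors in `SL₂(ℤ_ℓ)`. -/
lemma exists_smith (e : ℕ) {p r c : ℕ} (h : r = 0 ∨ (p = 0 ∧ c = 0) ∨ ‖(c : ℚ_[ℓ])‖ = 1) :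
    ∃ a b : GL (Fin 2) ℚ_[ℓ], (∀ i j, ‖a i j‖ ≤ 1) ∧ (∀ i j, ‖b i j‖ ≤ 1) ∧
      Matrix.GeneralLinearGroup.det a = 1 ∧ Matrix.GeneralLinearGroup.det b = 1 ∧
      herm ℓ e p r c = a * diagGL ![ϖ ℓ ^ (e + (p + r)), ϖ ℓ ^ e] * b := by
  have hS : ∀ (A : Matrix (Fin 2) (Fin 2) ℚ_[ℓ]), A.det = 1 →
      ∃ a : GL (Fin 2) ℚ_[ℓ], a.1 = A ∧ Matrix.GeneralLinearGroup.det a = 1 := fun A hA =>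
    ⟨Matrix.GeneralLinearGroup.mkOfDetNeZero A (by simp [hA]), rfl, Units.ext hA⟩
  have key : ∀ A B : Matrix (Fin 2) (Fin 2) ℚ_[ℓ], A.det = 1 → B.det = 1 →
      (∀ i j, ‖A i j‖ ≤ 1) → (∀ i j, ‖B i j‖ ≤ 1) →
      (herm ℓ e p r c).1 = A * Matrix.diagonal ![(ℓ : ℚ_[ℓ]) ^ (e + (p + r)), (ℓ : ℚ_[ℓ]) ^ e] * B →
      ∃ a b : GL (Fin 2) ℚ_[ℓ], (∀ i j, ‖a i j‖ ≤ 1) ∧ (∀ i j, ‖b i j‖ ≤ 1) ∧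
      Matrix.GeneralLinearGroup.det a = 1 ∧ Matrix.GeneralLinearGroup.det b = 1 ∧
      herm ℓ e p r c = a * diagGL ![ϖ ℓ ^ (e + (p + r)), ϖ ℓ ^ e] * b := by
    intro A B hA hB hA' hB' h
    obtain ⟨a, rfl, ha⟩ := hS A hA
    obtain ⟨b, rfl, hb⟩ := hS B hB
    refine ⟨a, b, hA', hB', ha, hb, Units.ext ?_⟩
    rw [h, Units.val_mul, Units.val_mul, coe_diagGL]
    congr 3
    funext i
    fin_cases i <;> simp [ϖ]
  have hc := norm_natCast_le (ℓ := ℓ) c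
  rcases h with rfl | ⟨rfl, rfl⟩ | h
  · refine key !![1, (c : ℚ_[ℓ]); 0, 1] 1 (by simp [Matrix.det_fin_two]) (by simp) ?_ ?_ ?_
    · intro i j; fin_cases i <;> fin_cases j <;> simp [hc]
    · intro i j; fin_cases i <;> fin_cases j <;> simp
    · ext i j
      fin_cases i <;> fin_cases j <;> simp [coe_herm, Matrix.mul_apply, Matrix.vecMul_diagonal, mul_comm]
  · refine key !![0, 1; -1, 0] !![0, -1; 1, 0] (by simp [Matrix.det_fin_two])
      (by simp [Matrix.det_fin_two]) ?_ ?_ ?_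
    · intro i j; fin_cases i <;> fin_cases j <;> simp
    · intro i j; fin_cases i <;> fin_cases j <;> simp
    · ext i j
      fin_cases i <;> fin_cases j <;> simp [coe_herm, Matrix.mul_apply, Matrix.vecMul_diagonal]
  · have hc0 : (c : ℚ_[ℓ]) ≠ 0 := by intro h0; simp [h0] at h
    refine key !![0, (c : ℚ_[ℓ]); -(c : ℚ_[ℓ])⁻¹, (ℓ : ℚ_[ℓ]) ^ r] !![1, 0; (ℓ : ℚ_[ℓ]) ^ p / c, 1]
      (by simp [Matrix.det_fin_two, hc0]) (by simp [Matrix.det_fin_two]) ?_ ?_ ?_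
    · have := norm_ℓ_pow_le (ℓ := ℓ) r
      rw [norm_pow] at this
      intro i j; fin_cases i <;> fin_cases j <;> simp [h]
      simpa using this
    · have := norm_ℓ_pow_le (ℓ := ℓ) p
      rw [norm_pow] at this
      intro i j; fin_cases i <;> fin_cases j <;> simp [h]
      simpa using this
    · ext i j
      fin_cases i <;> fin_cases j <;> simp [coe_herm, Matrix.mul_apply, Matrix.vecMul_diagonal]
      all_goals field_simp
      all_goals ring

end Arithmetic

/-! ### Left cosets of `G(ℤ_ℓ)` in the Hecke double cosets -/

section Cosets

variable {ℓ : ℕ} [Fact ℓ.Prime]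

lemma norm_det_fin_two_le {M : Matrix (Fin 2) (Fin 2) ℚ_[ℓ]} (h : ∀ i j, ‖M i j‖ ≤ 1) :
    ‖M.det‖ ≤ 1 := by
  rw [Matrix.det_fin_two]
  exact norm_sub_le_of (norm_mul_le_of (h _ _) (h _ _)) (norm_mul_le_of (h _ _) (h _ _))

lemma norm_kl_le {M : GL (Fin 2) ℚ_[ℓ]} {v₁ v₂ z : ℚ_[ℓ]} (hM : ∀ i j, ‖M i j‖ ≤ 1)
    (h₁ : ‖v₁‖ ≤ 1) (h₂ : ‖v₂‖ ≤ 1) (hz : ‖z‖ ≤ 1) (i j : Fin 4) :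
    ‖mat (kl M v₁ v₂ z) i j‖ ≤ 1 := by
  have e1 := norm_sub_le_of (norm_mul_le_of (hM 1 0) h₁) (norm_mul_le_of (hM 0 0) h₂)
  have e2 := norm_sub_le_of (norm_mul_le_of (hM 1 1) h₁) (norm_mul_le_of (hM 0 1) h₂)
  have e3 := norm_det_fin_two_le hM
  rw [mat_kl]
  fin_cases i <;> fin_cases j <;> simp [h₁, h₂, hz, hM, e1, e2, e3]

lemma klG_mem_GZ {M N : GL (Fin 2) ℚ_[ℓ]} {v₁ v₂ z : ℚ_[ℓ]} (h) (hM : ∀ i j, ‖M i j‖ ≤ 1)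
    (hN : ∀ i j, ‖N i j‖ ≤ 1) (hdet : ‖(M : Matrix (Fin 2) (Fin 2) ℚ_[ℓ]).det‖ = 1)
    (h₁ : ‖v₁‖ ≤ 1) (h₂ : ‖v₂‖ ≤ 1) (hz : ‖z‖ ≤ 1) : klG M N h v₁ v₂ z ∈ GZ ℓ :=
  (mem_GZ_iff _).mpr ⟨norm_kl_le hM h₁ h₂ hz, hN, hdet⟩

lemma klG_mul {M N M' N' : GL (Fin 2) ℚ_[ℓ]} (h h') (v₁ v₂ z v₁' v₂' z' : ℚ_[ℓ]) :
    klG M N h v₁ v₂ z * klG M' N' h' v₁' v₂' z' =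
      klG (M * M') (N * N') (by rw [map_mul, map_mul, h, h'])
        (M 0 0 * v₁' + M 0 1 * v₂' + v₁) (M 1 0 * v₁' + M 1 1 * v₂' + v₂)
        ((M : Matrix (Fin 2) (Fin 2) ℚ_[ℓ]).det * z' + (M 1 0 * v₁ - M 0 0 * v₂) * v₁'
          + (M 1 1 * v₁ - M 0 1 * v₂) * v₂' + z) :=
  G_ext (by rw [map_mul]; exact kl_mul ..) rfl

/-- The triples `((p, r), c)` with `p + r = f` and `c < ℓ ^ p`, which index the Hermite normal
forms of determinant `ℓ ^ f`. -/
def hermIdx (ℓ f : ℕ) : Finset (Σ _ : ℕ × ℕ, ℕ) :=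
  (Finset.HasAntidiagonal.antidiagonal f).sigma fun a => Finset.range (ℓ ^ a.1)

/-- The parameters of the coset representatives `cosetRep`: two Hermite normal forms, and a vector
`(v₁, v₂)` and a scalar `z` modulo the lattices that the first of them determines. -/
def cosetIdx (ℓ e f f' : ℕ) :
    Finset (Σ _ : (Σ _ : ℕ × ℕ, ℕ) × (Σ _ : ℕ × ℕ, ℕ), ℕ × ℕ × ℕ) :=
  (hermIdx ℓ f ×ˢ hermIdx ℓ f').sigma fun a =>
    Finset.range (ℓ ^ (e + a.1.1.1)) ×ˢ Finset.range (ℓ ^ (e + a.1.1.2)) ×ˢ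
      Finset.range (ℓ ^ (2 * e + f))

open Classical in
/-- The upper triangular element of `G(ℚ_ℓ)` whose blocks are the Hermite normal forms given by the
index, scaled by `ℓ ^ e` and `ℓ ^ e'`. The value is `1` if the two determinants differ, which does
not happen for the indices in use. -/
noncomputable def cosetRep (ℓ : ℕ) [Fact ℓ.Prime] (e e' : ℕ)
    (τ : Σ _ : (Σ _ : ℕ × ℕ, ℕ) × (Σ _ : ℕ × ℕ, ℕ), ℕ × ℕ × ℕ) : G ℚ_[ℓ] :=
  if h : Matrix.GeneralLinearGroup.det (herm ℓ e τ.1.1.1.1 τ.1.1.1.2 τ.1.1.2) =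
      Matrix.GeneralLinearGroup.det (herm ℓ e' τ.1.2.1.1 τ.1.2.1.2 τ.1.2.2) then
    klG _ _ h τ.2.1 τ.2.2.1 τ.2.2.2 else 1

lemma mem_cosetIdx {e f f' p r c p' r' c' v₁ v₂ z : ℕ} :
    (⟨(⟨(p, r), c⟩, ⟨(p', r'), c'⟩), (v₁, v₂, z)⟩ :
      Σ _ : (Σ _ : ℕ × ℕ, ℕ) × (Σ _ : ℕ × ℕ, ℕ), ℕ × ℕ × ℕ) ∈ cosetIdx ℓ e f f' ↔
      ((p + r = f ∧ c < ℓ ^ p) ∧ p' + r' = f' ∧ c' < ℓ ^ p') ∧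
        v₁ < ℓ ^ (e + p) ∧ v₂ < ℓ ^ (e + r) ∧ z < ℓ ^ (2 * e + f) := by
  simp [cosetIdx, hermIdx]

lemma det_herm_eq {e p r c e' p' r' c' : ℕ} (h : 2 * e + (p + r) = 2 * e' + (p' + r')) :
    Matrix.GeneralLinearGroup.det (herm ℓ e p r c) =
      Matrix.GeneralLinearGroup.det (herm ℓ e' p' r' c') := by
  refine Units.ext ?_
  change Matrix.det _ = Matrix.det _
  rw [det_herm, det_herm, h]

lemma cosetRep_eq {e p r c e' p' r' c' : ℕ} (h : 2 * e + (p + r) = 2 * e' + (p' + r'))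
    (v₁ v₂ z : ℕ) : cosetRep ℓ e e' ⟨(⟨(p, r), c⟩, ⟨(p', r'), c'⟩), (v₁, v₂, z)⟩ =
      klG (herm ℓ e p r c) (herm ℓ e' p' r' c') (det_herm_eq h) v₁ v₂ z :=
  dif_pos (det_herm_eq h)

/-- The union of the left cosets of `G(ℤ_ℓ)` represented by `cosetRep`. -/
def cosetUnion (ℓ : ℕ) [Fact ℓ.Prime] (e f e' f' : ℕ) : Set (G ℚ_[ℓ]) :=
  {g | ∃ τ ∈ cosetIdx ℓ e f f', ∃ k ∈ GZ ℓ, g = cosetRep ℓ e e' τ * k}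

lemma klG_mem_cosetUnion {e f e' f' : ℕ} (hk : 2 * e + f = 2 * e' + f')
    {M N : GL (Fin 2) ℚ_[ℓ]} (h) {v₁ v₂ z : ℚ_[ℓ]}
    (hM : ∀ i j, ‖M i j‖ ≤ (ℓ : ℝ) ^ (-(e : ℤ))) (hN : ∀ i j, ‖N i j‖ ≤ (ℓ : ℝ) ^ (-(e' : ℤ)))
    (hdet : ‖(M : Matrix (Fin 2) (Fin 2) ℚ_[ℓ]).det‖ = (ℓ : ℝ) ^ (-((2 * e + f : ℕ) : ℤ)))
    (h₁ : ‖v₁‖ ≤ 1) (h₂ : ‖v₂‖ ≤ 1) (hz : ‖z‖ ≤ 1) :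
    klG M N h v₁ v₂ z ∈ cosetUnion ℓ e f e' f' := by
  have hdet' : (M : Matrix (Fin 2) (Fin 2) ℚ_[ℓ]).det = (N : Matrix (Fin 2) (Fin 2) ℚ_[ℓ]).det :=
    congrArg Units.val h
  obtain ⟨p, r, c, rfl, hc, κ, hκ, rfl⟩ := exists_hermite M hM hdet
  obtain ⟨p', r', c', rfl, hc', κ', hκ', rfl⟩ := exists_hermite N hN (by rw [← hdet', hdet, hk])
  have hd := det_herm_eq (ℓ := ℓ) (c := c) (c' := c') hk
  obtain ⟨b₂, hb₂, x₂, hx₂, e₂⟩ := exists_natCast_add h₂ (e + r)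
  obtain ⟨b₁, hb₁, x₁, hx₁, e₁⟩ := exists_natCast_add (x := v₁ - (ℓ : ℚ_[ℓ]) ^ e * (c : ℚ_[ℓ]) * x₂)
    (norm_sub_le_of h₁ (norm_mul_le_of (norm_mul_le_of (norm_ℓ_pow_le _) (norm_natCast_le _)) hx₂))
    (e + p)
  have hz' : ‖z + (ℓ : ℚ_[ℓ]) ^ (e + p) * b₂ * x₁ -
      ((ℓ : ℚ_[ℓ]) ^ (e + r) * b₁ - (ℓ : ℚ_[ℓ]) ^ e * c * b₂) * x₂‖ ≤ 1 := by
    refine norm_sub_le_of (norm_add_le_of hz ?_) (norm_mul_le_of (norm_sub_le_of ?_ ?_) hx₂)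
    · exact norm_mul_le_of (norm_mul_le_of (norm_ℓ_pow_le _) (norm_natCast_le _)) hx₁
    · exact norm_mul_le_of (norm_ℓ_pow_le _) (norm_natCast_le _)
    · exact norm_mul_le_of (norm_mul_le_of (norm_ℓ_pow_le _) (norm_natCast_le _))
        (norm_natCast_le _)
  obtain ⟨b₃, hb₃, x₃, hx₃, e₃⟩ := exists_natCast_add hz' (2 * e + (p + r))
  have hdκ : ‖(κ : Matrix (Fin 2) (Fin 2) ℚ_[ℓ]).det‖ = 1 := by
    rw [Units.val_mul, Matrix.det_mul, det_herm, norm_mul, norm_pow_ℓ] at hdet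
    have h0 : (0 : ℝ) < (ℓ : ℝ) ^ (-((2 * e + (p + r) : ℕ) : ℤ)) :=
      zpow_pos (zero_lt_one.trans one_lt_cast) _
    exact mul_eq_left₀ h0.ne' |>.mp hdet
  have hκκ' : Matrix.GeneralLinearGroup.det κ = Matrix.GeneralLinearGroup.det κ' := by
    rw [map_mul, map_mul, hd] at h
    exact mul_left_cancel h
  refine ⟨⟨(⟨(p, r), c⟩, ⟨(p', r'), c'⟩), (b₁, b₂, b₃)⟩,
    mem_cosetIdx.mpr ⟨⟨⟨rfl, hc⟩, rfl, hc'⟩, hb₁, hb₂, hb₃⟩,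
    klG κ κ' hκκ' x₁ x₂ x₃, klG_mem_GZ _ hκ hκ' hdκ hx₁ hx₂ hx₃, ?_⟩
  rw [cosetRep_eq hk, klG_mul]
  congr 1
  · simp only [coe_herm, Matrix.of_apply, Matrix.cons_val', Matrix.cons_val_zero,
      Matrix.cons_val_one, Matrix.cons_val_fin_one]
    linear_combination e₁
  · simp only [coe_herm, Matrix.of_apply, Matrix.cons_val', Matrix.cons_val_zero,
      Matrix.cons_val_one, Matrix.cons_val_fin_one]
    linear_combination e₂
  · rw [det_herm]
    simp only [coe_herm, Matrix.of_apply, Matrix.cons_val', Matrix.cons_val_zero,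
      Matrix.cons_val_one, Matrix.cons_val_fin_one]
    linear_combination e₃

/-- Distinct indices give distinct cosets. -/
lemma cosetRep_injOn {e f e' f' : ℕ} (hk : 2 * e + f = 2 * e' + f') :
    Set.InjOn (fun τ => (cosetRep ℓ e e' τ : G ℚ_[ℓ] ⧸ GZ ℓ)) (cosetIdx ℓ e f f') := by
  rintro ⟨⟨⟨⟨p, r⟩, c⟩, ⟨⟨p', r'⟩, c'⟩⟩, ⟨v₁, v₂, z⟩⟩ hτ
    ⟨⟨⟨⟨q, t⟩, d⟩, ⟨⟨q', t'⟩, d'⟩⟩, ⟨w₁, w₂, y⟩⟩ hτ' h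
  rw [Finset.mem_coe, mem_cosetIdx] at hτ hτ'
  obtain ⟨⟨⟨hf, hc⟩, hf', hc'⟩, hv₁, hv₂, hz⟩ := hτ
  obtain ⟨⟨⟨hg, hd⟩, hg', hd'⟩, hw₁, hw₂, hy⟩ := hτ'
  simp only at h
  rw [cosetRep_eq (by omega), cosetRep_eq (by omega), QuotientGroup.eq, mem_GZ_iff] at h
  obtain ⟨h₁, h₂, -⟩ := h
  set k : G ℚ_[ℓ] := (klG (herm ℓ e p r c) (herm ℓ e' p' r' c') _ v₁ v₂ z)⁻¹ *
    klG (herm ℓ e q t d) (herm ℓ e' q' t' d') _ w₁ w₂ y with hk_def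
  have hmul : klG (herm ℓ e q t d) (herm ℓ e' q' t' d') (det_herm_eq (by omega)) (w₁ : ℚ_[ℓ]) w₂ y =
    klG (herm ℓ e p r c) (herm ℓ e' p' r' c') (det_herm_eq (by omega)) v₁ v₂ z * k := by
    rw [hk_def, mul_inv_cancel_left]
  have e₂ : herm ℓ e' q' t' d' = herm ℓ e' p' r' c' * pr₂ _ k := congrArg (pr₂ _) hmul
  obtain ⟨rfl, rfl, rfl⟩ := herm_unique (by omega) hc' hd' h₂ (congrArg Units.val e₂)
  have e₁ : mat (kl (herm ℓ e q t d) (w₁ : ℚ_[ℓ]) w₂ y)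
      = mat (kl (herm ℓ e p r c) v₁ v₂ z) * mat (pr₁ _ k) := congrArg (fun g => mat (pr₁ _ g)) hmul
  generalize mat (pr₁ _ k) = A at e₁ h₁
  rw [mat_kl, mat_kl] at e₁
  have E := fun i j => congrFun (congrFun e₁ i) j
  have r1 := (E 3 1).symm
  have r2 := (E 3 2).symm
  have r3 := (E 3 3).symm
  simp [Matrix.mul_apply, Fin.sum_univ_four] at r1 r2 r3
  have hM : (herm ℓ e q t d : Matrix (Fin 2) (Fin 2) ℚ_[ℓ]) =
      herm ℓ e p r c * !![A 1 1, A 1 2; A 2 1, A 2 2] := by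
    have e11 := E 1 1
    have e12 := E 1 2
    have e21 := E 2 1
    have e22 := E 2 2
    simp [Matrix.mul_apply, Fin.sum_univ_four, r1, r2] at e11 e12 e21 e22
    ext i j
    fin_cases i <;> fin_cases j <;> simp [Matrix.mul_apply, e11, e12, e21, e22]
  obtain ⟨rfl, rfl, rfl⟩ := herm_unique (by omega) hc hd
    (by intro i j; fin_cases i <;> fin_cases j <;> simp [h₁]) hM
  have hℓ := cast_ne_zero (ℓ := ℓ)
  have e23 := E 2 3
  simp [Matrix.mul_apply, Fin.sum_univ_four, r3, coe_herm] at e23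
  obtain rfl : w₂ = v₂ := natCast_unique hv₂ hw₂ (h₁ 2 3) (by rw [e23]; ring)
  have hA23 : A 2 3 = 0 := by simpa [hℓ] using e23
  have e13 := E 1 3
  simp [Matrix.mul_apply, Fin.sum_univ_four, r3, coe_herm, hA23] at e13
  obtain rfl : w₁ = v₁ := natCast_unique hv₁ hw₁ (h₁ 1 3) (by rw [e13]; ring)
  have hA13 : A 1 3 = 0 := by simpa [hℓ] using e13
  have e03 := E 0 3
  rw [Matrix.mul_apply, Fin.sum_univ_four, hA13, hA23, r3, det_herm] at e03
  simp at e03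
  obtain rfl : y = z := natCast_unique hz hy (h₁ 0 3) (by rw [e03, hf]; ring)
  rfl

/-- An element whose last row is `(0, 0, 0, 1)` lies in the Klingen parabolic subgroup. -/
lemma exists_eq_klG (g : G ℚ_[ℓ]) (h0 : mat (pr₁ _ g) 3 0 = 0) (h1 : mat (pr₁ _ g) 3 1 = 0)
    (h2 : mat (pr₁ _ g) 3 2 = 0) (h3 : mat (pr₁ _ g) 3 3 = 1) :
    ∃ (M : GL (Fin 2) ℚ_[ℓ]) (h : _), (M : Matrix (Fin 2) (Fin 2) ℚ_[ℓ]) =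
        !![mat (pr₁ _ g) 1 1, mat (pr₁ _ g) 1 2; mat (pr₁ _ g) 2 1, mat (pr₁ _ g) 2 2] ∧
      g = klG M (pr₂ _ g) h (mat (pr₁ _ g) 1 3) (mat (pr₁ _ g) 2 3) (mat (pr₁ _ g) 0 3) := by
  have P := mat_pairing (pr₁ _ g)
  have hμ : ((mult _ (pr₁ _ g) : ℚ_[ℓ]ˣ) : ℚ_[ℓ]) ≠ 0 := Units.ne_zero _
  have hμN := congrArg Units.val (mult_pr₁ g)
  set A := mat (pr₁ _ g) with hA
  have p03 := P 0 3
  have p12 := P 1 2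
  have p01 := P 0 1
  have p02 := P 0 2
  have p13 := P 1 3
  have p23 := P 2 3
  simp [J, h0, h1, h2, h3] at p03 p12 p01 p02 p13 p23
  set μ := ((mult _ (pr₁ _ g) : ℚ_[ℓ]ˣ) : ℚ_[ℓ])
  have a1 : A 1 0 = 0 := by
    have : A 1 0 * μ = 0 := by
      rw [← p12]; linear_combination (-A 1 2) * p01 + A 1 1 * p02
    simpa [hμ] using this
  have a2 : A 2 0 = 0 := by
    have : A 2 0 * μ = 0 := by
      rw [← p12]; linear_combination (-A 2 2) * p01 + A 2 1 * p02
    simpa [hμ] using this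
  have hdet : (!![A 1 1, A 1 2; A 2 1, A 2 2] : Matrix (Fin 2) (Fin 2) ℚ_[ℓ]).det = μ := by
    rw [Matrix.det_fin_two_of, ← p12]; ring
  obtain ⟨M, hM⟩ : ∃ M : GL (Fin 2) ℚ_[ℓ], (M : Matrix (Fin 2) (Fin 2) ℚ_[ℓ]) =
      !![A 1 1, A 1 2; A 2 1, A 2 2] :=
    ⟨Matrix.GeneralLinearGroup.mkOfDetNeZero _ (by rw [hdet]; exact hμ), rfl⟩
  have hd : Matrix.GeneralLinearGroup.det M = Matrix.GeneralLinearGroup.det (pr₂ _ g) := by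
    refine Units.ext (Eq.trans ?_ hμN)
    rw [← hdet, ← hM]
    rfl
  refine ⟨M, hd, hM, G_ext_mat ?_ rfl⟩
  rw [pr₁_klG, mat_kl, hM, hdet, ← hA]
  ext i j
  fin_cases i <;> fin_cases j <;> simp [h0, h1, h2, h3, a1, a2]
  · linear_combination p03 - A 2 3 * a1 + A 1 3 * a2
  · linear_combination p13
  · linear_combination p23

end Cosets

section DoubleCosets

variable {ℓ : ℕ} [Fact ℓ.Prime]

lemma mul_mem_cosetUnion {e f e' f' : ℕ} {g k : G ℚ_[ℓ]} (hg : g ∈ cosetUnion ℓ e f e' f')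
    (hk : k ∈ GZ ℓ) : g * k ∈ cosetUnion ℓ e f e' f' := by
  obtain ⟨τ, hτ, k', hk', rfl⟩ := hg
  exact ⟨τ, hτ, k' * k, mul_mem hk' hk, mul_assoc _ _ _⟩

/-- The lower right entry of an element of `K_{m,n}` is a unit, as its last row and its first
column vanish modulo `ℓ` away from the diagonal. -/
lemma norm_Kmn_three_three {m n : ℕ} (hn : 1 ≤ n) {k : G ℚ_[ℓ]} (hk : k ∈ Kmn ℓ m n) :
    ‖mat (pr₁ _ k) 3 3‖ = 1 := by
  obtain ⟨hGZ, h0, -⟩ := hk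
  obtain ⟨h1, -, hμ⟩ := (mem_GZ_iff _).mp hGZ
  have hlt : (ℓ : ℝ) ^ (-(n : ℤ)) < 1 := by
    apply zpow_lt_one_of_neg₀ one_lt_cast
    omega
  have P := mat_pairing (pr₁ _ k) 0 3
  have h10 := h0 (1, 0) (by simp)
  have h20 := h0 (2, 0) (by simp)
  have h30 := h0 (3, 0) (by simp)
  simp only at h10 h20 h30
  generalize mat (pr₁ _ k) = A at *
  have hs : ‖A 1 0 * A 2 3 - A 2 0 * A 1 3 - A 3 0 * A 0 3‖ ≤ (ℓ : ℝ) ^ (-(n : ℤ)) :=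
    norm_sub_le_of (norm_sub_le_of (norm_mul_le_of h10 (h1 _ _)) (norm_mul_le_of h20 (h1 _ _)))
      (norm_mul_le_of h30 (h1 _ _))
  by_contra hne
  have h33 : ‖A 0 0 * A 3 3‖ < 1 := by
    rw [norm_mul]
    exact mul_lt_one_of_nonneg_of_lt_one_right (h1 0 0) (norm_nonneg _)
      (lt_of_le_of_ne (h1 3 3) hne)
  have : ‖A 0 0 * A 3 3 + (A 1 0 * A 2 3 - A 2 0 * A 1 3 - A 3 0 * A 0 3)‖ < 1 :=
    (Padic.nonarchimedean _ _).trans_lt (max_lt h33 (hs.trans_lt hlt))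
  rw [show A 0 0 * A 3 3 + (A 1 0 * A 2 3 - A 2 0 * A 1 3 - A 3 0 * A 0 3)
    = A 0 0 * A 3 3 + A 1 0 * A 2 3 - A 2 0 * A 1 3 - A 3 0 * A 0 3 by ring, P] at this
  simp [J, hμ] at this

/-- The element of the opposite Klingen parabolic subgroup with diagonal `(β, 1, 1, β⁻¹)` and last
row `(x₁ β, x₂, x₃, β⁻¹)`. -/
noncomputable def lowerKl (β x₁ x₂ x₃ : ℚ_[ℓ]) (hβ : β ≠ 0) : G ℚ_[ℓ] :=
  mkG (mkGSp4 !![β, 0, 0, 0; -x₃ * β, 1, 0, 0; x₂ * β, 0, 1, 0; x₁ * β, x₂, x₃, β⁻¹] 1 (by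
    ext i j
    fin_cases i <;> fin_cases j <;>
      simp [J, Matrix.mul_apply, Fin.sum_univ_four, hβ] <;> ring)) 1 (by simp)

lemma lowerKl_mem_GZ {β x₁ x₂ x₃ : ℚ_[ℓ]} (hβ : β ≠ 0) (hβ' : ‖β‖ = 1) (h₁ : ‖x₁‖ ≤ 1)
    (h₂ : ‖x₂‖ ≤ 1) (h₃ : ‖x₃‖ ≤ 1) : lowerKl β x₁ x₂ x₃ hβ ∈ GZ ℓ := by
  rw [mem_GZ_iff]
  refine ⟨fun i j => ?_, fun i j => ?_, ?_⟩
  · simp only [lowerKl, pr₁_mkG, mat_mkGSp4]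
    fin_cases i <;> fin_cases j <;> simp [hβ', h₁, h₂, h₃]
  · change ‖(1 : Matrix (Fin 2) (Fin 2) ℚ_[ℓ]) i j‖ ≤ 1
    fin_cases i <;> fin_cases j <;> simp
  · change ‖((1 : ℚ_[ℓ]ˣ) : ℚ_[ℓ])‖ = 1
    simp

lemma mat_mul_diagG_mul_lowerKl (k : G ℚ_[ℓ]) (δ a b c d : ℚ_[ℓ]ˣ) (h h')
    {β : ℚ_[ℓ]} (hβ : β ≠ 0) (x₁ x₂ x₃ : ℚ_[ℓ]) (i : Fin 4) :
    mat (pr₁ _ (k * diagG δ a b 1 c d h h' * lowerKl β x₁ x₂ x₃ hβ)) i =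
      ![(mat (pr₁ _ k) i 0 * δ - mat (pr₁ _ k) i 1 * a * x₃ + mat (pr₁ _ k) i 2 * b * x₂
          + mat (pr₁ _ k) i 3 * x₁) * β,
        mat (pr₁ _ k) i 1 * a + mat (pr₁ _ k) i 3 * x₂,
        mat (pr₁ _ k) i 2 * b + mat (pr₁ _ k) i 3 * x₃, mat (pr₁ _ k) i 3 / β] := by
  have h1 : mat (pr₁ _ (diagG δ a b 1 c d h h')) =
      Matrix.diagonal ![(δ : ℚ_[ℓ]), (a : ℚ_[ℓ]), (b : ℚ_[ℓ]), 1] := by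
    refine (mat_diagGSp4 δ a b 1 h).trans ?_
    congr 1
    funext i
    fin_cases i <;> rfl
  have h2 : mat (pr₁ _ (lowerKl β x₁ x₂ x₃ hβ)) = !![β, 0, 0, 0; -x₃ * β, 1, 0, 0;
    x₂ * β, 0, 1, 0; x₁ * β, x₂, x₃, β⁻¹] := rfl
  rw [map_mul, map_mul, mat_mul, mat_mul, h1, h2]
  generalize mat (pr₁ _ k) = A
  funext j
  rw [Matrix.mul_apply]
  fin_cases j <;> simp [Fin.sum_univ_four, Matrix.mul_diagonal, div_eq_mul_inv]
  ring

/-- A lower triangular factor of `k` becomes integral on the right of a diagonal matrix with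
decreasing powers of `ℓ`, so that the coset of `k * diag` has a representative in the Klingen
parabolic subgroup. -/
lemma Kmn_mul_diagG_mem {m n : ℕ} (hn : 1 ≤ n) {k : G ℚ_[ℓ]} (hk : k ∈ Kmn ℓ m n)
    {e f e' f' : ℕ} (hef : 2 * e + f = 2 * e' + f') (δ a b c d : ℚ_[ℓ]ˣ) (h h')
    (ha : ‖(a : ℚ_[ℓ])‖ ≤ (ℓ : ℝ) ^ (-(e : ℤ))) (hb : ‖(b : ℚ_[ℓ])‖ ≤ (ℓ : ℝ) ^ (-(e : ℤ)))
    (hc : ‖(c : ℚ_[ℓ])‖ ≤ (ℓ : ℝ) ^ (-(e' : ℤ))) (hd : ‖(d : ℚ_[ℓ])‖ ≤ (ℓ : ℝ) ^ (-(e' : ℤ)))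
    (hδ : ‖(δ : ℚ_[ℓ])‖ = (ℓ : ℝ) ^ (-((2 * e + f : ℕ) : ℤ))) :
    k * diagG δ a b 1 c d h h' ∈ cosetUnion ℓ e f e' f' := by
  have h33 := norm_Kmn_three_three hn hk
  obtain ⟨h1, h2, hμ⟩ := (mem_GZ_iff _).mp hk.1
  have hle : ∀ j : ℕ, (ℓ : ℝ) ^ (-(j : ℤ)) ≤ 1 := fun j => by
    rw [← norm_pow_ℓ]; exact norm_ℓ_pow_le j
  have hC := @mat_mul_diagG_mul_lowerKl ℓ _ k δ a b c d h h'
  have hμ' : ∀ κ : G ℚ_[ℓ], mult _ (pr₁ _ κ) = 1 →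
      ‖((mult _ (pr₁ _ (k * diagG δ a b 1 c d h h' * κ)) : ℚ_[ℓ]ˣ) : ℚ_[ℓ])‖ = ‖(δ : ℚ_[ℓ])‖ := by
    intro κ hκ
    have e2 : mult _ (pr₁ _ (k * diagG δ a b 1 c d h h' * κ)) =
        mult _ (pr₁ _ k) * (δ * 1) * mult _ (pr₁ _ κ) := by
      simp only [map_mul]; rfl
    rw [e2, hκ, mul_one, mul_one, Units.val_mul, norm_mul, hμ, one_mul]
  generalize mat (pr₁ _ k) = A at *
  have hA0 : A 3 3 ≠ 0 := by intro h0; simp [h0] at h33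
  have hdiv : ∀ {x : ℚ_[ℓ]} {r : ℝ}, ‖x‖ ≤ r → ‖x / A 3 3‖ ≤ r := by
    intro x r hx; rwa [norm_div, h33, div_one]
  obtain ⟨x₁, hx₁⟩ : ∃ x, x = -A 3 0 * δ / A 3 3 := ⟨_, rfl⟩
  obtain ⟨x₂, hx₂⟩ : ∃ x, x = -A 3 1 * a / A 3 3 := ⟨_, rfl⟩
  obtain ⟨x₃, hx₃⟩ : ∃ x, x = -A 3 2 * b / A 3 3 := ⟨_, rfl⟩
  have n1 : ‖x₁‖ ≤ 1 := by
    rw [hx₁]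
    exact hdiv (norm_mul_le_of (by simpa using h1 3 0) (hδ.le.trans (hle _)))
  have n2 : ‖x₂‖ ≤ (ℓ : ℝ) ^ (-(e : ℤ)) := by
    rw [hx₂]
    exact hdiv (norm_mul_le_of' (by simpa using h1 3 1) ha)
  have n3 : ‖x₃‖ ≤ (ℓ : ℝ) ^ (-(e : ℤ)) := by
    rw [hx₃]
    exact hdiv (norm_mul_le_of' (by simpa using h1 3 2) hb)
  replace hC := hC hA0 x₁ x₂ x₃
  have hκGZ := lowerKl_mem_GZ hA0 h33 n1 (n2.trans (hle e)) (n3.trans (hle e))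
  have hgN : pr₂ _ (k * diagG δ a b 1 c d h h' * lowerKl (A 3 3) x₁ x₂ x₃ hA0) =
      pr₂ _ k * diagGL ![c, d] := by
    rw [map_mul, map_mul]
    exact mul_one _
  replace hμ' := hμ' (lowerKl (A 3 3) x₁ x₂ x₃ hA0) rfl
  suffices hgU : k * diagG δ a b 1 c d h h' * lowerKl (A 3 3) x₁ x₂ x₃ hA0 ∈
      cosetUnion ℓ e f e' f' by
    have := mul_mem_cosetUnion hgU (inv_mem hκGZ)
    rwa [mul_inv_cancel_right] at this
  generalize k * diagG δ a b 1 c d h h' * lowerKl (A 3 3) x₁ x₂ x₃ hA0 = g at *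
  have c1 : ∀ i, mat (pr₁ _ g) i 1 = A i 1 * a + A i 3 * x₂ := fun i => congrFun (hC i) 1
  have c2 : ∀ i, mat (pr₁ _ g) i 2 = A i 2 * b + A i 3 * x₃ := fun i => congrFun (hC i) 2
  have c3 : ∀ i, mat (pr₁ _ g) i 3 = A i 3 / A 3 3 := fun i => congrFun (hC i) 3
  have c0 : mat (pr₁ _ g) 3 0 = 0 := by
    refine (congrFun (hC 3) 0).trans ?_
    rw [Matrix.cons_val_zero, hx₁, hx₂, hx₃]
    field_simp
    ring
  obtain ⟨M, hMN, hM, hgM⟩ := exists_eq_klG g c0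
    (by rw [c1, hx₂]; field_simp; ring) (by rw [c2, hx₃]; field_simp; ring)
    (by rw [c3, div_self hA0])
  have b1 : ∀ i, ‖A i 1 * a + A i 3 * x₂‖ ≤ (ℓ : ℝ) ^ (-(e : ℤ)) := fun i =>
    norm_add_le_of (norm_mul_le_of' (h1 _ _) ha) (norm_mul_le_of' (h1 _ _) n2)
  have b2 : ∀ i, ‖A i 2 * b + A i 3 * x₃‖ ≤ (ℓ : ℝ) ^ (-(e : ℤ)) := fun i =>
    norm_add_le_of (norm_mul_le_of' (h1 _ _) hb) (norm_mul_le_of' (h1 _ _) n3)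
  rw [hgM]
  refine klG_mem_cosetUnion hef _ ?_ ?_ ?_ ?_ ?_ ?_
  · intro i j
    rw [hM]
    fin_cases i <;> fin_cases j
    · exact (c1 1).symm ▸ b1 1
    · exact (c2 1).symm ▸ b2 1
    · exact (c1 2).symm ▸ b1 2
    · exact (c2 2).symm ▸ b2 2
  · intro i j
    rw [hgN, Units.val_mul, coe_diagGL, Matrix.mul_diagonal]
    refine norm_mul_le_of' (h2 _ _) ?_
    fin_cases j
    · exact hc
    · exact hd
  · have e1 : (M : Matrix (Fin 2) (Fin 2) ℚ_[ℓ]).det = ((mult _ (pr₁ _ g) : ℚ_[ℓ]ˣ) : ℚ_[ℓ]) := by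
      rw [mult_pr₁, ← hMN]; rfl
    rw [e1, hμ', hδ]
  · rw [c3]; exact hdiv (h1 _ _)
  · rw [c3]; exact hdiv (h1 _ _)
  · rw [c3]; exact hdiv (h1 _ _)

lemma doubleCoset_subset_cosetUnion {m n : ℕ} (hn : 1 ≤ n)
    {e f e' f' : ℕ} (hef : 2 * e + f = 2 * e' + f') (δ a b c d : ℚ_[ℓ]ˣ) (h h')
    (ha : ‖(a : ℚ_[ℓ])‖ ≤ (ℓ : ℝ) ^ (-(e : ℤ))) (hb : ‖(b : ℚ_[ℓ])‖ ≤ (ℓ : ℝ) ^ (-(e : ℤ)))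
    (hc : ‖(c : ℚ_[ℓ])‖ ≤ (ℓ : ℝ) ^ (-(e' : ℤ))) (hd : ‖(d : ℚ_[ℓ])‖ ≤ (ℓ : ℝ) ^ (-(e' : ℤ)))
    (hδ : ‖(δ : ℚ_[ℓ])‖ = (ℓ : ℝ) ^ (-((2 * e + f : ℕ) : ℤ))) :
    DoubleCoset.doubleCoset (diagG δ a b 1 c d h h') (Kmn ℓ m n) (GZ ℓ : Set (G ℚ_[ℓ])) ⊆
      cosetUnion ℓ e f e' f' := by
  intro g hg
  obtain ⟨k, hk, k', hk', rfl⟩ := DoubleCoset.mem_doubleCoset.mp hg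
  exact mul_mem_cosetUnion (Kmn_mul_diagG_mem hn hk hef δ a b c d h h' ha hb hc hd hδ) hk'

/-- The condition under which `herm ℓ e p r c` has the elementary divisors `ℓ ^ (e + p + r)` and
`ℓ ^ e`. -/
def IsPrimitive (ℓ : ℕ) [Fact ℓ.Prime] (p r c : ℕ) : Prop :=
  r = 0 ∨ (p = 0 ∧ c = 0) ∨ ‖(c : ℚ_[ℓ])‖ = 1

lemma isPrimitive_of_le_one {p r c : ℕ} (h : p + r ≤ 1) (hc : c < ℓ ^ p) :
    IsPrimitive ℓ p r c := by
  rcases Nat.eq_zero_or_pos r with hr | hr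
  · exact Or.inl hr
  · obtain rfl : p = 0 := by omega
    exact Or.inr (Or.inl ⟨rfl, by simpa using hc⟩)

lemma isPrimitive_or_of_eq_two {p r c : ℕ} (h : p + r = 2) (hc : c < ℓ ^ p) :
    IsPrimitive ℓ p r c ∨ p = 1 ∧ r = 1 ∧ c = 0 := by
  have hp : p ≤ 2 := by omega
  interval_cases p
  · exact Or.inl (Or.inr (Or.inl ⟨rfl, by simpa using hc⟩))
  · obtain rfl : r = 1 := by omega
    rcases Nat.eq_zero_or_pos c with h0 | h0
    · exact Or.inr ⟨rfl, rfl, h0⟩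
    · refine Or.inl (Or.inr (Or.inr ?_))
      rw [Padic.norm_natCast_eq_one_iff]
      exact (Nat.coprime_of_lt_prime h0.ne' (by simpa using hc) Fact.out)
  · exact Or.inl (Or.inl (by omega))

lemma herm_scalar (e : ℕ) : herm ℓ e 1 1 0 = herm ℓ (e + 1) 0 0 0 := by
  refine Units.ext ?_
  rw [coe_herm, coe_herm]
  simp

lemma klG_mem_doubleCoset (m n : ℕ) {e p r c e' p' r' c' : ℕ} (hp : IsPrimitive ℓ p r c)
    (hp' : IsPrimitive ℓ p' r' c') (h) {v₁ v₂ z : ℚ_[ℓ]}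
    (h₁ : ‖v₁‖ ≤ 1) (h₂ : ‖v₂‖ ≤ 1) (hz : ‖z‖ ≤ 1) (δ a b c₁ d₁ : ℚ_[ℓ]ˣ) (hδ hδ')
    (ha : a = ϖ ℓ ^ (e + (p + r))) (hb : b = ϖ ℓ ^ e)
    (hc : c₁ = ϖ ℓ ^ (e' + (p' + r'))) (hd : d₁ = ϖ ℓ ^ e') :
    klG (herm ℓ e p r c) (herm ℓ e' p' r' c') h v₁ v₂ z ∈
      DoubleCoset.doubleCoset (diagG δ a b 1 c₁ d₁ hδ hδ') (Kmn ℓ m n)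
        (GZ ℓ : Set (G ℚ_[ℓ])) := by
  obtain ⟨x, y, hx, hy, hdx, hdy, e₁⟩ := exists_smith e hp
  obtain ⟨x', y', hx', hy', hdx', hdy', e₂⟩ := exists_smith e' hp'
  subst ha hb hc hd
  have hD : Matrix.GeneralLinearGroup.det (diagGL ![ϖ ℓ ^ (e + (p + r)), ϖ ℓ ^ e]) =
      Matrix.GeneralLinearGroup.det (diagGL ![ϖ ℓ ^ (e' + (p' + r')), ϖ ℓ ^ e']) := by
    have := h
    rw [e₁, e₂, map_mul, map_mul, map_mul, map_mul, hdx, hdy, hdx', hdy'] at this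
    simpa using this
  obtain rfl : δ = ϖ ℓ ^ (e + (p + r)) * ϖ ℓ ^ e := by simpa using hδ
  have hdiag : diagG _ _ _ 1 _ _ hδ hδ' = klG (diagGL ![ϖ ℓ ^ (e + (p + r)), ϖ ℓ ^ e])
      (diagGL ![ϖ ℓ ^ (e' + (p' + r')), ϖ ℓ ^ e']) hD 0 0 0 := (klG_diag _ _ _ _ _ _).symm
  have hdetx : ‖(x : Matrix (Fin 2) (Fin 2) ℚ_[ℓ]).det‖ = 1 := by
    have : (x : Matrix (Fin 2) (Fin 2) ℚ_[ℓ]).det = 1 := congrArg Units.val hdx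
    rw [this, norm_one]
  have hdety : ‖(y : Matrix (Fin 2) (Fin 2) ℚ_[ℓ]).det‖ = 1 := by
    have : (y : Matrix (Fin 2) (Fin 2) ℚ_[ℓ]).det = 1 := congrArg Units.val hdy
    rw [this, norm_one]
  rw [DoubleCoset.mem_doubleCoset]
  refine ⟨klG x x' (hdx.trans hdx'.symm) v₁ v₂ z,
    ⟨klG_mem_GZ _ hx hx' hdetx h₁ h₂ hz, ?_, ?_⟩,
    klG y y' (hdy.trans hdy'.symm) 0 0 0,
    klG_mem_GZ _ hy hy' hdety (by simp) (by simp) (by simp), ?_⟩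
  · intro q hq
    rw [pr₁_klG, mat_kl]
    simp only [Set.mem_insert_iff, Set.mem_singleton_iff] at hq
    rcases hq with rfl | rfl | rfl | rfl | rfl <;> simp
  · rw [pr₁_klG, mult_kl, hdx]
    simp
  · rw [hdiag, klG_mul, klG_mul]
    congr 1 <;> simp

end DoubleCosets

section DoubleCosets

variable {ℓ : ℕ} [Fact ℓ.Prime]

lemma norm_ϖ_pow (n : ℕ) : ‖((ϖ ℓ ^ n : ℚ_[ℓ]ˣ) : ℚ_[ℓ])‖ = (ℓ : ℝ) ^ (-(n : ℤ)) := by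
  rw [Units.val_pow_eq_pow_val]
  exact norm_pow_ℓ n

lemma norm_ϖ_pow_le {n e : ℕ} (h : e ≤ n) :
    ‖((ϖ ℓ ^ n : ℚ_[ℓ]ˣ) : ℚ_[ℓ])‖ ≤ (ℓ : ℝ) ^ (-(e : ℤ)) := by
  rw [norm_ϖ_pow]
  exact zpow_neg_le_iff.mpr h

lemma doubleCoset_subset {m n : ℕ} (hn : 1 ≤ n) {e f e' f' a b c d : ℕ}
    (hef : 2 * e + f = 2 * e' + f') (δ : ℚ_[ℓ]ˣ) (h h') (ha : e ≤ a) (hb : e ≤ b) (hc : e' ≤ c)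
    (hd : e' ≤ d) (hab : a + b = 2 * e + f) :
    DoubleCoset.doubleCoset (diagG δ (ϖ ℓ ^ a) (ϖ ℓ ^ b) 1 (ϖ ℓ ^ c) (ϖ ℓ ^ d) h h') (Kmn ℓ m n)
      (GZ ℓ : Set (G ℚ_[ℓ])) ⊆ cosetUnion ℓ e f e' f' := by
  refine doubleCoset_subset_cosetUnion hn hef _ _ _ _ _ _ _ (norm_ϖ_pow_le ha) (norm_ϖ_pow_le hb)
    (norm_ϖ_pow_le hc) (norm_ϖ_pow_le hd) ?_
  rw [← hab, ← norm_ϖ_pow, pow_add, ← h, mul_one]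

lemma doubleCoset_mul_mem {m n : ℕ} {w g k : G ℚ_[ℓ]} (hk : k ∈ GZ ℓ)
    (hg : g ∈ DoubleCoset.doubleCoset w (Kmn ℓ m n) (GZ ℓ : Set (G ℚ_[ℓ]))) :
    g * k ∈ DoubleCoset.doubleCoset w (Kmn ℓ m n) (GZ ℓ : Set (G ℚ_[ℓ])) := by
  obtain ⟨x, hx, y, hy, rfl⟩ := DoubleCoset.mem_doubleCoset.mp hg
  exact DoubleCoset.mem_doubleCoset.mpr ⟨x, hx, y * k, mul_mem hy hk, mul_assoc _ _ _⟩

lemma doubleCoset_eq_cosetUnion {m n : ℕ} (hn : 1 ≤ n) {e f e' f' a b c d : ℕ}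
    (hef : 2 * e + f = 2 * e' + f') (hf : f ≤ 1) (hf' : f' ≤ 1) (δ : ℚ_[ℓ]ˣ) (h h')
    (ha : a = e + f) (hb : b = e) (hc : c = e' + f') (hd : d = e') :
    DoubleCoset.doubleCoset (diagG δ (ϖ ℓ ^ a) (ϖ ℓ ^ b) 1 (ϖ ℓ ^ c) (ϖ ℓ ^ d) h h') (Kmn ℓ m n)
      (GZ ℓ : Set (G ℚ_[ℓ])) = cosetUnion ℓ e f e' f' := by
  refine (doubleCoset_subset hn hef δ h h' (by omega) (by omega) (by omega) (by omega)
    (by omega)).antisymm ?_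
  rintro _ ⟨⟨⟨⟨⟨p, r⟩, x⟩, ⟨⟨p', r'⟩, x'⟩⟩, ⟨v₁, v₂, z⟩⟩, hτ, k, hk, rfl⟩
  obtain ⟨⟨⟨rfl, hx⟩, rfl, hx'⟩, -⟩ := mem_cosetIdx.mp hτ
  refine doubleCoset_mul_mem hk ?_
  rw [cosetRep_eq hef]
  exact klG_mem_doubleCoset m n (isPrimitive_of_le_one hf hx) (isPrimitive_of_le_one hf' hx') _
    (norm_natCast_le _) (norm_natCast_le _) (norm_natCast_le _) _ _ _ _ _ _ _
    (by subst ha; rfl) (by subst hb; rfl) (by subst_vars; rfl) (by subst_vars; rfl)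

variable {m n : ℕ}

lemma doubleCoset_u_zero (hn : 1 ≤ n) : DoubleCoset.doubleCoset (u ℓ 0) (Kmn ℓ m n)
    (GZ ℓ : Set (G ℚ_[ℓ])) = cosetUnion ℓ 0 0 0 0 := by
  rw [← doubleCoset_eq_cosetUnion (m := m) hn rfl zero_le_one zero_le_one 1 (by simp) (by simp)
    rfl rfl rfl rfl]
  simp [u]

lemma doubleCoset_u_one (hn : 1 ≤ n) : DoubleCoset.doubleCoset (u ℓ 1) (Kmn ℓ m n)
    (GZ ℓ : Set (G ℚ_[ℓ])) = cosetUnion ℓ 0 1 0 1 := by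
  rw [← doubleCoset_eq_cosetUnion (m := m) hn rfl le_rfl le_rfl (ϖ ℓ) (by simp) (by simp)
    rfl rfl rfl rfl]
  congr 1
  simp [u]

lemma doubleCoset_u_two (hn : 1 ≤ n) : DoubleCoset.doubleCoset (u ℓ 2) (Kmn ℓ m n)
    (GZ ℓ : Set (G ℚ_[ℓ])) = cosetUnion ℓ 1 0 1 0 := by
  rw [← doubleCoset_eq_cosetUnion (m := m) hn rfl zero_le_one zero_le_one (ϖ ℓ ^ 2)
    (by simp [pow_two]) (by simp [pow_two]) rfl rfl rfl rfl]
  congr 1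
  simp [u]

lemma doubleCoset_u_five (hn : 1 ≤ n) : DoubleCoset.doubleCoset (u ℓ 5) (Kmn ℓ m n)
    (GZ ℓ : Set (G ℚ_[ℓ])) = cosetUnion ℓ 1 1 1 1 := by
  rw [← doubleCoset_eq_cosetUnion (m := m) hn rfl le_rfl le_rfl (ϖ ℓ ^ 3)
    (by simp [pow_succ]) (by simp [pow_succ]) rfl rfl rfl rfl]
  congr 1
  simp [u]

lemma doubleCoset_u_six (hn : 1 ≤ n) : DoubleCoset.doubleCoset (u ℓ 6) (Kmn ℓ m n)
    (GZ ℓ : Set (G ℚ_[ℓ])) = cosetUnion ℓ 2 0 2 0 := by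
  rw [← doubleCoset_eq_cosetUnion (m := m) hn rfl zero_le_one zero_le_one (ϖ ℓ ^ 4)
    (by simp [pow_succ, mul_assoc]) (by simp [pow_succ, mul_assoc]) rfl rfl rfl rfl]
  congr 1

lemma u_two_eq : u ℓ 2 = diagG (ϖ ℓ ^ 2) (ϖ ℓ ^ 1) (ϖ ℓ ^ 1) 1 (ϖ ℓ ^ 1) (ϖ ℓ ^ 1)
    (by simp [pow_two]) (by simp [pow_two]) := by simp [u]

lemma u_three_eq : u ℓ 3 = diagG (ϖ ℓ ^ 2) (ϖ ℓ ^ 1) (ϖ ℓ ^ 1) 1 (ϖ ℓ ^ 2) (ϖ ℓ ^ 0)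
    (by simp [pow_two]) (by simp [pow_two]) := by simp [u]

lemma u_four_eq : u ℓ 4 = diagG (ϖ ℓ ^ 2) (ϖ ℓ ^ 2) (ϖ ℓ ^ 0) 1 (ϖ ℓ ^ 1) (ϖ ℓ ^ 1)
    (by simp [pow_two]) (by simp [pow_two]) := by simp [u]

/-- The integral matrices of determinant `ℓ ^ 2` in the second component form two double cosets,
according to whether they are divisible by `ℓ`. -/
lemma doubleCoset_u_three_union (hn : 1 ≤ n) :
    DoubleCoset.doubleCoset (u ℓ 3) (Kmn ℓ m n) (GZ ℓ : Set (G ℚ_[ℓ])) ∪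
      DoubleCoset.doubleCoset (u ℓ 2) (Kmn ℓ m n) (GZ ℓ : Set (G ℚ_[ℓ])) =
        cosetUnion ℓ 1 0 0 2 := by
  rw [u_two_eq, u_three_eq]
  refine (Set.union_subset ?_ ?_).antisymm ?_
  · exact doubleCoset_subset (e := 1) (f := 0) (e' := 0) (f' := 2) (a := 1) (b := 1) (c := 2) (d := 0)
      hn rfl _ _ _ (by norm_num) (by norm_num) (by norm_num)
      (by norm_num) rfl
  · exact doubleCoset_subset (e := 1) (f := 0) (e' := 0) (f' := 2) (a := 1) (b := 1) (c := 1) (d := 1)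
      hn rfl _ _ _ (by norm_num) (by norm_num) (by norm_num)
      (by norm_num) rfl
  rintro _ ⟨⟨⟨⟨⟨p, r⟩, c⟩, ⟨⟨p', r'⟩, c'⟩⟩, ⟨v₁, v₂, z⟩⟩, hτ, k, hk, rfl⟩
  obtain ⟨⟨⟨hpr, hc⟩, hpr', hc'⟩, -⟩ := mem_cosetIdx.mp hτ
  rw [cosetRep_eq (by omega)]
  obtain ⟨rfl, rfl⟩ : p = 0 ∧ r = 0 := by omega
  rcases isPrimitive_or_of_eq_two hpr' hc' with hp | ⟨rfl, rfl, rfl⟩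
  · refine Or.inl (doubleCoset_mul_mem hk ?_)
    exact klG_mem_doubleCoset m n (isPrimitive_of_le_one zero_le_one hc) hp _
      (norm_natCast_le _) (norm_natCast_le _) (norm_natCast_le _) _ _ _ _ _ _ _
      (by simp) (by simp) (by simp [hpr']) (by simp)
  · refine Or.inr (doubleCoset_mul_mem hk ?_)
    simp only [herm_scalar]
    exact klG_mem_doubleCoset m n (isPrimitive_of_le_one zero_le_one hc) (Or.inl rfl) _
      (norm_natCast_le _) (norm_natCast_le _) (norm_natCast_le _) _ _ _ _ _ _ _
      (by simp) (by simp) (by simp) (by simp)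

/-- The same as `doubleCoset_u_three_union`, for the middle block of the first component. -/
lemma doubleCoset_u_four_union (hn : 1 ≤ n) :
    DoubleCoset.doubleCoset (u ℓ 4) (Kmn ℓ m n) (GZ ℓ : Set (G ℚ_[ℓ])) ∪
      DoubleCoset.doubleCoset (u ℓ 2) (Kmn ℓ m n) (GZ ℓ : Set (G ℚ_[ℓ])) =
        cosetUnion ℓ 0 2 1 0 := by
  rw [u_two_eq, u_four_eq]
  refine (Set.union_subset ?_ ?_).antisymm ?_
  · exact doubleCoset_subset (e := 0) (f := 2) (e' := 1) (f' := 0) (a := 2) (b := 0) (c := 1) (d := 1)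
      hn rfl _ _ _ (by norm_num) (by norm_num) (by norm_num)
      (by norm_num) rfl
  · exact doubleCoset_subset (e := 0) (f := 2) (e' := 1) (f' := 0) (a := 1) (b := 1) (c := 1) (d := 1)
      hn rfl _ _ _ (by norm_num) (by norm_num) (by norm_num)
      (by norm_num) rfl
  rintro _ ⟨⟨⟨⟨⟨p, r⟩, c⟩, ⟨⟨p', r'⟩, c'⟩⟩, ⟨v₁, v₂, z⟩⟩, hτ, k, hk, rfl⟩
  obtain ⟨⟨⟨hpr, hc⟩, hpr', hc'⟩, -⟩ := mem_cosetIdx.mp hτ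
  rw [cosetRep_eq (by omega)]
  obtain ⟨rfl, rfl⟩ : p' = 0 ∧ r' = 0 := by omega
  rcases isPrimitive_or_of_eq_two hpr hc with hp | ⟨rfl, rfl, rfl⟩
  · refine Or.inl (doubleCoset_mul_mem hk ?_)
    exact klG_mem_doubleCoset m n hp (isPrimitive_of_le_one zero_le_one hc') _
      (norm_natCast_le _) (norm_natCast_le _) (norm_natCast_le _) _ _ _ _ _ _ _
      (by simp [hpr]) (by simp) (by simp) (by simp)
  · refine Or.inr (doubleCoset_mul_mem hk ?_)
    simp only [herm_scalar]
    exact klG_mem_doubleCoset m n (Or.inl rfl) (isPrimitive_of_le_one zero_le_one hc') _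
      (norm_natCast_le _) (norm_natCast_le _) (norm_natCast_le _) _ _ _ _ _ _ _
      (by simp) (by simp) (by simp) (by simp)

lemma exists_of_not_disjoint {w w' : G ℚ_[ℓ]}
    (h : ¬ Disjoint (DoubleCoset.doubleCoset w (Kmn ℓ m n) (GZ ℓ : Set (G ℚ_[ℓ])))
      (DoubleCoset.doubleCoset w' (Kmn ℓ m n) (GZ ℓ : Set (G ℚ_[ℓ])))) :
    ∃ a ∈ GZ ℓ, ∃ b ∈ GZ ℓ, w = a * w' * b := by
  obtain ⟨g, hg, hg'⟩ := Set.not_disjoint_iff.mp h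
  obtain ⟨x, hx, y, hy, rfl⟩ := DoubleCoset.mem_doubleCoset.mp hg
  obtain ⟨x', hx', y', hy', e⟩ := DoubleCoset.mem_doubleCoset.mp hg'
  refine ⟨x⁻¹ * x', mul_mem (inv_mem hx.1) hx'.1, y' * y⁻¹, mul_mem hy' (inv_mem hy), ?_⟩
  have : w = x⁻¹ * (x * w * y) * y⁻¹ := by group
  rw [this, e]
  group

lemma disjoint_u_three : Disjoint (DoubleCoset.doubleCoset (u ℓ 3) (Kmn ℓ m n)
    (GZ ℓ : Set (G ℚ_[ℓ]))) (DoubleCoset.doubleCoset (u ℓ 2) (Kmn ℓ m n)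
    (GZ ℓ : Set (G ℚ_[ℓ]))) := by
  by_contra h
  obtain ⟨a, ha, b, hb, e⟩ := exists_of_not_disjoint h
  have e2 := congrFun (congrFun (congrArg (fun g => (pr₂ _ g : Matrix (Fin 2) (Fin 2) ℚ_[ℓ])) e) 1) 1
  have e3 : (1 : ℚ_[ℓ]) = ℓ * (pr₂ _ a 1 0 * pr₂ _ b 0 1 + pr₂ _ a 1 1 * pr₂ _ b 1 1) := by
    have h1 : (pr₂ _ (u ℓ 3) : Matrix (Fin 2) (Fin 2) ℚ_[ℓ]) 1 1 = 1 := by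
      rw [u_three_eq]; change (diagGL _).1 _ _ = _; simp [coe_diagGL]
    have h2 : (pr₂ _ (u ℓ 2) : Matrix (Fin 2) (Fin 2) ℚ_[ℓ]) =
        Matrix.diagonal fun _ => (ℓ : ℚ_[ℓ]) := by
      rw [u_two_eq]; change (diagGL _).1 = _
      rw [coe_diagGL]
      congr 1
      funext i
      fin_cases i <;> simp [ϖ]
    simp only [map_mul, Units.val_mul, h1, h2] at e2
    rw [e2, Matrix.mul_apply]
    simp [Matrix.mul_diagonal]
    ring
  have h1 := ((mem_GZ_iff _).mp ha).2.1
  have h2 := ((mem_GZ_iff _).mp hb).2.1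
  have := pow_eq_mul_le (ℓ := ℓ) (a := 0) (b := 1) (norm_add_le_of
    (norm_mul_le_of (h1 1 0) (h2 0 1)) (norm_mul_le_of (h1 1 1) (h2 1 1))) (by simpa using e3)
  omega

/-- Modulo `ℓ` the first component of `u₂` has rank `1` and that of `u₄` has rank `2`: the minor on
the last two rows and columns distinguishes them. -/
lemma disjoint_u_four : Disjoint (DoubleCoset.doubleCoset (u ℓ 4) (Kmn ℓ m n)
    (GZ ℓ : Set (G ℚ_[ℓ]))) (DoubleCoset.doubleCoset (u ℓ 2) (Kmn ℓ m n)
    (GZ ℓ : Set (G ℚ_[ℓ]))) := by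
  by_contra h
  obtain ⟨a, ha, b, hb, e⟩ := exists_of_not_disjoint h
  have h1 := ((mem_GZ_iff _).mp ha).1
  have h2 := ((mem_GZ_iff _).mp hb).1
  have h4 : mat (pr₁ _ (u ℓ 4)) = Matrix.diagonal ![(ℓ : ℚ_[ℓ]) ^ 2, (ℓ : ℚ_[ℓ]) ^ 2, 1, 1] := by
    rw [u_four_eq]
    refine (mat_diagGSp4 _ _ _ _ (by simp [pow_two])).trans ?_
    congr 1
    funext i
    fin_cases i <;> simp [ϖ]
  have h3 : mat (pr₁ _ (u ℓ 2)) = Matrix.diagonal ![(ℓ : ℚ_[ℓ]) ^ 2, (ℓ : ℚ_[ℓ]), ℓ, 1] := by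
    rw [u_two_eq]
    refine (mat_diagGSp4 _ _ _ _ (by simp [pow_two])).trans ?_
    congr 1
    funext i
    fin_cases i <;> simp [ϖ]
  have e1 := congrArg (fun g => mat (pr₁ _ g)) e
  simp only [map_mul, mat_mul, h3, h4] at e1
  generalize mat (pr₁ _ a) = A at *
  generalize mat (pr₁ _ b) = B at *
  have E : ∀ i j, Matrix.diagonal ![(ℓ : ℚ_[ℓ]) ^ 2, (ℓ : ℚ_[ℓ]) ^ 2, 1, 1] i j =
      ℓ * (A i 0 * B 0 j * ℓ ^ 1 + A i 1 * B 1 j + A i 2 * B 2 j) + A i 3 * B 3 j := by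
    intro i j
    rw [e1, Matrix.mul_apply]
    simp [Fin.sum_univ_four, Matrix.mul_diagonal]
    ring
  have hS : ∀ i j, ‖A i 0 * B 0 j * (ℓ : ℚ_[ℓ]) ^ 1 + A i 1 * B 1 j + A i 2 * B 2 j‖ ≤ 1 :=
    fun i j => norm_add_le_of (norm_add_le_of
      (norm_mul_le_of (norm_mul_le_of (h1 _ _) (h2 _ _)) (norm_ℓ_pow_le 1))
      (norm_mul_le_of (h1 _ _) (h2 _ _))) (norm_mul_le_of (h1 _ _) (h2 _ _))
  obtain ⟨S, hSd⟩ : ∃ S : Fin 4 → Fin 4 → ℚ_[ℓ], S = fun i j =>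
    A i 0 * B 0 j * (ℓ : ℚ_[ℓ]) ^ 1 + A i 1 * B 1 j + A i 2 * B 2 j := ⟨_, rfl⟩
  have hS' : ∀ i j, ‖S i j‖ ≤ 1 := fun i j => by rw [hSd]; exact hS i j
  have E' : ∀ i j, Matrix.diagonal ![(ℓ : ℚ_[ℓ]) ^ 2, (ℓ : ℚ_[ℓ]) ^ 2, 1, 1] i j =
      ℓ * S i j + A i 3 * B 3 j := fun i j => by rw [E, hSd]
  have e22 := E' 2 2
  have e33 := E' 3 3
  have e23 := E' 2 3
  have e32 := E' 3 2
  simp at e22 e33 e23 e32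
  have key : (1 : ℚ_[ℓ]) = ℓ * (S 2 2 + A 2 3 * B 3 2 * S 3 3 - S 2 3 * (A 3 3 * B 3 2)) := by
    linear_combination e22 + A 2 3 * B 3 2 * e33 - (A 3 3 * B 3 2) * e23
  have hfin := norm_sub_le_of (norm_add_le_of (hS' 2 2)
    (norm_mul_le_of (norm_mul_le_of (h1 2 3) (h2 3 2)) (hS' 3 3)))
    (norm_mul_le_of (hS' 2 3) (norm_mul_le_of (h1 3 3) (h2 3 2)))
  have := pow_eq_mul_le (ℓ := ℓ) (a := 0) (b := 1) hfin (by simpa using key)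
  omega

lemma U_three_add_U_two (hn : 1 ≤ n) :
    U ℓ m n 3 + U ℓ m n 2 = Set.indicator (cosetUnion ℓ 1 0 0 2) 1 := by
  rw [← doubleCoset_u_three_union (m := m) hn, Set.indicator_union_of_disjoint disjoint_u_three]
  rfl

lemma U_four_add_U_two (hn : 1 ≤ n) :
    U ℓ m n 4 + U ℓ m n 2 = Set.indicator (cosetUnion ℓ 0 2 1 0) 1 := by
  rw [← doubleCoset_u_four_union (m := m) hn, Set.indicator_union_of_disjoint disjoint_u_four]
  rfl

end DoubleCosets

/-! ### The Hecke action on invariant vectors -/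

section Hecke

variable {Γ : Type*} [Group Γ] {V : Type*} [AddCommGroup V] [Module ℂ V]
  {K : Subgroup Γ} {ρ : Representation ℂ Γ V} {v : V}

/-- For a `K`-invariant vector and a right `K`-invariant function the stabilizer in the definition
of `heckeAct` is `K` itself. -/
lemma heckeAct_eq_finsum {ξ : Γ → ℂ} (hξ : ∀ g, ∀ k ∈ K, ξ (g * k) = ξ g)
    (hv : ∀ k ∈ K, ρ k v = v) :
    heckeAct K ρ ξ v = ∑ᶠ q : Γ ⧸ K, ξ q.out • ρ q.out v := by
  have h : heckeStab K ρ ξ v = K :=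
    le_antisymm (fun k hk => hk.1) fun k hk => ⟨hk, fun g => hξ g k hk, hv k hk⟩
  rw [heckeAct, h, Subgroup.relIndex_self]
  simp

lemma heckeAct_indicator {ι : Type*} {s : Finset ι} {γ : ι → Γ}
    (hγ : Set.InjOn (fun i => (γ i : Γ ⧸ K)) s) (hv : ∀ k ∈ K, ρ k v = v) :
    heckeAct K ρ (Set.indicator {g | ∃ i ∈ s, ∃ k ∈ K, g = γ i * k} 1) v =
      ∑ i ∈ s, ρ (γ i) v := by
  classical
  have hD : ∀ g, ∀ k ∈ K, g * k ∈ {g | ∃ i ∈ s, ∃ k ∈ K, g = γ i * k} ↔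
      g ∈ {g | ∃ i ∈ s, ∃ k ∈ K, g = γ i * k} := by
    intro g k hk
    constructor
    · rintro ⟨i, hi, k', hk', e⟩
      exact ⟨i, hi, k' * k⁻¹, mul_mem hk' (inv_mem hk), by rw [← mul_assoc, ← e]; group⟩
    · rintro ⟨i, hi, k', hk', rfl⟩
      exact ⟨i, hi, k' * k, mul_mem hk' hk, mul_assoc _ _ _⟩
  have hinv : ∀ g, ∀ k ∈ K,
      Set.indicator {g | ∃ i ∈ s, ∃ k ∈ K, g = γ i * k} (1 : Γ → ℂ) (g * k) =
        Set.indicator {g | ∃ i ∈ s, ∃ k ∈ K, g = γ i * k} 1 g := by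
    intro g k hk
    by_cases hg : g ∈ {g | ∃ i ∈ s, ∃ k ∈ K, g = γ i * k}
    · rw [Set.indicator_of_mem hg, Set.indicator_of_mem ((hD g k hk).mpr hg)]
      rfl
    · rw [Set.indicator_of_notMem hg, Set.indicator_of_notMem (mt (hD g k hk).mp hg)]
  rw [heckeAct_eq_finsum hinv hv,
    finsum_eq_sum_of_support_subset (s := s.image fun i => (γ i : Γ ⧸ K)), Finset.sum_image hγ]
  · refine Finset.sum_congr rfl fun i hi => ?_
    obtain ⟨k, hk⟩ := QuotientGroup.mk_out_eq_mul K (γ i)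
    rw [hk, Set.indicator_of_mem (show γ i * k ∈ {g | ∃ i ∈ s, ∃ k ∈ K, g = γ i * k} from
      ⟨i, hi, k, k.2, rfl⟩), Pi.one_apply, one_smul, map_mul,
      Module.End.mul_apply, hv k k.2]
  · intro q hq
    by_contra hne
    refine hq ?_
    have : (q.out : Γ) ∉ {g | ∃ i ∈ s, ∃ k ∈ K, g = γ i * k} := by
      rintro ⟨i, hi, k, hk, e⟩
      refine hne ?_
      rw [Finset.coe_image]
      refine ⟨i, hi, ?_⟩
      rw [← q.out_eq']
      change (γ i : Γ ⧸ K) = (q.out : Γ ⧸ K)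
      rw [e]
      exact (QuotientGroup.mk_mul_of_mem _ hk).symm
    change Set.indicator _ _ _ • _ = _
    rw [Set.indicator_of_notMem this, zero_smul]

/-- Right `K`-invariant functions that are supported on finitely many cosets of `K`. -/
def heckeFinite (K : Subgroup Γ) : Submodule ℂ (Γ → ℂ) where
  carrier := {ξ | (∀ g, ∀ k ∈ K, ξ (g * k) = ξ g) ∧
    (Function.support fun q : Γ ⧸ K => ξ q.out).Finite}
  add_mem' := by
    rintro ξ ζ ⟨h₁, h₂⟩ ⟨h₃, h₄⟩
    refine ⟨fun g k hk => by simp [h₁ g k hk, h₃ g k hk], (h₂.union h₄).subset ?_⟩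
    exact Function.support_add _ _
  zero_mem' := ⟨fun _ _ _ => rfl, by simp⟩
  smul_mem' := by
    rintro c ξ ⟨h₁, h₂⟩
    exact ⟨fun g k hk => by simp [h₁ g k hk], h₂.subset (Function.support_const_smul_subset c _)⟩

/-- The Hecke action on an invariant vector, as a linear map in the function. -/
noncomputable def heckeLinear (hv : ∀ k ∈ K, ρ k v = v) : heckeFinite K →ₗ[ℂ] V where
  toFun ξ := heckeAct K ρ ξ v
  map_add' ξ ζ := by
    rw [heckeAct_eq_finsum ξ.2.1 hv, heckeAct_eq_finsum ζ.2.1 hv,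
      heckeAct_eq_finsum (ξ + ζ).2.1 hv, ← finsum_add_distrib]
    · exact finsum_congr fun q => by simp [add_smul]
    · exact ξ.2.2.subset (Function.support_smul_subset_left _ _)
    · exact ζ.2.2.subset (Function.support_smul_subset_left _ _)
  map_smul' c ξ := by
    rw [heckeAct_eq_finsum ξ.2.1 hv, heckeAct_eq_finsum (c • ξ).2.1 hv, RingHom.id_apply,
      smul_finsum]
    exact finsum_congr fun q => by simp [mul_smul]

lemma heckeLinear_apply (hv : ∀ k ∈ K, ρ k v = v) (ξ : heckeFinite K) :
    heckeLinear hv ξ = heckeAct K ρ ξ v := rfl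

lemma indicator_mem_heckeFinite {D : Set Γ} {ι : Type*} {s : Finset ι} {γ : ι → Γ}
    (hD : ∀ g ∈ D, ∀ k ∈ K, g * k ∈ D) (hDE : D ⊆ {g | ∃ i ∈ s, ∃ k ∈ K, g = γ i * k}) :
    Set.indicator D 1 ∈ heckeFinite K := by
  classical
  refine ⟨fun g k hk => ?_, (Finset.finite_toSet (s.image fun i => (γ i : Γ ⧸ K))).subset ?_⟩
  · have : g * k ∈ D ↔ g ∈ D :=
      ⟨fun h => by simpa using hD _ h _ (inv_mem hk), fun h => hD g h k hk⟩
    simp only [Set.indicator, this]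
    rfl
  · intro q hq
    have : (q.out : Γ) ∈ D := by
      by_contra h
      exact hq (Set.indicator_of_notMem h _)
    obtain ⟨i, hi, k, hk, e⟩ := hDE this
    rw [Finset.coe_image]
    refine ⟨i, hi, ?_⟩
    rw [← q.out_eq']
    change (γ i : Γ ⧸ K) = (q.out : Γ ⧸ K)
    rw [e]
    exact (QuotientGroup.mk_mul_of_mem _ hk).symm

end Hecke

section HeckeU

variable {ℓ : ℕ} [Fact ℓ.Prime] {m n : ℕ}

lemma U_mem_heckeFinite (hn : 1 ≤ n) (i : Fin 7) : U ℓ m n i ∈ heckeFinite (GZ ℓ) := by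
  obtain ⟨e, f, e', f', h⟩ : ∃ e f e' f', DoubleCoset.doubleCoset (u ℓ i) (Kmn ℓ m n)
      (GZ ℓ : Set (G ℚ_[ℓ])) ⊆ cosetUnion ℓ e f e' f' := by
    fin_cases i
    · exact ⟨_, _, _, _, (doubleCoset_u_zero hn).subset⟩
    · exact ⟨_, _, _, _, (doubleCoset_u_one hn).subset⟩
    · exact ⟨_, _, _, _, (doubleCoset_u_two hn).subset⟩
    · exact ⟨_, _, _, _, Set.subset_union_left.trans (doubleCoset_u_three_union hn).subset⟩
    · exact ⟨_, _, _, _, Set.subset_union_left.trans (doubleCoset_u_four_union hn).subset⟩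
    · exact ⟨_, _, _, _, (doubleCoset_u_five hn).subset⟩
    · exact ⟨_, _, _, _, (doubleCoset_u_six hn).subset⟩
  exact indicator_mem_heckeFinite (fun g hg k hk => doubleCoset_mul_mem hk hg) h

lemma heckeAct_cosetUnion {V : Type*} [AddCommGroup V] [Module ℂ V]
    {ρ : Representation ℂ (G ℚ_[ℓ]) V} {v : V} (hv : ∀ k ∈ GZ ℓ, ρ k v = v) {e f e' f' : ℕ}
    (hk : 2 * e + f = 2 * e' + f') :
    heckeAct (GZ ℓ) ρ (Set.indicator (cosetUnion ℓ e f e' f') 1) v =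
      ∑ τ ∈ cosetIdx ℓ e f f', ρ (cosetRep ℓ e e' τ) v :=
  heckeAct_indicator (cosetRep_injOn hk) hv

end HeckeU

/-! ### Unramified additive characters -/

section Characters

variable {ℓ : ℕ} [Fact ℓ.Prime] {Ψ : AddChar ℚ_[ℓ] ℂ}

/-- An unramified character is trivial on `ℤ_ℓ` only. -/
lemma IsUnramifiedAddChar.eq_one_iff (hΨ : IsUnramifiedAddChar ℓ Ψ) {z : ℚ_[ℓ]} :
    Ψ z = 1 ↔ ‖z‖ ≤ 1 := by
  refine ⟨fun h => ?_, hΨ.1 z⟩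
  by_contra hz
  obtain ⟨x, hx, hne⟩ := hΨ.2
  have hz0 : z ≠ 0 := by rintro rfl; simp at hz
  -- If `‖z‖ > 1`, then `‖z‖ ≥ ℓ` and `x` is a multiple of `z` by an element of `ℤ_ℓ`.
  have hzℓ : (ℓ : ℝ) ≤ ‖z‖ := by
    have := Padic.norm_le_pow_iff_norm_lt_pow_add_one z 0
    simp only [zpow_zero, zero_add, zpow_one] at this
    exact not_lt.mp fun h => hz (this.mpr h)
  have hxz : ‖x / z‖ ≤ 1 := by
    rw [norm_div]
    exact div_le_one_of_le₀ (hx.trans hzℓ) (norm_nonneg _)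
  obtain ⟨n, hn⟩ := pow_unbounded_of_one_lt ‖z‖ (one_lt_cast (ℓ := ℓ))
  obtain ⟨c, -, y, hy, e⟩ := exists_natCast_add hxz n
  have hx' : x = c • z + z * ℓ ^ n * y := by
    rw [nsmul_eq_mul]
    field_simp at e
    linear_combination e
  have hint : ‖z * ℓ ^ n * y‖ ≤ 1 := by
    refine norm_mul_le_of ?_ hy
    rw [norm_mul, norm_pow_ℓ, zpow_neg, zpow_natCast]
    exact mul_inv_le_one_of_le₀ hn.le (by positivity)
  refine hne ?_
  rw [hx', AddChar.map_add_eq_mul, AddChar.map_nsmul_eq_pow, h, one_pow, one_mul]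
  exact hΨ.1 _ hint

lemma IsUnramifiedAddChar.sum_range (hΨ : IsUnramifiedAddChar ℓ Ψ) {z : ℚ_[ℓ]} {n : ℕ}
    (hz : ‖z * ℓ ^ n‖ ≤ 1) :
    ∑ c ∈ Finset.range (ℓ ^ n), Ψ (z * c) = if ‖z‖ ≤ 1 then (ℓ : ℂ) ^ n else 0 := by
  have h : ∀ c : ℕ, Ψ (z * c) = Ψ z ^ c := fun c => by
    rw [← AddChar.map_nsmul_eq_pow, nsmul_eq_mul, mul_comm]
  simp only [h]
  split_ifs with h1
  · simp [hΨ.1 z h1]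
  · have hne : Ψ z ≠ 1 := fun h => h1 (hΨ.eq_one_iff.mp h)
    rw [geom_sum_eq hne, ← h]
    have : Ψ (z * (ℓ ^ n : ℕ)) = 1 := by
      push_cast
      exact hΨ.1 _ hz
    rw [this, sub_self, zero_div]

lemma IsUnramifiedAddChar.sum_range_mul (hΨ : IsUnramifiedAddChar ℓ Ψ) {A B Y : ℚ_[ℓ]}
    {p p' a b k : ℕ} (hA : ‖A * ℓ ^ p‖ ≤ 1) (hB : ‖B * ℓ ^ p'‖ ≤ 1) (hY : ‖Y * ℓ ^ b‖ ≤ 1) (C : ℂ) :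
    ∑ c ∈ Finset.range (ℓ ^ p), ∑ c' ∈ Finset.range (ℓ ^ p'), ∑ _v₁ ∈ Finset.range (ℓ ^ a),
      ∑ v₂ ∈ Finset.range (ℓ ^ b), ∑ _z ∈ Finset.range (ℓ ^ k),
        Ψ (A * c) * Ψ (-B * c') * Ψ (-Y * v₂) * C =
      if ‖A‖ ≤ 1 ∧ ‖B‖ ≤ 1 ∧ ‖Y‖ ≤ 1 then (ℓ : ℂ) ^ (p + p' + (a + b) + k) * C else 0 := by
  have s1 := hΨ.sum_range hA
  have s2 := hΨ.sum_range (z := -B) (n := p') (by rwa [neg_mul, norm_neg])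
  have s3 := hΨ.sum_range (z := -Y) (n := b) (by rwa [neg_mul, norm_neg])
  rw [norm_neg] at s2 s3
  simp only [Finset.sum_const, Finset.card_range, nsmul_eq_mul, ← Finset.mul_sum,
    ← Finset.sum_mul, s1, s2, s3]
  push_cast
  by_cases h1 : ‖A‖ ≤ 1 <;> by_cases h2 : ‖B‖ ≤ 1 <;> by_cases h3 : ‖Y‖ ≤ 1 <;>
    simp only [h1, h2, h3, if_true, if_false, and_self, and_true, and_false,
      mul_zero, zero_mul]
  ring

end Characters

/-! ### Spherical Whittaker functions on `G` -/

section Whittaker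

/-- The upper unitriangular matrix with entry `s`. -/
def unip {R : Type*} [CommRing R] (s : R) : GL (Fin 2) R where
  val := !![1, s; 0, 1]
  inv := !![1, -s; 0, 1]
  val_inv := by ext i j; fin_cases i <;> fin_cases j <;> simp
  inv_val := by ext i j; fin_cases i <;> fin_cases j <;> simp

lemma coe_unip {R : Type*} [CommRing R] (s : R) :
    (unip s : Matrix (Fin 2) (Fin 2) R) = !![1, s; 0, 1] := rfl

lemma det_unip {R : Type*} [CommRing R] (s : R) :
    Matrix.GeneralLinearGroup.det (unip s) = 1 := by
  ext
  simp [coe_unip]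

lemma det_unip_eq {R : Type*} [CommRing R] (s s' : R) :
    Matrix.GeneralLinearGroup.det (unip s) = Matrix.GeneralLinearGroup.det (unip s') := by
  rw [det_unip, det_unip]

variable {ℓ : ℕ} [Fact ℓ.Prime] {Ψ : AddChar ℚ_[ℓ] ℂ} {F : G ℚ_[ℓ] → ℂ}

/-- Functions on `G(ℚ_ℓ)` that are right invariant under `G(ℤ_ℓ)` and transform under the upper
unitriangular elements on the left as the Whittaker functions of `σ' ⊗ τ'` do. -/
structure IsSphericalWhittaker (Ψ : AddChar ℚ_[ℓ] ℂ) (F : G ℚ_[ℓ] → ℂ) : Prop where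
  map_mul_right : ∀ g, ∀ k ∈ GZ ℓ, F (g * k) = F g
  map_unip_mul : ∀ (s s' v₁ v₂ z : ℚ_[ℓ]) (g : G ℚ_[ℓ]),
    F (klG (unip s) (unip s') (det_unip_eq s s') v₁ v₂ z * g) = Ψ (s - v₂) * Ψ (-s') * F g

/-- The diagonal element `(diag(ab, a, b, 1), diag(c, d))` of `G`, where `ab = cd`. -/
def torus {R : Type*} [CommRing R] (a b c d : Rˣ) (h : a * b = c * d) : G R :=
  klG (diagGL ![a, b]) (diagGL ![c, d]) (by ext; simpa [coe_diagGL] using congrArg Units.val h)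
    0 0 0

lemma torus_mul_torus {R : Type*} [CommRing R] {a b c d a' b' c' d' : Rˣ} (h h') :
    torus a b c d h * torus a' b' c' d' h' =
      torus (a * a') (b * b') (c * c') (d * d')
        (by rw [mul_mul_mul_comm, h, h', mul_mul_mul_comm]) := by
  have hd : ∀ x y x' y' : Rˣ, diagGL ![x, y] * diagGL ![x', y'] = diagGL ![x * x', y * y'] := by
    intro x y x' y'
    refine Units.ext ?_
    rw [Units.val_mul, coe_diagGL, coe_diagGL, coe_diagGL, Matrix.diagonal_mul_diagonal]
    congr 1
    funext i
    fin_cases i <;> simp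
  rw [torus, torus, torus]
  refine G_ext ?_ ?_
  · rw [map_mul, pr₁_klG, pr₁_klG, pr₁_klG, kl_mul, hd]
    simp
  · rw [map_mul, pr₂_klG, pr₂_klG, pr₂_klG, hd]

lemma torus_mem_GZ {a b c d : ℚ_[ℓ]ˣ} (h) (ha : ‖(a : ℚ_[ℓ])‖ = 1) (hb : ‖(b : ℚ_[ℓ])‖ = 1)
    (hc : ‖(c : ℚ_[ℓ])‖ = 1) (hd : ‖(d : ℚ_[ℓ])‖ = 1) : torus a b c d h ∈ GZ ℓ := by
  refine klG_mem_GZ _ ?_ ?_ ?_ (by simp) (by simp) (by simp)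
  · intro i j; rw [coe_diagGL]; fin_cases i <;> fin_cases j <;> simp [ha, hb]
  · intro i j; rw [coe_diagGL]; fin_cases i <;> fin_cases j <;> simp [hc, hd]
  · rw [coe_diagGL]; simp [ha, hb]

/-- A diagonal element times an upper triangular one. -/
lemma torus_mul_klG {a b c d : ℚ_[ℓ]ˣ} (h) (s s' v₁ v₂ z : ℚ_[ℓ]) :
    torus a b c d h * klG (unip s) (unip s') (det_unip_eq s s') v₁ v₂ z =
      klG (unip (a / b * s)) (unip (c / d * s')) (det_unip_eq _ _) (a * v₁) (b * v₂) (a * b * z) *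
        torus a b c d h := by
  have key : ∀ (x y : ℚ_[ℓ]ˣ) (t : ℚ_[ℓ]),
      diagGL ![x, y] * unip t = unip (x / y * t) * diagGL ![x, y] := by
    intro x y t
    refine Units.ext ?_
    rw [Units.val_mul, Units.val_mul, coe_diagGL, coe_unip, coe_unip]
    ext i j
    fin_cases i <;> fin_cases j <;> simp [Matrix.mul_apply]
    field_simp
  rw [torus, klG_mul, klG_mul]
  congr 1
  · exact key a b s
  · exact key c d s'
  · simp [coe_diagGL]
  · simp [coe_diagGL]
  · simp [coe_diagGL]

lemma unip_norm_le {s : ℚ_[ℓ]} (hs : ‖s‖ ≤ 1) (i j : Fin 2) : ‖unip s i j‖ ≤ 1 := by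
  rw [coe_unip]
  fin_cases i <;> fin_cases j <;> simp [hs]

lemma klG_unip_mem_GZ {s s' v₁ v₂ z : ℚ_[ℓ]} (hs : ‖s‖ ≤ 1) (hs' : ‖s'‖ ≤ 1) (h₁ : ‖v₁‖ ≤ 1)
    (h₂ : ‖v₂‖ ≤ 1) (hz : ‖z‖ ≤ 1) :
    klG (unip s) (unip s') (det_unip_eq s s') v₁ v₂ z ∈ GZ ℓ :=
  klG_mem_GZ _ (unip_norm_le hs) (unip_norm_le hs') (by rw [coe_unip]; simp) h₁ h₂ hz

/-- A spherical Whittaker function vanishes at the diagonal elements that are not dominant. -/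
lemma IsSphericalWhittaker.torus_eq_zero (hF : IsSphericalWhittaker Ψ F)
    (hΨ : IsUnramifiedAddChar ℓ Ψ) {a b c d : ℚ_[ℓ]ˣ} (h)
    (hne : ¬ (‖(b : ℚ_[ℓ])‖ ≤ 1 ∧ ‖(a / b : ℚ_[ℓ])‖ ≤ 1 ∧ ‖(c / d : ℚ_[ℓ])‖ ≤ 1)) :
    F (torus a b c d h) = 0 := by
  by_contra h0
  have key : ∀ s s' v₂ : ℚ_[ℓ], ‖s‖ ≤ 1 → ‖s'‖ ≤ 1 → ‖v₂‖ ≤ 1 →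
      Ψ (a / b * s - b * v₂) * Ψ (-(c / d * s')) = 1 := by
    intro s s' v₂ hs hs' hv
    have := hF.map_mul_right (torus a b c d h) _
      (klG_unip_mem_GZ (z := 0) (v₁ := 0) hs hs' (by simp) hv (by simp))
    rw [torus_mul_klG, hF.map_unip_mul] at this
    exact mul_eq_right₀ h0 |>.mp this
  refine hne ⟨?_, ?_, ?_⟩
  · have := key 0 0 1 (by simp) (by simp) (by simp)
    simp only [mul_zero, zero_sub, mul_one, neg_zero, AddChar.map_zero_eq_one] at this
    simpa using hΨ.eq_one_iff.mp this
  · have := key 1 0 0 (by simp) (by simp) (by simp)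
    simp only [mul_zero, sub_zero, mul_one, neg_zero, AddChar.map_zero_eq_one] at this
    exact hΨ.eq_one_iff.mp this
  · have := key 0 1 0 (by simp) (by simp) (by simp)
    simp only [mul_zero, sub_zero, mul_one, one_mul, AddChar.map_zero_eq_one] at this
    simpa using hΨ.eq_one_iff.mp this

lemma det_herm_units {e p r e' p' r' : ℕ} {x y : ℚ_[ℓ]ˣ}
    (hk : 2 * e + (p + r) = 2 * e' + (p' + r')) :
    x * ϖ ℓ ^ (e + p) * (y * ϖ ℓ ^ (e + r)) = x * ϖ ℓ ^ (e' + p') * (y * ϖ ℓ ^ (e' + r')) := by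
  rw [mul_mul_mul_comm, mul_mul_mul_comm x (ϖ ℓ ^ (e' + p')), ← pow_add, ← pow_add]
  congr 2
  omega

/-- The Iwasawa decomposition of a diagonal element times a coset representative. -/
lemma torus_mul_cosetRep {e p r c e' p' r' c' : ℕ} (hk : 2 * e + (p + r) = 2 * e' + (p' + r'))
    (v₁ v₂ z : ℕ) (x y : ℚ_[ℓ]ˣ) :
    torus x y x y rfl * cosetRep ℓ e e' ⟨(⟨(p, r), c⟩, ⟨(p', r'), c'⟩), (v₁, v₂, z)⟩ =
      klG (unip ((x / y : ℚ_[ℓ]) / ℓ ^ r * c)) (unip ((x / y : ℚ_[ℓ]) / ℓ ^ r' * c'))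
        (det_unip_eq _ _) (x * v₁) (y * v₂) (x * y * z) *
      torus (x * ϖ ℓ ^ (e + p)) (y * ϖ ℓ ^ (e + r)) (x * ϖ ℓ ^ (e' + p')) (y * ϖ ℓ ^ (e' + r'))
        (det_herm_units hk) := by
  have key : ∀ e p r c : ℕ, diagGL ![x, y] * herm ℓ e p r c =
      unip ((x / y : ℚ_[ℓ]) / ℓ ^ r * c) * diagGL ![x * ϖ ℓ ^ (e + p), y * ϖ ℓ ^ (e + r)] := by
    intro e p r c
    refine Units.ext ?_
    rw [Units.val_mul, Units.val_mul, coe_diagGL, coe_diagGL, coe_unip, coe_herm]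
    have := cast_ne_zero (ℓ := ℓ)
    ext i j
    fin_cases i <;> fin_cases j <;> simp [Matrix.mul_apply, ϖ]
    field_simp
    ring
  rw [cosetRep_eq hk, torus, torus, klG_mul, klG_mul]
  congr 1
  · exact key e p r c
  · exact key e' p' r' c'
  · simp [coe_diagGL]
  · simp [coe_diagGL]
  · simp [coe_diagGL]

/-- The sum of a spherical Whittaker function over the cosets that belong to one pair of elementary
types `(p, r)`, `(p', r')`. -/
lemma IsSphericalWhittaker.sum_cosetRep_aux (hF : IsSphericalWhittaker Ψ F)
    (hΨ : IsUnramifiedAddChar ℓ Ψ) {e p r e' p' r' : ℕ}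
    (hk : 2 * e + (p + r) = 2 * e' + (p' + r')) (x y : ℚ_[ℓ]ˣ) :
    ∑ c ∈ Finset.range (ℓ ^ p), ∑ c' ∈ Finset.range (ℓ ^ p'),
      ∑ v₁ ∈ Finset.range (ℓ ^ (e + p)), ∑ v₂ ∈ Finset.range (ℓ ^ (e + r)),
        ∑ z ∈ Finset.range (ℓ ^ (2 * e + (p + r))),
          F (torus x y x y rfl * cosetRep ℓ e e' ⟨(⟨(p, r), c⟩, ⟨(p', r'), c'⟩), (v₁, v₂, z)⟩) =
    if ‖(x / y : ℚ_[ℓ]) / ℓ ^ r‖ ≤ 1 ∧ ‖(x / y : ℚ_[ℓ]) / ℓ ^ r'‖ ≤ 1 ∧ ‖(y : ℚ_[ℓ])‖ ≤ 1 then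
      (ℓ : ℂ) ^ (p + p' + 2 * (2 * e + (p + r))) *
        F (torus (x * ϖ ℓ ^ (e + p)) (y * ϖ ℓ ^ (e + r)) (x * ϖ ℓ ^ (e' + p'))
          (y * ϖ ℓ ^ (e' + r')) (det_herm_units hk))
    else 0 := by
  set T := torus (x * ϖ ℓ ^ (e + p)) (y * ϖ ℓ ^ (e + r)) (x * ϖ ℓ ^ (e' + p'))
    (y * ϖ ℓ ^ (e' + r')) (det_herm_units hk) with hT
  have hterm : ∀ c c' v₁ v₂ z : ℕ,
      F (torus x y x y rfl * cosetRep ℓ e e' ⟨(⟨(p, r), c⟩, ⟨(p', r'), c'⟩), (v₁, v₂, z)⟩) =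
      Ψ ((x / y : ℚ_[ℓ]) / ℓ ^ r * c) * Ψ (-((x / y : ℚ_[ℓ]) / ℓ ^ r') * c') *
        Ψ (-(y : ℚ_[ℓ]) * v₂) * F T := by
    intro c c' v₁ v₂ z
    rw [torus_mul_cosetRep hk, hF.map_unip_mul, sub_eq_add_neg, AddChar.map_add_eq_mul, neg_mul,
      neg_mul]
    ring
  simp only [hterm]
  by_cases hdom : ‖((y * ϖ ℓ ^ (e + r) : ℚ_[ℓ]ˣ) : ℚ_[ℓ])‖ ≤ 1 ∧
      ‖((x * ϖ ℓ ^ (e + p) : ℚ_[ℓ]ˣ) / (y * ϖ ℓ ^ (e + r) : ℚ_[ℓ]ˣ) : ℚ_[ℓ])‖ ≤ 1 ∧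
      ‖((x * ϖ ℓ ^ (e' + p') : ℚ_[ℓ]ˣ) / (y * ϖ ℓ ^ (e' + r') : ℚ_[ℓ]ˣ) : ℚ_[ℓ])‖ ≤ 1
  swap
  · rw [hF.torus_eq_zero hΨ _ hdom]
    simp
  obtain ⟨d1, d2, d3⟩ := hdom
  have hℓ := cast_ne_zero (ℓ := ℓ)
  have hq : ∀ e p r : ℕ, ((x * ϖ ℓ ^ (e + p) : ℚ_[ℓ]ˣ) / (y * ϖ ℓ ^ (e + r) : ℚ_[ℓ]ˣ) : ℚ_[ℓ]) =
      (x / y : ℚ_[ℓ]) / ℓ ^ r * ℓ ^ p := by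
    intro e p r
    simp only [Units.val_mul, Units.val_pow_eq_pow_val, ϖ, Units.val_mk0]
    field_simp
    ring
  rw [hq] at d2 d3
  rw [hΨ.sum_range_mul d2 d3 (by simpa [ϖ] using d1)]
  congr 1
  ring

end Whittaker

/-! ### Integration of functions of the valuation -/

section Measure

variable {ℓ : ℕ} [Fact ℓ.Prime]

/-- The valuation on `ℚ_ℓˣ`. -/
noncomputable def val (x : ℚ_[ℓ]ˣ) : ℤ := (x : ℚ_[ℓ]).valuation

lemma norm_eq_val (x : ℚ_[ℓ]ˣ) : ‖(x : ℚ_[ℓ])‖ = (ℓ : ℝ) ^ (-val x) :=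
  Padic.norm_eq_zpow_neg_valuation x.ne_zero

lemma zpow_neg_injective : Function.Injective fun n : ℤ => (ℓ : ℝ) ^ (-n) := fun a b h => by
  have := zpow_right_injective₀ (zero_lt_one.trans (one_lt_cast (ℓ := ℓ))) one_lt_cast.ne' h
  exact neg_injective this

lemma val_eq_iff (x : ℚ_[ℓ]ˣ) (n : ℤ) : val x = n ↔ ‖(x : ℚ_[ℓ])‖ = (ℓ : ℝ) ^ (-n) := by
  rw [norm_eq_val]
  exact (zpow_neg_injective (ℓ := ℓ)).eq_iff.symm

lemma val_mul (x y : ℚ_[ℓ]ˣ) : val (x * y) = val x + val y :=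
  Padic.valuation_mul x.ne_zero y.ne_zero

lemma norm_ϖ_zpow (n : ℤ) : ‖((ϖ ℓ ^ n : ℚ_[ℓ]ˣ) : ℚ_[ℓ])‖ = (ℓ : ℝ) ^ (-n) := by
  rw [Units.val_zpow_eq_zpow_val]
  exact Padic.norm_p_zpow n

lemma val_ϖ_zpow (n : ℤ) : val (ϖ ℓ ^ n) = n := (val_eq_iff _ _).mpr (norm_ϖ_zpow n)

lemma val_ϖ_pow (n : ℕ) : val (ϖ ℓ ^ n) = n := by
  rw [← zpow_natCast, val_ϖ_zpow]

lemma exists_eq_ϖ_zpow_mul {x : ℚ_[ℓ]ˣ} {n : ℤ} (h : val x = n) :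
    ∃ y : ℚ_[ℓ]ˣ, ‖(y : ℚ_[ℓ])‖ = 1 ∧ x = ϖ ℓ ^ n * y := by
  refine ⟨(ϖ ℓ ^ n)⁻¹ * x, ?_, by group⟩
  have h0 : (0 : ℝ) < ℓ := zero_lt_one.trans one_lt_cast
  rw [Units.val_mul, Units.val_inv_eq_inv_val, norm_mul, norm_inv, norm_ϖ_zpow, norm_eq_val, h,
    inv_mul_cancel₀ (zpow_pos h0 _).ne']

lemma measurable_val : Measurable (val (ℓ := ℓ)) := by
  refine measurable_to_countable' fun n => ?_
  have : val ⁻¹' {n} = Units.val ⁻¹' Metric.sphere (0 : ℚ_[ℓ]) ((ℓ : ℝ) ^ (-n)) := by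
    ext x
    simp [val_eq_iff]
  rw [this]
  refine ((IsUltrametricDist.isOpen_sphere _ ?_).preimage Units.continuous_val).measurableSet
  exact (zpow_pos (zero_lt_one.trans one_lt_cast) _).ne'

instance : SecondCountableTopology ℚ_[ℓ]ˣ :=
  have : SecondCountableTopology ℚ_[ℓ]ᵐᵒᵖ :=
    MulOpposite.opHomeomorph.symm.isEmbedding.secondCountableTopology
  Units.isEmbedding_embedProduct.secondCountableTopology

instance : SigmaFinite (mulHaar ℓ) := by
  unfold mulHaar
  infer_instance

instance : (mulHaar ℓ).IsMulLeftInvariant := by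
  unfold mulHaar
  infer_instance

/-- Each set of elements of given valuation is a translate of `ℤ_ℓˣ` and has volume `1`. -/
lemma map_val_mulHaar : (mulHaar ℓ).map val = Measure.count := by
  refine Measure.ext_of_singleton fun n => ?_
  rw [Measure.map_apply measurable_val (measurableSet_singleton n), Measure.count_singleton,
    ← measure_preimage_mul (mulHaar ℓ) (ϖ ℓ ^ n)]
  have : (fun h => ϖ ℓ ^ n * h) ⁻¹' (val ⁻¹' {n}) = (unitsPC ℓ : Set ℚ_[ℓ]ˣ) := by
    ext x
    change val (ϖ ℓ ^ n * x) = n ↔ ‖(x : ℚ_[ℓ])‖ = 1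
    rw [val_mul, val_ϖ_zpow, add_eq_left, val_eq_iff]
    simp
  rw [this]
  exact Measure.haarMeasure_self

lemma map_val_prod : ((mulHaar ℓ).prod (mulHaar ℓ)).map (Prod.map val val) =
    (Measure.count : Measure (ℤ × ℤ)) := by
  rw [← Measure.map_prod_map _ _ measurable_val measurable_val, map_val_mulHaar]
  refine Measure.ext_of_singleton fun p => ?_
  rw [← Set.singleton_prod_singleton, Measure.prod_prod]
  simp

lemma integrable_val_iff (H : ℤ × ℤ → ℂ) :
    Integrable (fun z : ℚ_[ℓ]ˣ × ℚ_[ℓ]ˣ => H (val z.1, val z.2)) ((mulHaar ℓ).prod (mulHaar ℓ)) ↔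
      Summable H := by
  have := integrable_map_measure (f := Prod.map val val) (g := H)
    (μ := (mulHaar ℓ).prod (mulHaar ℓ)) (by
      rw [map_val_prod]; exact (measurable_of_countable H).aestronglyMeasurable)
    (measurable_val.prodMap measurable_val).aemeasurable
  rw [map_val_prod, integrable_count_iff] at this
  rw [summable_norm_iff] at this
  exact this.symm

lemma integral_val {H : ℤ × ℤ → ℂ} (hH : Summable H) :
    ∫ z : ℚ_[ℓ]ˣ × ℚ_[ℓ]ˣ, H (val z.1, val z.2) ∂((mulHaar ℓ).prod (mulHaar ℓ)) =
      ∑' p, H p := by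
  have := integral_map (φ := Prod.map val val) (f := H)
    (μ := (mulHaar ℓ).prod (mulHaar ℓ)) (measurable_val.prodMap measurable_val).aemeasurable (by
      rw [map_val_prod]; exact (measurable_of_countable H).aestronglyMeasurable)
  rw [map_val_prod] at this
  refine this.symm.trans ?_
  rw [integral_countable (integrable_count_iff.mpr hH.norm)]
  simp

end Measure

/-! ### Double sums over `ℤ × ℤ` -/

section Sums

lemma summable_indicator {g : ℤ × ℤ → ℂ} (hg : Summable g) (P : ℤ × ℤ → Prop)
    [DecidablePred P] : Summable fun p => if P p then g p else 0 :=
  (hg.indicator {p | P p}).congr fun p => by simp [Set.indicator]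

lemma tsum_indicator_eq_dsum {g : ℤ → ℤ → ℂ} (hg : Summable fun p : ℤ × ℤ => g p.1 p.2)
    (a b : ℤ) : ∑' p : ℤ × ℤ, (if a ≤ p.1 ∧ b ≤ p.2 then g p.1 p.2 else 0) = dsum a b g := by
  let ι : ℕ × ℕ → ℤ × ℤ := fun q => (a + q.1, b + q.2)
  have hι : Function.Injective ι := by
    rintro ⟨i, j⟩ ⟨i', j'⟩ h
    simp only [ι, Prod.mk.injEq] at h
    ext <;> simp <;> omega
  have hs := hg.comp_injective hι
  rw [← hι.tsum_eq]
  · exact (tsum_congr fun q => by simp [ι]).trans hs.tsum_prod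
  · intro p hp
    have hp' : a ≤ p.1 ∧ b ≤ p.2 := by
      by_contra h
      exact hp (if_neg h)
    refine ⟨((p.1 - a).toNat, (p.2 - b).toNat), ?_⟩
    ext <;> simp [ι] <;> omega

end Sums

/-! ### The zeta integral of a Hecke translate as a double sum -/

section Zeta

variable {ℓ : ℕ} [Fact ℓ.Prime]
variable {V₁ V₂ : Type*} [AddCommGroup V₁] [Module ℂ V₁] [AddCommGroup V₂] [Module ℂ V₂]
  {σ' : Representation ℂ (GSp4 ℚ_[ℓ]) V₁} {τ' : Representation ℂ (GL (Fin 2) ℚ_[ℓ]) V₂}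
  {Ψ : AddChar ℚ_[ℓ] ℂ} {Wσ : V₁ →ₗ[ℂ] ℂ} {Wτ : V₂ →ₗ[ℂ] ℂ} {v₀ : V₁} {w₀ : V₂}
  {η : ℚ_[ℓ]ˣ →* ℂˣ}

/-- The Whittaker function `g ↦ (W_{σ'} ⊗ W_{τ'})(g (v₀ ⊗ w₀))` on `G(ℚ_ℓ)`. -/
noncomputable def whit (σ' : Representation ℂ (GSp4 ℚ_[ℓ]) V₁)
    (τ' : Representation ℂ (GL (Fin 2) ℚ_[ℓ]) V₂)
    (Wσ : V₁ →ₗ[ℂ] ℂ) (Wτ : V₂ →ₗ[ℂ] ℂ) (v₀ : V₁) (w₀ : V₂) (g : G ℚ_[ℓ]) : ℂ :=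
  Wσ (σ' (pr₁ _ g) v₀) * Wτ (τ' (pr₂ _ g) w₀)

lemma boxFunctional_boxRep (g : G ℚ_[ℓ]) :
    boxFunctional Wσ Wτ (boxRep σ' τ' g (v₀ ⊗ₜ[ℂ] w₀)) = whit σ' τ' Wσ Wτ v₀ w₀ g := rfl

lemma IsWhittaker₁.apply_kl (hWσ : IsWhittaker₁ σ' Ψ Wσ) (s v₁ v₂ z : ℚ_[ℓ]) (v : V₁) :
    Wσ (σ' (kl (unip s) v₁ v₂ z) v) = Ψ (s - v₂) * Wσ v := by
  have h1 := hWσ (kl (unip s) v₁ v₂ z)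
    (by intro i; rw [mat_kl, coe_unip]; fin_cases i <;> simp)
    (by intro i j h; rw [mat_kl, coe_unip]; fin_cases i <;> fin_cases j <;> simp at h ⊢) v
  have e1 : mat (kl (unip s) v₁ v₂ z) 1 2 + mat (kl (unip s) v₁ v₂ z) 0 1 = s - v₂ := by
    rw [mat_kl, coe_unip]; simp; ring
  rwa [e1] at h1

lemma IsWhittaker₂.apply_unip (hWτ : IsWhittaker₂ τ' Ψ Wτ) (s : ℚ_[ℓ]) (w : V₂) :
    Wτ (τ' (unip s) w) = Ψ (-s) * Wτ w := by
  have h2 := hWτ (unip s) (by intro i; rw [coe_unip]; fin_cases i <;> simp)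
    (by intro i j h; rw [coe_unip]; fin_cases i <;> fin_cases j <;> simp at h ⊢) w
  have e2 : (unip s : Matrix (Fin 2) (Fin 2) ℚ_[ℓ]) 0 1 = s := rfl
  rwa [e2, ← AddChar.map_neg_eq_inv] at h2

lemma isSphericalWhittaker_whit (hWσ : IsWhittaker₁ σ' Ψ Wσ) (hWτ : IsWhittaker₂ τ' Ψ Wτ)
    (hsph : ∀ k ∈ GZ ℓ, boxRep σ' τ' k (v₀ ⊗ₜ[ℂ] w₀) = v₀ ⊗ₜ[ℂ] w₀) :
    IsSphericalWhittaker Ψ (whit σ' τ' Wσ Wτ v₀ w₀) where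
  map_mul_right g k hk := by
    rw [← boxFunctional_boxRep, ← boxFunctional_boxRep, map_mul, Module.End.mul_apply, hsph k hk]
  map_unip_mul s s' v₁ v₂ z g := by
    simp only [whit, map_mul, pr₁_klG, pr₂_klG, Module.End.mul_apply]
    rw [hWσ.apply_kl, hWτ.apply_unip]
    ring

lemma diagGSp4_congr {R : Type*} [CommRing R] {a b c d a' b' c' d' : Rˣ} (h h') (ha : a = a')
    (hb : b = b') (hc : c = c') (hd : d = d') :
    diagGSp4 a b c d h = diagGSp4 a' b' c' d' h' := by
  subst_vars
  rfl

/-- The values of the Whittaker function at diagonal elements depend only on the valuations of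
the entries. -/
lemma whit_torus (hF : IsSphericalWhittaker Ψ (whit σ' τ' Wσ Wτ v₀ w₀)) {a b c d : ℚ_[ℓ]ˣ} (h)
    {i j i' j' : ℤ} (ha : val a = i + j) (hb : val b = j) (hc : val c = i' + j')
    (hd : val d = j') :
    whit σ' τ' Wσ Wτ v₀ w₀ (torus a b c d h) = wGSp4 σ' Wσ v₀ i j * wGL2 τ' Wτ w₀ i' j' := by
  have hij : i + j + j = i' + j' + j' := by
    have := congrArg val h
    rwa [val_mul, val_mul, ha, hb, hc, hd] at this
  obtain ⟨a₁, na, rfl⟩ := exists_eq_ϖ_zpow_mul ha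
  obtain ⟨b₁, nb, rfl⟩ := exists_eq_ϖ_zpow_mul hb
  obtain ⟨c₁, nc, rfl⟩ := exists_eq_ϖ_zpow_mul hc
  obtain ⟨d₁, nd, rfl⟩ := exists_eq_ϖ_zpow_mul hd
  have h₁ : ϖ ℓ ^ (i + j) * ϖ ℓ ^ j = ϖ ℓ ^ (i' + j') * ϖ ℓ ^ j' := by
    rw [← zpow_add, ← zpow_add, hij]
  have h₂ : a₁ * b₁ = c₁ * d₁ := by
    rw [mul_mul_mul_comm, mul_mul_mul_comm _ c₁, h₁] at h
    exact mul_left_cancel h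
  rw [← torus_mul_torus h₁ h₂, hF.map_mul_right _ _ (torus_mem_GZ h₂ na nb nc nd)]
  rw [whit, torus, pr₁_klG, pr₂_klG, kl_diag, wGSp4, wGL2]
  rw [diagGSp4_congr _ _ (show ϖ ℓ ^ (i + j) * ϖ ℓ ^ j = ϖ ℓ ^ (i + 2 * j) by
    rw [← zpow_add]; congr 1; ring) rfl rfl rfl]

lemma map_η_eq (hη : IsUnramifiedChar ℓ η) (x : ℚ_[ℓ]ˣ) : η x = η (ϖ ℓ) ^ val x := by
  obtain ⟨y, hy, e⟩ := exists_eq_ϖ_zpow_mul (x := x) rfl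
  rw [e, map_mul, hη y hy, mul_one, map_zpow, ← e]

lemma cast_ne_zero_complex : (ℓ : ℂ) ≠ 0 := Nat.cast_ne_zero.mpr (Fact.out : ℓ.Prime).ne_zero

lemma ofReal_zpow_cpow (n : ℤ) (w : ℂ) :
    ((((ℓ : ℝ) ^ n : ℝ)) : ℂ) ^ w = ((ℓ : ℂ) ^ w) ^ n := by
  have h0 : (0 : ℝ) < ℓ := zero_lt_one.trans one_lt_cast
  rw [Complex.cpow_def_of_ne_zero (by exact_mod_cast (zpow_pos h0 n).ne'),
    Complex.cpow_def_of_ne_zero cast_ne_zero_complex, ← Complex.ofReal_log (zpow_pos h0 n).le,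
    Real.log_zpow, ← Complex.exp_int_mul, ← Complex.ofReal_natCast, ← Complex.ofReal_log h0.le]
  congr 1
  push_cast
  ring

lemma X_ne_zero (s : ℂ) : X η s ≠ 0 :=
  mul_ne_zero (Units.ne_zero _) (by simp [Complex.cpow_eq_zero_iff, (Fact.out : ℓ.Prime).ne_zero])

lemma weight_eq (hη : IsUnramifiedChar ℓ η) (s : ℂ) (x y : ℚ_[ℓ]ˣ) :
    ((‖(x : ℚ_[ℓ])‖ : ℝ) : ℂ) ^ (s - 2) * ((‖(y : ℚ_[ℓ])‖ : ℝ) : ℂ) ^ s * (η (x * y) : ℂ) =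
      (ℓ : ℂ) ^ (2 * val x) * X η s ^ (val x + val y) := by
  have hℓ := cast_ne_zero_complex (ℓ := ℓ)
  have h1 : (ℓ : ℂ) ^ (s - 2) = (ℓ : ℂ) ^ s / (ℓ : ℂ) ^ (2 : ℤ) := by
    rw [Complex.cpow_sub _ _ hℓ]
    norm_cast
  have hc : (ℓ : ℂ) ^ s ≠ 0 := by
    simp [Complex.cpow_eq_zero_iff, (Fact.out : ℓ.Prime).ne_zero]
  have hη0 : (η (ϖ ℓ) : ℂ) ≠ 0 := Units.ne_zero _
  rw [norm_eq_val, norm_eq_val, ofReal_zpow_cpow, ofReal_zpow_cpow, map_η_eq hη, val_mul, X,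
    Complex.cpow_neg, h1, Units.val_zpow_eq_zpow_val]
  generalize (ℓ : ℂ) ^ s = c at *
  rw [mul_zpow, div_zpow, ← zpow_mul, zpow_add₀ hη0, inv_zpow, zpow_add₀ hc, zpow_neg, zpow_neg,
    mul_neg, zpow_neg]
  field_simp

/-- The sum over the coset representatives in terms of the Whittaker values, where `i` and `j` are
the valuations of `x / y` and `y`. -/
lemma sum_whit_cosetRep (hF : IsSphericalWhittaker Ψ (whit σ' τ' Wσ Wτ v₀ w₀))
    (hΨ : IsUnramifiedAddChar ℓ Ψ) {e f e' f' : ℕ} (hk : 2 * e + f = 2 * e' + f')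
    (x y : ℚ_[ℓ]ˣ) :
    ∑ τ ∈ cosetIdx ℓ e f f', whit σ' τ' Wσ Wτ v₀ w₀ (torus x y x y rfl * cosetRep ℓ e e' τ) =
      ∑ P ∈ Finset.HasAntidiagonal.antidiagonal f, ∑ P' ∈ Finset.HasAntidiagonal.antidiagonal f',
        if (P.2 : ℤ) ≤ val x - val y ∧ (P'.2 : ℤ) ≤ val x - val y ∧ 0 ≤ val y then
          (ℓ : ℂ) ^ (P.1 + P'.1 + 2 * (2 * e + f)) *
            (wGSp4 σ' Wσ v₀ (val x - val y + P.1 - P.2) (val y + (e + P.2)) *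
              wGL2 τ' Wτ w₀ (val x - val y + P'.1 - P'.2) (val y + (e' + P'.2)))
        else 0 := by
  have hle : ∀ (z : ℚ_[ℓ]) (n : ℤ), ‖z‖ = (ℓ : ℝ) ^ (-n) → (‖z‖ ≤ 1 ↔ 0 ≤ n) := by
    intro z n h
    rw [h, zpow_le_one_iff_right₀ one_lt_cast]
    omega
  have hxy : ∀ r : ℕ, ‖(x / y : ℚ_[ℓ]) / ℓ ^ r‖ ≤ 1 ↔ (r : ℤ) ≤ val x - val y := by
    intro r
    rw [hle _ (val x - val y - r), sub_nonneg]
    have h0 : (ℓ : ℝ) ≠ 0 := (zero_lt_one.trans one_lt_cast).ne'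
    rw [norm_div, norm_div, norm_pow_ℓ, norm_eq_val, norm_eq_val, ← zpow_sub₀ h0, ← zpow_sub₀ h0]
    congr 1
    ring
  simp only [cosetIdx, hermIdx, Finset.sum_sigma, Finset.sum_product]
  refine Finset.sum_congr rfl fun P hP => ?_
  rw [Finset.sum_comm]
  refine Finset.sum_congr rfl fun P' hP' => ?_
  obtain ⟨p, r⟩ := P
  obtain ⟨p', r'⟩ := P'
  replace hP := Finset.HasAntidiagonal.mem_antidiagonal.mp hP
  replace hP' := Finset.HasAntidiagonal.mem_antidiagonal.mp hP'
  simp only at hP hP'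
  subst hP hP'
  simp only
  rw [hF.sum_cosetRep_aux hΨ hk]
  refine if_congr (and_congr (hxy r) (and_congr (hxy r') (hle _ _ (norm_eq_val y)))) ?_ rfl
  rw [whit_torus hF _ (i := val x - val y + p - r) (j := val y + (e + r))
    (i' := val x - val y + p' - r') (j' := val y + (e' + r'))]
  all_goals
    rw [val_mul, val_ϖ_pow]
    push_cast
    ring

/-- The translation that accounts for a Hecke representative, from the valuations of `(x, y)` to
the index of the Whittaker values. -/
def shear (m n : ℤ) : ℤ × ℤ ≃ ℤ × ℤ where
  toFun q := (q.1 - q.2 + m, q.2 + n)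
  invFun q := (q.1 - m + (q.2 - n), q.2 - n)
  left_inv q := by ext <;> simp
  right_inv q := by ext <;> simp

lemma hasSum_shear_indicator {g : ℤ → ℤ → ℂ} (hg : Summable fun p : ℤ × ℤ => g p.1 p.2) (c : ℂ)
    (m n a b : ℤ) :
    HasSum (fun q : ℤ × ℤ => c * if a ≤ q.1 - q.2 + m ∧ b ≤ q.2 + n then
      g (q.1 - q.2 + m) (q.2 + n) else 0) (c * dsum a b g) := by
  have h := (summable_indicator hg fun p => a ≤ p.1 ∧ b ≤ p.2).hasSum
  rw [tsum_indicator_eq_dsum hg] at h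
  have h' := ((Equiv.hasSum_iff (shear m n)).mpr h).mul_left c
  simpa only [shear, Function.comp_def, Equiv.coe_fn_mk] using h'

/-- The contribution of the coset representatives attached to `(p, r)` and `(p', r')` to the
integrand at elements of valuations `x` and `y`, in terms of the index of the Whittaker values. -/
lemma weight_mul_eq_term (e e' p r p' r' : ℕ) (x y : ℤ) (s : ℂ) :
    (if (r : ℤ) ≤ x - y ∧ (r' : ℤ) ≤ x - y ∧ 0 ≤ y then
      (ℓ : ℂ) ^ (p + p' + 2 * (2 * e + (p + r))) *
        (wGSp4 σ' Wσ v₀ (x - y + p - r) (y + (e + r)) *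
          wGL2 τ' Wτ w₀ (x - y + p' - r') (y + (e' + r'))) else 0) *
      ((ℓ : ℂ) ^ (2 * x) * X η s ^ (x + y)) =
    (ℓ : ℂ) ^ ((p' + 2 * (2 * e + (p + r)) - p - 2 * e : ℤ)) * X η s ^ (-(2 * e + (p + r) : ℤ)) *
      if max (p : ℤ) (p - r + r') ≤ x - y + (p - r) ∧ (r + e : ℤ) ≤ y + (r + e) then
        term σ' τ' Wσ Wτ v₀ w₀ η s (p' - r' - (p - r)) (r' + e' - (r + e))
          (x - y + (p - r)) (y + (r + e)) else 0 := by
  have hℓ := cast_ne_zero_complex (ℓ := ℓ)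
  have hX := X_ne_zero (ℓ := ℓ) (η := η) s
  by_cases hcond : (r : ℤ) ≤ x - y ∧ (r' : ℤ) ≤ x - y ∧ 0 ≤ y
  · rw [if_pos hcond, if_pos (by omega)]
    simp only [term]
    have a1 : x - y + (p - r : ℤ) + (p' - r' - (p - r)) = x - y + p' - r' := by ring
    have a2 : y + (r + e : ℤ) + (r' + e' - (r + e)) = y + (e' + r') := by ring
    have a3 : x - y + (p - r : ℤ) = x - y + p - r := by ring
    have a4 : y + (r + e : ℤ) = y + (e + r) := by ring
    rw [a1, a2, a3, a4]
    have b1 : (ℓ : ℂ) ^ (p + p' + 2 * (2 * e + (p + r))) * (ℓ : ℂ) ^ (2 * x) =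
        (ℓ : ℂ) ^ ((p' + 2 * (2 * e + (p + r)) - p - 2 * e : ℤ)) *
        (ℓ : ℂ) ^ (2 * (x - y + p - r + (y + (e + r)))) := by
      rw [← zpow_natCast, ← zpow_add₀ hℓ, ← zpow_add₀ hℓ]
      congr 1
      push_cast
      ring
    have b2 : X η s ^ (x + y) = X η s ^ (-(2 * e + (p + r) : ℤ)) *
        X η s ^ (x - y + p - r + 2 * (y + (e + r))) := by
      rw [← zpow_add₀ hX]
      congr 1
      ring
    rw [b2]
    linear_combination (wGSp4 σ' Wσ v₀ (x - y + p - r) (y + (e + r)) *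
      wGL2 τ' Wτ w₀ (x - y + p' - r') (y + (e' + r')) * X η s ^ (-(2 * e + (p + r) : ℤ)) *
        X η s ^ (x - y + p - r + 2 * (y + (e + r)))) * b1
  · rw [if_neg hcond, if_neg (by omega), zero_mul, mul_zero]

lemma lIntegrand_cosetUnion (hF : IsSphericalWhittaker Ψ (whit σ' τ' Wσ Wτ v₀ w₀))
    (hsph : ∀ k ∈ GZ ℓ, boxRep σ' τ' k (v₀ ⊗ₜ[ℂ] w₀) = v₀ ⊗ₜ[ℂ] w₀)
    (hΨ : IsUnramifiedAddChar ℓ Ψ) (hη : IsUnramifiedChar ℓ η) {e f e' f' : ℕ}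
    (hk : 2 * e + f = 2 * e' + f') (s : ℂ) (z : ℚ_[ℓ]ˣ × ℚ_[ℓ]ˣ) :
    lIntegrand σ' τ' Wσ Wτ (heckeAct (GZ ℓ) (boxRep σ' τ')
      (Set.indicator (cosetUnion ℓ e f e' f') 1) (v₀ ⊗ₜ[ℂ] w₀)) η s z =
    ∑ P ∈ Finset.HasAntidiagonal.antidiagonal f, ∑ P' ∈ Finset.HasAntidiagonal.antidiagonal f',
      (ℓ : ℂ) ^ ((P'.1 + 2 * (2 * e + f) - P.1 - 2 * e : ℤ)) * X η s ^ (-(2 * e + f : ℤ)) *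
        if max (P.1 : ℤ) (P.1 - P.2 + P'.2) ≤ val z.1 - val z.2 + (P.1 - P.2) ∧
            (P.2 + e : ℤ) ≤ val z.2 + (P.2 + e) then
          term σ' τ' Wσ Wτ v₀ w₀ η s (P'.1 - P'.2 - (P.1 - P.2)) (P'.2 + e' - (P.2 + e))
            (val z.1 - val z.2 + (P.1 - P.2)) (val z.2 + (P.2 + e)) else 0 := by
  have ht : diagG (z.1 * z.2) z.1 z.2 1 z.1 z.2 (by group) (by group) =
      torus z.1 z.2 z.1 z.2 rfl := (klG_diag _ _ _ _ _ _).symm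
  rw [lIntegrand, heckeAct_cosetUnion hsph hk, ht, map_sum, map_sum]
  have hw : ∀ τ, boxFunctional Wσ Wτ (boxRep σ' τ' (torus z.1 z.2 z.1 z.2 rfl)
      (boxRep σ' τ' (cosetRep ℓ e e' τ) (v₀ ⊗ₜ[ℂ] w₀))) =
      whit σ' τ' Wσ Wτ v₀ w₀ (torus z.1 z.2 z.1 z.2 rfl * cosetRep ℓ e e' τ) := by
    intro τ
    rw [← boxFunctional_boxRep, map_mul, Module.End.mul_apply]
  rw [Finset.sum_congr rfl fun τ _ => hw τ, sum_whit_cosetRep hF hΨ hk, mul_assoc, mul_assoc,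
    ← mul_assoc _ (_ ^ s), weight_eq hη, Finset.sum_mul]
  refine Finset.sum_congr rfl fun P hP => ?_
  rw [Finset.sum_mul]
  refine Finset.sum_congr rfl fun P' hP' => ?_
  obtain ⟨p, r⟩ := P
  replace hP := Finset.HasAntidiagonal.mem_antidiagonal.mp hP
  simp only at hP
  subst hP
  push_cast
  exact weight_mul_eq_term e e' p r P'.1 P'.2 (val z.1) (val z.2) s

/-- The zeta integral of the Hecke translate by `cosetUnion ℓ e f e' f'`. -/
theorem l_cosetUnion (hF : IsSphericalWhittaker Ψ (whit σ' τ' Wσ Wτ v₀ w₀))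
    (hsph : ∀ k ∈ GZ ℓ, boxRep σ' τ' k (v₀ ⊗ₜ[ℂ] w₀) = v₀ ⊗ₜ[ℂ] w₀)
    (hΨ : IsUnramifiedAddChar ℓ Ψ) (hη : IsUnramifiedChar ℓ η) {e f e' f' : ℕ}
    (hk : 2 * e + f = 2 * e' + f') (s : ℂ)
    (hS : ∀ P ∈ Finset.HasAntidiagonal.antidiagonal f,
      ∀ P' ∈ Finset.HasAntidiagonal.antidiagonal f', Summable fun q : ℤ × ℤ =>
        term σ' τ' Wσ Wτ v₀ w₀ η s (P'.1 - P'.2 - (P.1 - P.2)) (P'.2 + e' - (P.2 + e)) q.1 q.2) :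
    Integrable (lIntegrand σ' τ' Wσ Wτ (heckeAct (GZ ℓ) (boxRep σ' τ')
      (Set.indicator (cosetUnion ℓ e f e' f') 1) (v₀ ⊗ₜ[ℂ] w₀)) η s)
      ((mulHaar ℓ).prod (mulHaar ℓ)) ∧
    l σ' τ' Wσ Wτ (heckeAct (GZ ℓ) (boxRep σ' τ')
      (Set.indicator (cosetUnion ℓ e f e' f') 1) (v₀ ⊗ₜ[ℂ] w₀)) η s =
    ∑ P ∈ Finset.HasAntidiagonal.antidiagonal f, ∑ P' ∈ Finset.HasAntidiagonal.antidiagonal f',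
      (ℓ : ℂ) ^ ((P'.1 + 2 * (2 * e + f) - P.1 - 2 * e : ℤ)) * X η s ^ (-(2 * e + f : ℤ)) *
        dsum (max P.1 (P.1 - P.2 + P'.2)) (P.2 + e)
          (term σ' τ' Wσ Wτ v₀ w₀ η s (P'.1 - P'.2 - (P.1 - P.2)) (P'.2 + e' - (P.2 + e))) := by
  have hsum := hasSum_sum fun P hP => hasSum_sum fun P' hP' =>
    hasSum_shear_indicator (hS P hP P' hP')
      ((ℓ : ℂ) ^ ((P'.1 + 2 * (2 * e + f) - P.1 - 2 * e : ℤ)) * X η s ^ (-(2 * e + f : ℤ)))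
      (P.1 - P.2) (P.2 + e) (max P.1 (P.1 - P.2 + P'.2)) (P.2 + e)
  rw [l, funext (lIntegrand_cosetUnion hF hsph hΨ hη hk s)]
  exact ⟨(integrable_val_iff _).mpr hsum.summable,
    (integral_val hsum.summable).trans hsum.tsum_eq⟩

end Zeta

/-! ### Growth of matrix coefficients along a semigroup -/

section Growth

lemma exists_norm_iterate_le {E : Type*} [AddCommGroup E] [Module ℂ E] [FiniteDimensional ℂ E]
    (T₁ T₂ : Module.End ℂ E) (f : E →ₗ[ℂ] ℂ) (v : E) :
    ∃ C R : ℝ, 0 ≤ C ∧ 1 ≤ R ∧ ∀ i j : ℕ, ‖f ((T₁ ^ i * T₂ ^ j) v)‖ ≤ C * R ^ (i + j) := by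
  let e : E ≃ₗ[ℂ] (Fin (Module.finrank ℂ E) → ℂ) :=
    (Module.finBasis ℂ E).equivFun
  let A : Module.End ℂ E → ((Fin (Module.finrank ℂ E) → ℂ) →L[ℂ] (Fin (Module.finrank ℂ E) → ℂ)) :=
    fun T => LinearMap.toContinuousLinearMap (e.toLinearMap ∘ₗ T ∘ₗ e.symm.toLinearMap)
  let g : (Fin (Module.finrank ℂ E) → ℂ) →L[ℂ] ℂ :=
    LinearMap.toContinuousLinearMap (f ∘ₗ e.symm.toLinearMap)
  let R : ℝ := max 1 (max ‖A T₁‖ ‖A T₂‖)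
  have hR : 1 ≤ R := le_max_left _ _
  have h1 : ∀ T : Module.End ℂ E, ‖A T‖ ≤ R →
      ∀ (n : ℕ) (w : E), ‖e ((T ^ n) w)‖ ≤ R ^ n * ‖e w‖ := by
    intro T hT n w
    induction n with
    | zero => simp
    | succ n ih =>
      have : e ((T ^ (n + 1)) w) = A T (e ((T ^ n) w)) := by
        simp [A, pow_succ', Module.End.mul_apply]
      rw [this, pow_succ', mul_assoc]
      exact ((A T).le_opNorm _).trans
        (mul_le_mul hT ih (norm_nonneg _) (zero_le_one.trans hR))
  refine ⟨‖g‖ * ‖e v‖, R, by positivity, hR, fun i j => ?_⟩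
  have h2 : f ((T₁ ^ i * T₂ ^ j) v) = g (e ((T₁ ^ i) ((T₂ ^ j) v))) := by
    simp [g, Module.End.mul_apply]
  rw [h2, pow_add]
  calc _ ≤ ‖g‖ * (R ^ i * (R ^ j * ‖e v‖)) := (g.le_opNorm _).trans <| by
        refine mul_le_mul_of_nonneg_left ?_ (norm_nonneg _)
        refine (h1 T₁ ((le_max_left _ _).trans (le_max_right _ _)) i _).trans ?_
        exact mul_le_mul_of_nonneg_left
          (h1 T₂ ((le_max_right _ _).trans (le_max_right _ _)) j _) (by positivity)
    _ = _ := by ring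

variable {Γ : Type*} [Group Γ] {V : Type*} [AddCommGroup V] [Module ℂ V]
  {ρ : Representation ℂ Γ V} {I : Subgroup Γ}

lemma mem_invariants_subtype {v : V} :
    v ∈ Representation.invariants (MonoidHom.comp ρ I.subtype) ↔ ∀ k ∈ I, ρ k v = v := by
  rw [Representation.mem_invariants]
  exact ⟨fun h k hk => h ⟨k, hk⟩, fun h k => h k k.2⟩

/-- The Hecke operator of the double coset `I t I` on the vectors fixed by `I`, normalized to be
an average: a functional that takes the same value on all `ρ (k * t) v`, with `k ∈ I`, takes this
value on the image of `v`. -/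
lemma exists_hecke_average {t : Γ}
    (hfin : ((fun k : Γ => ((k * t : Γ) : Γ ⧸ I)) '' (I : Set Γ)).Finite) :
    ∃ T : Module.End ℂ (Representation.invariants (MonoidHom.comp ρ I.subtype)),
      ∀ (f : V →ₗ[ℂ] ℂ) (v : Representation.invariants (MonoidHom.comp ρ I.subtype)),
        (∀ k ∈ I, f (ρ (k * t) v) = f (ρ t v)) → f (ρ t v) = f (T v) := by
  classical
  set S : Finset (Γ ⧸ I) := hfin.toFinset with hS
  have hmem : ∀ x, x ∈ S ↔ ∃ k ∈ I, ((k * t : Γ) : Γ ⧸ I) = x := by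
    intro x
    rw [hS, Set.Finite.mem_toFinset]
    rfl
  have hout : ∀ v ∈ Representation.invariants (MonoidHom.comp ρ I.subtype), ∀ g : Γ,
      ρ ((g : Γ ⧸ I).out) v = ρ g v := by
    intro v hv g
    obtain ⟨h, hh⟩ := QuotientGroup.mk_out_eq_mul I g
    rw [hh, map_mul, Module.End.mul_apply, mem_invariants_subtype.mp hv h h.2]
  have hinv : ∀ v ∈ Representation.invariants (MonoidHom.comp ρ I.subtype),
      ∑ x ∈ S, ρ x.out v ∈ Representation.invariants (MonoidHom.comp ρ I.subtype) := by
    intro v hv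
    rw [mem_invariants_subtype]
    intro k hk
    rw [map_sum]
    refine Finset.sum_bij' (fun x _ => k • x) (fun x _ => k⁻¹ • x) ?_ ?_ ?_ ?_ ?_
    · intro x hx
      obtain ⟨k', hk', rfl⟩ := (hmem x).mp hx
      exact (hmem _).mpr ⟨k * k', mul_mem hk hk', by rw [mul_assoc]; rfl⟩
    · intro x hx
      obtain ⟨k', hk', rfl⟩ := (hmem x).mp hx
      exact (hmem _).mpr ⟨k⁻¹ * k', mul_mem (inv_mem hk) hk', by rw [mul_assoc]; rfl⟩
    · intro x _; exact inv_smul_smul k x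
    · intro x _; exact smul_inv_smul k x
    · intro x _
      induction x using QuotientGroup.induction_on with
      | H g =>
        rw [hout v hv, ← Module.End.mul_apply, ← map_mul]
        exact (hout v hv (k * g)).symm
  refine ⟨((S.card : ℂ)⁻¹ • ((∑ x ∈ S, ρ x.out).domRestrict _)).codRestrict _ fun v => ?_,
    fun f v hf => ?_⟩
  · rw [LinearMap.smul_apply, LinearMap.domRestrict_apply, LinearMap.sum_apply]
    exact Submodule.smul_mem _ _ (hinv v v.2)
  · rw [LinearMap.codRestrict_apply, LinearMap.smul_apply, LinearMap.domRestrict_apply,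
      LinearMap.sum_apply, map_smul, map_sum]
    have hx : ∀ x ∈ S, f (ρ x.out v) = f (ρ t v) := by
      intro x hx
      obtain ⟨k, hk, rfl⟩ := (hmem x).mp hx
      rw [hout v v.2, hf k hk]
    have hne : (S.card : ℂ) ≠ 0 := by
      have : (t : Γ ⧸ I) ∈ S := (hmem _).mpr ⟨1, one_mem I, by rw [one_mul]⟩
      exact Nat.cast_ne_zero.mpr (Finset.card_ne_zero_of_mem this)
    rw [Finset.sum_congr rfl hx, Finset.sum_const, nsmul_eq_mul, smul_eq_mul,
      inv_mul_cancel_left₀ hne]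

lemma finite_image_mul [TopologicalSpace Γ] [ContinuousMul Γ] (hI : IsOpen (I : Set Γ))
    (hI' : IsCompact (I : Set Γ)) (t : Γ) :
    ((fun k : Γ => ((k * t : Γ) : Γ ⧸ I)) '' (I : Set Γ)).Finite := by
  have := QuotientGroup.discreteTopology hI
  refine (hI'.image ?_).finite_of_discrete
  exact QuotientGroup.continuous_mk.comp (continuous_mul_const t)

/-- Along elements `s i j` obtained by multiplying `i` times by `t₁` and `j` times by `t₂`, a
functional that does not see the factors in `I` grows at most exponentially. It is computed by the
powers of two operators on the finite-dimensional space of vectors fixed by `I`. -/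
lemma exists_norm_apply_le [TopologicalSpace Γ] [ContinuousMul Γ] (hI : IsOpen (I : Set Γ))
    (hI' : IsCompact (I : Set Γ)) (hρ : IsAdmissible ρ) (f : V →ₗ[ℂ] ℂ) {t₁ t₂ : Γ}
    {s : ℕ → ℕ → Γ} (hs₁ : ∀ i j, s (i + 1) j = s i j * t₁)
    (hs₂ : ∀ i j, s i (j + 1) = s i j * t₂) (hs₀ : s 0 0 = 1)
    (hf₁ : ∀ i j, ∀ k ∈ I, ∀ v, (∀ k ∈ I, ρ k v = v) →
      f (ρ (s i j * (k * t₁)) v) = f (ρ (s i j * t₁) v))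
    (hf₂ : ∀ i j, ∀ k ∈ I, ∀ v, (∀ k ∈ I, ρ k v = v) →
      f (ρ (s i j * (k * t₂)) v) = f (ρ (s i j * t₂) v))
    {v : V} (hv : ∀ k ∈ I, ρ k v = v) :
    ∃ C R : ℝ, 0 ≤ C ∧ 1 ≤ R ∧ ∀ i j, ‖f (ρ (s i j) v)‖ ≤ C * R ^ (i + j) := by
  obtain ⟨T₁, hT₁⟩ := exists_hecke_average (ρ := ρ) (finite_image_mul hI hI' t₁)
  obtain ⟨T₂, hT₂⟩ := exists_hecke_average (ρ := ρ) (finite_image_mul hI hI' t₂)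
  have h₁ : ∀ i j (w : Representation.invariants (MonoidHom.comp ρ I.subtype)),
      f (ρ (s (i + 1) j) w) = f (ρ (s i j) (T₁ w)) := by
    intro i j w
    have := hT₁ (f ∘ₗ ρ (s i j)) w fun k hk => by
      simpa only [map_mul, Module.End.mul_apply, LinearMap.comp_apply] using
        hf₁ i j k hk w (mem_invariants_subtype.mp w.2)
    rw [hs₁, map_mul]
    exact this
  have h₂ : ∀ i j (w : Representation.invariants (MonoidHom.comp ρ I.subtype)),
      f (ρ (s i (j + 1)) w) = f (ρ (s i j) (T₂ w)) := by
    intro i j w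
    have := hT₂ (f ∘ₗ ρ (s i j)) w fun k hk => by
      simpa only [map_mul, Module.End.mul_apply, LinearMap.comp_apply] using
        hf₂ i j k hk w (mem_invariants_subtype.mp w.2)
    rw [hs₂, map_mul]
    exact this
  have h : ∀ i j (w : Representation.invariants (MonoidHom.comp ρ I.subtype)),
      f (ρ (s i j) w) = f ((T₁ ^ i * T₂ ^ j) w) := by
    intro i j
    induction j with
    | zero =>
      induction i with
      | zero => intro w; simp [hs₀]
      | succ i ih => intro w; rw [h₁, ih, pow_succ, pow_zero, mul_one, mul_one]; rfl
    | succ j ih => intro w; rw [h₂, ih, pow_succ, ← mul_assoc]; rfl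
  have := hρ.2 I hI
  obtain ⟨C, R, hC, hR, hb⟩ := exists_norm_iterate_le T₁ T₂
    (f ∘ₗ Submodule.subtype _) ⟨v, mem_invariants_subtype.mpr hv⟩
  refine ⟨C, R, hC, hR, fun i j => ?_⟩
  have := h i j ⟨v, mem_invariants_subtype.mpr hv⟩
  rw [this]
  exact hb i j

end Growth

/-! ### Iwahori subgroups -/

section Iwahori

variable {ℓ : ℕ} [Fact ℓ.Prime]

/-- The integral matrices that are upper triangular modulo `ℓ`. -/
def iwahoriOrder (ℓ n : ℕ) [Fact ℓ.Prime] : Set (Matrix (Fin n) (Fin n) ℚ_[ℓ]) :=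
  {A | ∀ i j, ‖A i j‖ ≤ if j < i then (ℓ : ℝ)⁻¹ else 1}

lemma inv_cast_pos : (0 : ℝ) < (ℓ : ℝ)⁻¹ := inv_pos.mpr (zero_lt_one.trans one_lt_cast)

lemma inv_cast_lt_one : (ℓ : ℝ)⁻¹ < 1 := inv_lt_one_of_one_lt₀ one_lt_cast

lemma iwahoriOrder_norm_le {n : ℕ} {A : Matrix (Fin n) (Fin n) ℚ_[ℓ]} (hA : A ∈ iwahoriOrder ℓ n)
    (i j : Fin n) : ‖A i j‖ ≤ 1 := by
  refine (hA i j).trans ?_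
  split_ifs
  · exact inv_cast_lt_one.le
  · exact le_rfl

lemma one_mem_iwahoriOrder (n : ℕ) : 1 ∈ iwahoriOrder ℓ n := by
  intro i j
  rw [Matrix.one_apply]
  by_cases h : i = j
  · simp [h]
  · rw [if_neg h, norm_zero]
    split_ifs
    · exact inv_cast_pos.le
    · exact zero_le_one

lemma norm_mul_le_of_mem_iwahoriOrder {n : ℕ} {A B : Matrix (Fin n) (Fin n) ℚ_[ℓ]}
    (hA : A ∈ iwahoriOrder ℓ n) (hB : B ∈ iwahoriOrder ℓ n) {i j k : Fin n} (h : k < i ∨ j < k) :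
    ‖A i k * B k j‖ ≤ (ℓ : ℝ)⁻¹ := by
  rw [norm_mul]
  rcases h with h | h
  · have := hA i k
    rw [if_pos h] at this
    exact (mul_le_mul this (iwahoriOrder_norm_le hB k j) (norm_nonneg _) inv_cast_pos.le).trans_eq
      (mul_one _)
  · have := hB k j
    rw [if_pos h] at this
    exact (mul_le_mul (iwahoriOrder_norm_le hA i k) this (norm_nonneg _) zero_le_one).trans_eq
      (one_mul _)

lemma mul_mem_iwahoriOrder {n : ℕ} {A B : Matrix (Fin n) (Fin n) ℚ_[ℓ]}
    (hA : A ∈ iwahoriOrder ℓ n) (hB : B ∈ iwahoriOrder ℓ n) : A * B ∈ iwahoriOrder ℓ n := by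
  intro i j
  rw [Matrix.mul_apply]
  split_ifs with h
  · refine IsUltrametricDist.norm_sum_le_of_forall_le_of_nonneg inv_cast_pos.le fun k _ => ?_
    refine norm_mul_le_of_mem_iwahoriOrder hA hB ?_
    by_contra hc
    push Not at hc
    exact absurd (hc.1.trans hc.2) (not_le.mpr h)
  · refine IsUltrametricDist.norm_sum_le_of_forall_le_of_nonneg zero_le_one fun k _ => ?_
    rw [norm_mul]
    exact mul_le_one₀ (iwahoriOrder_norm_le hA i k) (norm_nonneg _) (iwahoriOrder_norm_le hB k j)

lemma iwahoriOrder_eq_pi (n : ℕ) : iwahoriOrder ℓ n = Set.univ.pi fun i => Set.univ.pi fun j =>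
    Metric.closedBall (0 : ℚ_[ℓ]) (if j < i then (ℓ : ℝ)⁻¹ else 1) := by
  ext A
  refine ⟨fun h i _ j _ => mem_closedBall_zero_iff.mpr (h i j), fun h i j => ?_⟩
  exact mem_closedBall_zero_iff.mp (h i trivial j trivial)

lemma isCompact_iwahoriOrder (n : ℕ) : IsCompact (iwahoriOrder ℓ n) := by
  rw [iwahoriOrder_eq_pi]
  exact isCompact_univ_pi fun i => isCompact_univ_pi fun j => isCompact_closedBall _ _

lemma isOpen_iwahoriOrder (n : ℕ) : IsOpen (iwahoriOrder ℓ n) := by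
  rw [iwahoriOrder_eq_pi]
  refine isOpen_set_pi Set.finite_univ fun i _ => isOpen_set_pi Set.finite_univ fun j _ =>
    IsUltrametricDist.isOpen_closedBall _ ?_
  split_ifs
  · exact inv_cast_pos.ne'
  · exact one_ne_zero

/-- The standard Iwahori subgroup of `GL_n(ℚ_ℓ)`. -/
def iwahori (ℓ n : ℕ) [Fact ℓ.Prime] : Subgroup (GL (Fin n) ℚ_[ℓ]) where
  carrier := {g | (g : Matrix (Fin n) (Fin n) ℚ_[ℓ]) ∈ iwahoriOrder ℓ n ∧
    ((g⁻¹ : GL (Fin n) ℚ_[ℓ]) : Matrix (Fin n) (Fin n) ℚ_[ℓ]) ∈ iwahoriOrder ℓ n}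
  one_mem' := by
    rw [Set.mem_ofPred_eq, inv_one, Units.val_one]
    exact ⟨one_mem_iwahoriOrder n, one_mem_iwahoriOrder n⟩
  mul_mem' := by
    rintro g h ⟨hg, hg'⟩ ⟨hh, hh'⟩
    rw [Set.mem_ofPred_eq, mul_inv_rev, Units.val_mul, Units.val_mul]
    exact ⟨mul_mem_iwahoriOrder hg hh, mul_mem_iwahoriOrder hh' hg'⟩
  inv_mem' := by
    rintro g ⟨hg, hg'⟩
    rw [Set.mem_ofPred_eq, inv_inv]
    exact ⟨hg', hg⟩

lemma iwahori_eq_preimage (n : ℕ) : (iwahori ℓ n : Set (GL (Fin n) ℚ_[ℓ])) =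
    Units.embedProduct _ ⁻¹' (iwahoriOrder ℓ n ×ˢ (MulOpposite.unop ⁻¹' iwahoriOrder ℓ n)) := rfl

lemma isOpen_iwahori (n : ℕ) : IsOpen (iwahori ℓ n : Set (GL (Fin n) ℚ_[ℓ])) := by
  rw [iwahori_eq_preimage]
  exact ((isOpen_iwahoriOrder n).prod
    ((isOpen_iwahoriOrder n).preimage MulOpposite.continuous_unop)).preimage
      Units.continuous_embedProduct

lemma isCompact_iwahori (n : ℕ) : IsCompact (iwahori ℓ n : Set (GL (Fin n) ℚ_[ℓ])) := by
  rw [iwahori_eq_preimage]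
  refine Units.isClosedEmbedding_embedProduct.isCompact_preimage
    ((isCompact_iwahoriOrder n).prod ?_)
  exact MulOpposite.opHomeomorph.symm.isClosedEmbedding.isCompact_preimage
    (isCompact_iwahoriOrder n)

lemma iwahori_norm_apply_self {n : ℕ} {g : GL (Fin n) ℚ_[ℓ]} (hg : g ∈ iwahori ℓ n) (i : Fin n) :
    ‖g i i‖ = 1 := by
  obtain ⟨h, h'⟩ := hg
  have e : ∑ k, g i k * (g⁻¹ : GL (Fin n) ℚ_[ℓ]) k i = 1 := by
    have := congrArg (fun x : GL (Fin n) ℚ_[ℓ] => (x : Matrix (Fin n) (Fin n) ℚ_[ℓ]) i i)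
      (mul_inv_cancel g)
    simpa only [Units.val_mul, Matrix.mul_apply, Units.val_one, Matrix.one_apply_eq] using this
  rw [← Finset.add_sum_erase _ _ (Finset.mem_univ i)] at e
  have hs : ‖∑ k ∈ Finset.univ.erase i, g i k * (g⁻¹ : GL (Fin n) ℚ_[ℓ]) k i‖ < 1 := by
    refine lt_of_le_of_lt ?_ (inv_cast_lt_one (ℓ := ℓ))
    refine IsUltrametricDist.norm_sum_le_of_forall_le_of_nonneg inv_cast_pos.le fun k hk => ?_
    exact norm_mul_le_of_mem_iwahoriOrder h h' (lt_or_gt_of_ne (Finset.ne_of_mem_erase hk))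
  by_contra hne
  have hlt : ‖g i i * (g⁻¹ : GL (Fin n) ℚ_[ℓ]) i i‖ < 1 := by
    rw [norm_mul]
    exact mul_lt_one_of_nonneg_of_lt_one_left (norm_nonneg _)
      (lt_of_le_of_ne (iwahoriOrder_norm_le h i i) hne) (iwahoriOrder_norm_le h' i i)
  have := (Padic.nonarchimedean (g i i * (g⁻¹ : GL (Fin n) ℚ_[ℓ]) i i)
    (∑ k ∈ Finset.univ.erase i, g i k * (g⁻¹ : GL (Fin n) ℚ_[ℓ]) k i)).trans_lt (max_lt hlt hs)
  rw [e, norm_one] at this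
  exact lt_irrefl _ this

/-- A diagonal matrix whose entries grow from the top to the bottom contracts the lower triangular
part of the Iwahori subgroup. -/
lemma conj_mem_iwahori {n : ℕ} {b : GL (Fin n) ℚ_[ℓ]} (hb : b ∈ iwahori ℓ n)
    (hl : ∀ i j, i < j → b i j = 0) {a : Fin n → ℚ_[ℓ]ˣ}
    (ha : ∀ i j, j ≤ i → ‖(a j : ℚ_[ℓ])‖ ≤ ‖(a i : ℚ_[ℓ])‖) :
    (diagGL a)⁻¹ * b * diagGL a ∈ iwahori ℓ n := by
  have key : ∀ x : GL (Fin n) ℚ_[ℓ], (x : Matrix (Fin n) (Fin n) ℚ_[ℓ]) ∈ iwahoriOrder ℓ n →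
      (∀ i j, i < j → x i j = 0) →
      (((diagGL a)⁻¹ * x * diagGL a : GL (Fin n) ℚ_[ℓ]) : Matrix (Fin n) (Fin n) ℚ_[ℓ]) ∈
        iwahoriOrder ℓ n := by
    intro x hx hx0 i j
    have e : ((diagGL a)⁻¹ * x * diagGL a : GL (Fin n) ℚ_[ℓ]) i j =
        ((a i)⁻¹ : ℚ_[ℓ]ˣ) * x i j * a j := by
      change (Matrix.diagonal (fun i => (((a i)⁻¹ : ℚ_[ℓ]ˣ) : ℚ_[ℓ])) *
        (x : Matrix (Fin n) (Fin n) ℚ_[ℓ]) * Matrix.diagonal fun i => (a i : ℚ_[ℓ])) i j = _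
      rw [Matrix.mul_diagonal, Matrix.diagonal_mul]
    refine le_trans ?_ (hx i j)
    rw [e]
    rcases lt_or_ge i j with h | h
    · simp [hx0 i j h]
    · have h0 : 0 < ‖(a i : ℚ_[ℓ])‖ := norm_pos_iff.mpr (a i).ne_zero
      rw [norm_mul, norm_mul, Units.val_inv_eq_inv_val, norm_inv, mul_right_comm]
      refine mul_le_of_le_one_left (norm_nonneg _) ?_
      rw [inv_mul_le_one₀ h0]
      exact ha i j h
  refine ⟨key b hb.1 hl, ?_⟩
  have e : ((diagGL a)⁻¹ * b * diagGL a)⁻¹ = (diagGL a)⁻¹ * b⁻¹ * diagGL a := by group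
  rw [e]
  refine key _ hb.2 fun i j h => ?_
  have hT : (b : Matrix (Fin n) (Fin n) ℚ_[ℓ]).BlockTriangular OrderDual.toDual :=
    fun i j h => hl i j h
  have := Matrix.blockTriangular_inv_of_blockTriangular hT
  rw [Matrix.coe_units_inv]
  exact this h

/-- The stabilizer of a vector in a representation. -/
def stab {Γ V : Type*} [Group Γ] [AddCommGroup V] [Module ℂ V] (ρ : Representation ℂ Γ V) (v : V) :
    Subgroup Γ where
  carrier := {g | ρ g v = v}
  one_mem' := by simp
  mul_mem' := by
    intro g h hg hh
    rw [Set.mem_ofPred_eq, map_mul, Module.End.mul_apply, hh, hg]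
  inv_mem' := by
    intro g hg
    rw [Set.mem_ofPred_eq]
    conv_lhs => rw [← show ρ g v = v from hg]
    rw [← Module.End.mul_apply, ← map_mul, inv_mul_cancel, map_one, Module.End.one_apply]

lemma IsSmooth.isOpen_stab {Γ V : Type*} [Group Γ] [TopologicalSpace Γ] [ContinuousMul Γ]
    [AddCommGroup V] [Module ℂ V] {ρ : Representation ℂ Γ V} (hρ : IsSmooth ρ) (v : V) :
    IsOpen (stab ρ v : Set Γ) := by
  obtain ⟨U, hU, h⟩ := hρ v
  exact Subgroup.isOpen_mono (H₁ := U) (fun g hg => h g hg) hU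

/-- If `m` makes `k` lower triangular and is absorbed by `f` to the left of `s`, then `k` is
invisible between `s` and `t`. -/
lemma apply_eq_of_conj_mem {Γ V : Type*} [Group Γ] [AddCommGroup V] [Module ℂ V]
    {ρ : Representation ℂ Γ V} {f : V →ₗ[ℂ] ℂ} {s k t m : Γ} {v : V}
    (h : f (ρ (s * m * (k * t)) v) = f (ρ (s * (k * t)) v)) (hv : ρ (t⁻¹ * (m * k) * t) v = v) :
    f (ρ (s * (k * t)) v) = f (ρ (s * t) v) := by
  rw [← h, show s * m * (k * t) = s * t * (t⁻¹ * (m * k) * t) by group, map_mul ρ (s * t),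
    Module.End.mul_apply, hv]

end Iwahori

/-! ### Growth of the Whittaker functions -/

section WhittakerGrowth

variable {ℓ : ℕ} [Fact ℓ.Prime]
variable {V₁ V₂ : Type*} [AddCommGroup V₁] [Module ℂ V₁] [AddCommGroup V₂] [Module ℂ V₂]
  {σ' : Representation ℂ (GSp4 ℚ_[ℓ]) V₁} {τ' : Representation ℂ (GL (Fin 2) ℚ_[ℓ]) V₂}
  {Ψ : AddChar ℚ_[ℓ] ℂ} {Wσ : V₁ →ₗ[ℂ] ℂ} {Wτ : V₂ →ₗ[ℂ] ℂ}

lemma diagGL_mul_diagGL {n : Type*} [Fintype n] [DecidableEq n] {R : Type*} [CommRing R]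
    (a b : n → Rˣ) : diagGL a * diagGL b = diagGL (a * b) := by
  refine Units.ext ?_
  rw [Units.val_mul, coe_diagGL, coe_diagGL, coe_diagGL, Matrix.diagonal_mul_diagonal]
  rfl

lemma diagGL_one {n : Type*} [Fintype n] [DecidableEq n] {R : Type*} [CommRing R] :
    diagGL (1 : n → Rˣ) = 1 := by
  refine Units.ext ?_
  rw [coe_diagGL]
  simp

lemma map_conj_mul_inv {Γ A : Type*} [Group Γ] [CommGroup A] (f : Γ →* A) (t b : Γ) :
    f (t⁻¹ * b * t * b⁻¹) = 1 := by
  rw [map_mul, map_mul, map_mul, map_inv, map_inv, inv_mul_cancel_comm, mul_inv_cancel]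

/-- `diag(ℓ^(i+j), ℓ^j)`. -/
noncomputable def torus₂ (ℓ : ℕ) [Fact ℓ.Prime] (i j : ℤ) : GL (Fin 2) ℚ_[ℓ] :=
  diagGL ![ϖ ℓ ^ (i + j), ϖ ℓ ^ j]

/-- `diag(ℓ^(i+2j), ℓ^(i+j), ℓ^j, 1)`. -/
noncomputable def torus₄ (ℓ : ℕ) [Fact ℓ.Prime] (i j : ℤ) : GSp4 ℚ_[ℓ] :=
  kl (torus₂ ℓ i j) 0 0 0

lemma torus₂_add (i j i' j' : ℤ) :
    torus₂ ℓ (i + i') (j + j') = torus₂ ℓ i j * torus₂ ℓ i' j' := by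
  rw [torus₂, torus₂, torus₂, diagGL_mul_diagGL]
  congr 1
  funext k
  fin_cases k
  · change ϖ ℓ ^ (i + i' + (j + j')) = ϖ ℓ ^ (i + j) * ϖ ℓ ^ (i' + j')
    rw [← zpow_add]
    congr 1
    ring
  · exact zpow_add _ _ _

lemma torus₂_zero : torus₂ ℓ 0 0 = 1 := by
  rw [torus₂, ← diagGL_one]
  congr 1
  funext k
  fin_cases k <;> simp

lemma torus₄_add (i j i' j' : ℤ) :
    torus₄ ℓ (i + i') (j + j') = torus₄ ℓ i j * torus₄ ℓ i' j' := by
  rw [torus₄, torus₄, torus₄, kl_mul, torus₂_add]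
  simp

lemma kl_one : kl (1 : GL (Fin 2) ℚ_[ℓ]) 0 0 0 = 1 := by
  refine GSp4_ext ?_ (by simp)
  rw [mat_kl, mat_one]
  ext i j
  fin_cases i <;> fin_cases j <;> simp

lemma torus₄_zero : torus₄ ℓ 0 0 = 1 := by
  rw [torus₄, torus₂_zero, kl_one]

lemma torus₄_eq (i j : ℤ) (h) :
    torus₄ ℓ i j = diagGSp4 (ϖ ℓ ^ (i + 2 * j)) (ϖ ℓ ^ (i + j)) (ϖ ℓ ^ j) 1 h := by
  rw [torus₄, torus₂, kl_diag]
  refine diagGSp4_congr _ _ ?_ rfl rfl rfl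
  rw [← zpow_add]
  congr 1
  ring

lemma torus₂_mul_unip (i j : ℤ) (s : ℚ_[ℓ]) :
    torus₂ ℓ i j * unip s =
      unip ((ϖ ℓ ^ (i + j) : ℚ_[ℓ]ˣ) / (ϖ ℓ ^ j : ℚ_[ℓ]ˣ) * s) * torus₂ ℓ i j := by
  have := congrArg (pr₂ _) (torus_mul_klG (a := ϖ ℓ ^ (i + j)) (b := ϖ ℓ ^ j) rfl s s 0 0 0)
  simpa only [map_mul, torus, torus₂, pr₂_klG] using this

lemma torus₄_mul_kl (i j : ℤ) (s v₁ v₂ z : ℚ_[ℓ]) :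
    torus₄ ℓ i j * kl (unip s) v₁ v₂ z =
      kl (unip ((ϖ ℓ ^ (i + j) : ℚ_[ℓ]ˣ) / (ϖ ℓ ^ j : ℚ_[ℓ]ˣ) * s))
        ((ϖ ℓ ^ (i + j) : ℚ_[ℓ]ˣ) * v₁) ((ϖ ℓ ^ j : ℚ_[ℓ]ˣ) * v₂)
        ((ϖ ℓ ^ (i + j) : ℚ_[ℓ]ˣ) * (ϖ ℓ ^ j : ℚ_[ℓ]ˣ) * z) * torus₄ ℓ i j := by
  have := congrArg (pr₁ _) (torus_mul_klG (a := ϖ ℓ ^ (i + j)) (b := ϖ ℓ ^ j) rfl s s v₁ v₂ z)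
  simpa only [map_mul, torus, torus₄, torus₂, pr₁_klG] using this

lemma norm_ϖ_zpow_div (i j : ℤ) :
    ‖((ϖ ℓ ^ (i + j) : ℚ_[ℓ]ˣ) / (ϖ ℓ ^ j : ℚ_[ℓ]ˣ) : ℚ_[ℓ])‖ = (ℓ : ℝ) ^ (-i) := by
  have h0 : (ℓ : ℝ) ≠ 0 := (zero_lt_one.trans one_lt_cast).ne'
  rw [norm_div, norm_ϖ_zpow, norm_ϖ_zpow, ← zpow_sub₀ h0]
  congr 1
  ring

lemma zpow_neg_natCast_le_one (i : ℕ) : (ℓ : ℝ) ^ (-(i : ℤ)) ≤ 1 :=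
  zpow_le_one_of_nonpos₀ one_lt_cast.le (by omega)

lemma unip_mem_iwahori {s : ℚ_[ℓ]} (hs : ‖s‖ ≤ 1) : unip s ∈ iwahori ℓ 2 := by
  have key : ∀ t : ℚ_[ℓ], ‖t‖ ≤ 1 → !![1, t; 0, 1] ∈ iwahoriOrder ℓ 2 := by
    intro t ht i j
    fin_cases i <;> fin_cases j <;> simp [ht]
  exact ⟨key s hs, key (-s) (by rwa [norm_neg])⟩

/-- The Whittaker function of a vector fixed by `SL₂(ℤ_ℓ)` grows at most exponentially on dominant
diagonal matrices. -/
lemma exists_norm_wGL2_le (hΨ : IsUnramifiedAddChar ℓ Ψ) (hτa : IsAdmissible τ')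
    (hWτ : IsWhittaker₂ τ' Ψ Wτ) {w : V₂}
    (hw : ∀ g : GL (Fin 2) ℚ_[ℓ], (∀ i j, ‖g i j‖ ≤ 1) →
      (g : Matrix (Fin 2) (Fin 2) ℚ_[ℓ]).det = 1 → τ' g w = w) :
    ∃ C R : ℝ, 0 ≤ C ∧ 1 ≤ R ∧ ∀ i j : ℕ, ‖Wτ (τ' (torus₂ ℓ i j) w)‖ ≤ C * R ^ (i + j) := by
  have key : ∀ i j : ℕ, ∀ i' j' : ℤ, 0 ≤ i' → ∀ k ∈ iwahori ℓ 2 ⊓ stab τ' w, ∀ v,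
      (∀ k ∈ iwahori ℓ 2 ⊓ stab τ' w, τ' k v = v) →
      Wτ (τ' (torus₂ ℓ i j * (k * torus₂ ℓ i' j')) v) =
        Wτ (τ' (torus₂ ℓ i j * torus₂ ℓ i' j') v) := by
    intro i j i' j' hi' k ⟨hk, hkw⟩ v hv
    have h11 := iwahori_norm_apply_self hk 1
    have h11' : k 1 1 ≠ 0 := by
      intro h; rw [h, norm_zero] at h11; exact zero_ne_one h11
    have hs : ‖-k 0 1 / k 1 1‖ ≤ 1 := by
      rw [norm_div, h11, div_one, norm_neg]
      exact iwahoriOrder_norm_le hk.1 0 1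
    have hm := unip_mem_iwahori hs
    set m := unip (-k 0 1 / k 1 1) with hm_def
    have hdet : (m : Matrix (Fin 2) (Fin 2) ℚ_[ℓ]).det = 1 := by simp [hm_def, coe_unip]
    have hmw : τ' m w = w := hw m (iwahoriOrder_norm_le hm.1) hdet
    have hb := mul_mem hm hk
    have hc : (torus₂ ℓ i' j')⁻¹ * (m * k) * torus₂ ℓ i' j' ∈ iwahori ℓ 2 := by
      refine conj_mem_iwahori hb ?_ ?_
      · intro a b hab
        have e : (m * k) 0 1 = 0 := by
          rw [Units.val_mul, hm_def, coe_unip, Matrix.mul_apply, Fin.sum_univ_two]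
          simp [h11']
        fin_cases a <;> fin_cases b <;> simp at hab
        exact e
      · intro a b hab
        fin_cases a <;> fin_cases b <;> simp at hab
        · exact le_rfl
        · change ‖((ϖ ℓ ^ (i' + j') : ℚ_[ℓ]ˣ) : ℚ_[ℓ])‖ ≤ ‖((ϖ ℓ ^ j' : ℚ_[ℓ]ˣ) : ℚ_[ℓ])‖
          rw [norm_ϖ_zpow, norm_ϖ_zpow]
          exact zpow_le_zpow_right₀ one_lt_cast.le (by omega)
        · exact le_rfl
    refine apply_eq_of_conj_mem (m := m) ?_ (hv _ ⟨hc, ?_⟩)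
    · rw [hm_def, torus₂_mul_unip, mul_assoc (unip _), map_mul, Module.End.mul_apply,
        hWτ.apply_unip, hΨ.1, one_mul]
      rw [norm_neg, norm_mul, norm_ϖ_zpow_div]
      exact mul_le_one₀ (zpow_neg_natCast_le_one i) (norm_nonneg _) hs
    · have hbw : τ' (m * k) w = w := by
        rw [map_mul, Module.End.mul_apply, show τ' k w = w from hkw, hmw]
      change τ' _ w = w
      rw [← inv_mul_cancel_right ((torus₂ ℓ i' j')⁻¹ * (m * k) * torus₂ ℓ i' j') (m * k), map_mul,
        Module.End.mul_apply, hbw]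
      refine hw _ (iwahoriOrder_norm_le (mul_mem hc (inv_mem hb)).1) ?_
      exact congrArg Units.val
        (map_conj_mul_inv Matrix.GeneralLinearGroup.det (torus₂ ℓ i' j') (m * k))
  refine exists_norm_apply_le (I := iwahori ℓ 2 ⊓ stab τ' w) ?_ ?_ hτa Wτ (t₁ := torus₂ ℓ 1 0)
    (t₂ := torus₂ ℓ 0 1) (s := fun i j => torus₂ ℓ i j) ?_ ?_ torus₂_zero
    (fun i j => key i j 1 0 zero_le_one) (fun i j => key i j 0 1 le_rfl) fun k hk => hk.2
  · exact (isOpen_iwahori 2).inter (hτa.1.isOpen_stab w)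
  · exact (isCompact_iwahori 2).inter_right
      (Subgroup.isClosed_of_isOpen _ (hτa.1.isOpen_stab w))
  · intro i j
    rw [← torus₂_add]; simp
  · intro i j
    rw [← torus₂_add]; simp

/-- The Iwahori subgroup of `GSp₄(ℚ_ℓ)`. -/
def iwahoriGSp4 (ℓ : ℕ) [Fact ℓ.Prime] : Subgroup (GSp4 ℚ_[ℓ]) where
  carrier := {g | g.1.1 ∈ iwahori ℓ 4 ∧ ‖((mult ℚ_[ℓ] g : ℚ_[ℓ]ˣ) : ℚ_[ℓ])‖ = 1}
  one_mem' := ⟨one_mem _, by simp⟩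
  mul_mem' := by
    rintro g h ⟨hg, hg'⟩ ⟨hh, hh'⟩
    exact ⟨mul_mem hg hh, by rw [map_mul, Units.val_mul, norm_mul, hg', hh', mul_one]⟩
  inv_mem' := by
    rintro g ⟨hg, hg'⟩
    exact ⟨inv_mem hg, by rw [map_inv, Units.val_inv_eq_inv_val, norm_inv, hg', inv_one]⟩

lemma iwahoriGSp4_eq_preimage : (iwahoriGSp4 ℓ : Set (GSp4 ℚ_[ℓ])) =
    Subtype.val ⁻¹' ((iwahori ℓ 4 : Set (GL (Fin 4) ℚ_[ℓ])) ×ˢ (unitsPC ℓ : Set ℚ_[ℓ]ˣ)) := rfl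

lemma isOpen_iwahoriGSp4 : IsOpen (iwahoriGSp4 ℓ : Set (GSp4 ℚ_[ℓ])) := by
  rw [iwahoriGSp4_eq_preimage]
  refine ((isOpen_iwahori 4).prod ?_).preimage continuous_subtype_val
  have : (unitsPC ℓ : Set ℚ_[ℓ]ˣ) = Units.val ⁻¹' Metric.sphere (0 : ℚ_[ℓ]) 1 := by
    ext x
    exact mem_sphere_zero_iff_norm.symm
  rw [this]
  exact (IsUltrametricDist.isOpen_sphere _ one_ne_zero).preimage Units.continuous_val

lemma isClosed_GSp4 : IsClosed (GSp4 ℚ_[ℓ] : Set (GL (Fin 4) ℚ_[ℓ] × ℚ_[ℓ]ˣ)) := by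
  have h1 : Continuous fun p : GL (Fin 4) ℚ_[ℓ] × ℚ_[ℓ]ˣ =>
      (p.1 : Matrix (Fin 4) (Fin 4) ℚ_[ℓ]) := Units.continuous_val.comp continuous_fst
  have h2 : Continuous fun p : GL (Fin 4) ℚ_[ℓ] × ℚ_[ℓ]ˣ => (p.2 : ℚ_[ℓ]) :=
    Units.continuous_val.comp continuous_snd
  exact isClosed_eq ((h1.matrix_transpose.matrix_mul continuous_const).matrix_mul h1)
    (h2.smul continuous_const)

lemma isCompact_iwahoriGSp4 : IsCompact (iwahoriGSp4 ℓ : Set (GSp4 ℚ_[ℓ])) := by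
  rw [iwahoriGSp4_eq_preimage]
  exact isClosed_GSp4.isClosedEmbedding_subtypeVal.isCompact_preimage
    ((isCompact_iwahori 4).prod (unitsPC ℓ).isCompact)

lemma kl_unip_mem_iwahoriGSp4 {s v₁ v₂ z : ℚ_[ℓ]} (hs : ‖s‖ ≤ 1) (h₁ : ‖v₁‖ ≤ 1)
    (h₂ : ‖v₂‖ ≤ 1) (hz : ‖z‖ ≤ 1) : kl (unip s) v₁ v₂ z ∈ iwahoriGSp4 ℓ := by
  have key : ∀ s v₁ v₂ z : ℚ_[ℓ], ‖s‖ ≤ 1 → ‖v₁‖ ≤ 1 → ‖v₂‖ ≤ 1 → ‖z‖ ≤ 1 →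
      mat (kl (unip s) v₁ v₂ z) ∈ iwahoriOrder ℓ 4 := by
    intro s v₁ v₂ z hs h₁ h₂ hz i j
    have h := norm_kl_le (unip_norm_le hs) h₁ h₂ hz i j
    rw [mat_kl, coe_unip] at h ⊢
    fin_cases i <;> fin_cases j <;> simp at h ⊢ <;> exact h
  have hinv : (kl (unip s) v₁ v₂ z)⁻¹ = kl (unip (-s)) (s * v₂ - v₁) (-v₂) (-z) := by
    refine inv_eq_of_mul_eq_one_right ?_
    rw [kl_mul, ← kl_one]
    have hu : unip s * unip (-s) = 1 := by
      refine Units.ext ?_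
      rw [Units.val_mul, coe_unip, coe_unip]
      ext i j
      fin_cases i <;> fin_cases j <;> simp
    rw [hu, coe_unip]
    congr 1 <;> simp <;> ring
  refine ⟨⟨key _ _ _ _ hs h₁ h₂ hz, ?_⟩, by simp [det_unip]⟩
  have : ((kl (unip s) v₁ v₂ z)⁻¹).1.1 = (kl (unip s) v₁ v₂ z).1.1⁻¹ := rfl
  rw [← this, hinv]
  exact key _ _ _ _ (by rwa [norm_neg]) (norm_sub_le_of (norm_mul_le_of hs h₂) h₁)
    (by rwa [norm_neg]) (by rwa [norm_neg])

lemma iwahoriGSp4_norm_le {g : GSp4 ℚ_[ℓ]} (hg : g ∈ iwahoriGSp4 ℓ) (i j : Fin 4) :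
    ‖mat g i j‖ ≤ 1 := iwahoriOrder_norm_le hg.1.1 i j

/-- The row operations that clear a matrix, upper triangular modulo `ℓ`, above the diagonal in the
last two columns. -/
lemma exists_clear_above {A : Matrix (Fin 4) (Fin 4) ℚ_[ℓ]} (h1 : ∀ i j, ‖A i j‖ ≤ 1)
    (h33 : ‖A 3 3‖ = 1) (h22 : ‖A 2 2‖ = 1) (h32 : ‖A 3 2‖ ≤ (ℓ : ℝ)⁻¹) :
    ∃ s v₁ v₂ z : ℚ_[ℓ], ‖s‖ ≤ 1 ∧ ‖v₁‖ ≤ 1 ∧ ‖v₂‖ ≤ 1 ∧ ‖z‖ ≤ 1 ∧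
      A 2 3 + v₂ * A 3 3 = 0 ∧ A 1 3 + s * A 2 3 + v₁ * A 3 3 = 0 ∧
      A 1 2 + s * A 2 2 + v₁ * A 3 2 = 0 ∧
      A 0 3 - v₂ * A 1 3 + (v₁ - s * v₂) * A 2 3 + z * A 3 3 = 0 := by
  have hd0 : ‖A 2 2 * A 3 3 - A 2 3 * A 3 2‖ = 1 := by
    have hlt : ‖A 2 3 * A 3 2‖ < 1 := by
      rw [norm_mul]
      exact mul_lt_one_of_nonneg_of_lt_one_right (h1 2 3) (norm_nonneg _)
        (h32.trans_lt inv_cast_lt_one)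
    have e : ‖A 2 2 * A 3 3‖ = 1 := by rw [norm_mul, h22, h33, mul_one]
    rw [sub_eq_add_neg, Padic.add_eq_max_of_ne, norm_neg, e, max_eq_left hlt.le]
    rw [norm_neg, e]
    exact hlt.ne'
  have n33 : A 3 3 ≠ 0 := by intro h; rw [h, norm_zero] at h33; exact zero_ne_one h33
  have nd : A 2 2 * A 3 3 - A 2 3 * A 3 2 ≠ 0 := by
    intro h; rw [h, norm_zero] at hd0; exact zero_ne_one hd0
  have hdiv : ∀ {x y : ℚ_[ℓ]}, ‖x‖ ≤ 1 → ‖y‖ = 1 → y ≠ 0 → ∃ w, ‖w‖ ≤ 1 ∧ w * y = x := by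
    intro x y hx hy hy0
    exact ⟨x / y, by rwa [norm_div, hy, div_one], div_mul_cancel₀ x hy0⟩
  obtain ⟨v₂, nv₂, hv₂⟩ := hdiv (show ‖-A 2 3‖ ≤ 1 by rw [norm_neg]; exact h1 _ _) h33 n33
  obtain ⟨s, ns, hs⟩ := hdiv (norm_sub_le_of (norm_mul_le_of (h1 1 3) (h1 3 2))
    (norm_mul_le_of (h1 1 2) (h1 3 3))) hd0 nd
  obtain ⟨v₁, nv₁, hv₁⟩ := hdiv (show ‖-(A 1 3 + s * A 2 3)‖ ≤ 1 by
    rw [norm_neg]; exact norm_add_le_of (h1 _ _) (norm_mul_le_of ns (h1 _ _))) h33 n33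
  obtain ⟨z, nz, hz⟩ := hdiv (show ‖-(A 0 3 - v₂ * A 1 3 + (v₁ - s * v₂) * A 2 3)‖ ≤ 1 by
    rw [norm_neg]
    exact norm_add_le_of (norm_sub_le_of (h1 _ _) (norm_mul_le_of nv₂ (h1 _ _)))
      (norm_mul_le_of (norm_sub_le_of nv₁ (norm_mul_le_of ns nv₂)) (h1 _ _))) h33 n33
  refine ⟨s, v₁, v₂, z, ns, nv₁, nv₂, nz, by rw [hv₂, add_neg_cancel], by rw [hv₁, add_neg_cancel],
    mul_right_cancel₀ n33 ?_, by rw [hz, add_neg_cancel]⟩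
  linear_combination hs + A 3 2 * hv₁

/-- Elements of the Iwahori subgroup are products of an upper unitriangular and a lower triangular
matrix. -/
lemma exists_kl_mul_lower {k : GSp4 ℚ_[ℓ]} (hk : k ∈ iwahoriGSp4 ℓ) :
    ∃ s v₁ v₂ z : ℚ_[ℓ], ‖s‖ ≤ 1 ∧ ‖v₁‖ ≤ 1 ∧ ‖v₂‖ ≤ 1 ∧ ‖z‖ ≤ 1 ∧
      ∀ i j, i < j → mat (kl (unip s) v₁ v₂ z * k) i j = 0 := by
  have h33 : ‖mat k 3 3‖ = 1 := iwahori_norm_apply_self hk.1 3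
  obtain ⟨s, v₁, v₂, z, ns, nv₁, nv₂, nz, e23, e13, e12, e03⟩ :=
    exists_clear_above (iwahoriGSp4_norm_le hk) h33 (iwahori_norm_apply_self hk.1 2)
      (hk.1.1 3 2)
  refine ⟨s, v₁, v₂, z, ns, nv₁, nv₂, nz, ?_⟩
  have hP : ∀ i j, mat (kl (unip s) v₁ v₂ z * k) i j =
      ![mat k 0 j - v₂ * mat k 1 j + (v₁ - s * v₂) * mat k 2 j + z * mat k 3 j,
        mat k 1 j + s * mat k 2 j + v₁ * mat k 3 j, mat k 2 j + v₂ * mat k 3 j, mat k 3 j] i := by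
    intro i j
    rw [mat_mul, mat_kl, coe_unip, Matrix.mul_apply, Fin.sum_univ_four]
    fin_cases i <;> simp
    ring
  replace e23 : mat (kl (unip s) v₁ v₂ z * k) 2 3 = 0 := (hP 2 3).trans e23
  replace e13 : mat (kl (unip s) v₁ v₂ z * k) 1 3 = 0 := (hP 1 3).trans e13
  replace e12 : mat (kl (unip s) v₁ v₂ z * k) 1 2 = 0 := (hP 1 2).trans e12
  replace e03 : mat (kl (unip s) v₁ v₂ z * k) 0 3 = 0 := (hP 0 3).trans e03
  have e33 : mat (kl (unip s) v₁ v₂ z * k) 3 3 ≠ 0 := by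
    rw [show mat (kl (unip s) v₁ v₂ z * k) 3 3 = mat k 3 3 from hP 3 3]
    intro h
    rw [h, norm_zero] at h33
    exact zero_ne_one h33
  clear hP
  generalize kl (unip s) v₁ v₂ z * k = g at *
  -- The form determines the rest of the first row.
  have e01 : mat g 0 1 = 0 := by
    have := mat_pairing g 1 3
    rw [e13, e23, e03] at this
    simpa [J, e33] using this
  have e02 : mat g 0 2 = 0 := by
    have := mat_pairing g 2 3
    rw [e13, e23, e03] at this
    simpa [J, e33] using this
  intro i j hij
  fin_cases i <;> fin_cases j <;> simp at hij <;> assumption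

/-- The Whittaker function of a vector fixed by `Sp₄(ℤ_ℓ)` grows at most exponentially on dominant
diagonal matrices. -/
lemma exists_norm_wGSp4_le (hΨ : IsUnramifiedAddChar ℓ Ψ) (hσa : IsAdmissible σ')
    (hWσ : IsWhittaker₁ σ' Ψ Wσ) {v₀ : V₁}
    (hv₀ : ∀ g : GSp4 ℚ_[ℓ], (∀ i j, ‖mat g i j‖ ≤ 1) → mult ℚ_[ℓ] g = 1 → σ' g v₀ = v₀) :
    ∃ C R : ℝ, 0 ≤ C ∧ 1 ≤ R ∧ ∀ i j : ℕ, ‖Wσ (σ' (torus₄ ℓ i j) v₀)‖ ≤ C * R ^ (i + j) := by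
  have key : ∀ i j : ℕ, ∀ i' j' : ℤ, 0 ≤ i' → 0 ≤ j' → ∀ k ∈ iwahoriGSp4 ℓ ⊓ stab σ' v₀, ∀ v,
      (∀ k ∈ iwahoriGSp4 ℓ ⊓ stab σ' v₀, σ' k v = v) →
      Wσ (σ' (torus₄ ℓ i j * (k * torus₄ ℓ i' j')) v) =
        Wσ (σ' (torus₄ ℓ i j * torus₄ ℓ i' j') v) := by
    intro i j i' j' hi' hj' k ⟨hk, hkv⟩ v hv
    obtain ⟨s, v₁, v₂, z, ns, nv₁, nv₂, nz, hl⟩ := exists_kl_mul_lower hk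
    have hm := kl_unip_mem_iwahoriGSp4 ns nv₁ nv₂ nz
    have hmv : σ' (kl (unip s) v₁ v₂ z) v₀ = v₀ :=
      hv₀ _ (iwahoriGSp4_norm_le hm) (by rw [mult_kl, det_unip])
    have hb := mul_mem hm hk
    have hc : (torus₄ ℓ i' j')⁻¹ * (kl (unip s) v₁ v₂ z * k) * torus₄ ℓ i' j' ∈
        iwahoriGSp4 ℓ := by
      refine ⟨?_, ?_⟩
      · rw [torus₄_eq i' j' (by group)]
        refine conj_mem_iwahori hb.1 hl ?_
        have hmono : ∀ {x y : ℤ}, y ≤ x →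
            ‖((ϖ ℓ ^ x : ℚ_[ℓ]ˣ) : ℚ_[ℓ])‖ ≤ ‖((ϖ ℓ ^ y : ℚ_[ℓ]ˣ) : ℚ_[ℓ])‖ := by
          intro x y hxy
          rw [norm_ϖ_zpow, norm_ϖ_zpow]
          exact zpow_le_zpow_right₀ one_lt_cast.le (by omega)
        have h1 : (1 : ℚ_[ℓ]ˣ) = ϖ ℓ ^ (0 : ℤ) := (zpow_zero _).symm
        rw [h1]
        intro a b hab
        fin_cases a <;> fin_cases b <;> simp at hab <;> exact hmono (by omega)
      · rw [map_mul, map_mul, map_inv, inv_mul_cancel_comm]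
        exact hb.2
    refine apply_eq_of_conj_mem (m := kl (unip s) v₁ v₂ z) ?_ (hv _ ⟨hc, ?_⟩)
    · rw [torus₄_mul_kl, mul_assoc (kl _ _ _ _), map_mul, Module.End.mul_apply,
        hWσ.apply_kl, hΨ.1, one_mul]
      refine norm_sub_le_of (norm_mul_le_of ?_ ns) (norm_mul_le_of ?_ nv₂)
      · rw [norm_ϖ_zpow_div]; exact zpow_neg_natCast_le_one i
      · rw [norm_ϖ_zpow]; exact zpow_neg_natCast_le_one j
    · have hbv : σ' (kl (unip s) v₁ v₂ z * k) v₀ = v₀ := by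
        rw [map_mul, Module.End.mul_apply, show σ' k v₀ = v₀ from hkv, hmv]
      generalize kl (unip s) v₁ v₂ z * k = b at hb hc hbv ⊢
      change σ' _ v₀ = v₀
      rw [← inv_mul_cancel_right ((torus₄ ℓ i' j')⁻¹ * b * torus₄ ℓ i' j') b, map_mul,
        Module.End.mul_apply, hbv]
      exact hv₀ _ (iwahoriGSp4_norm_le (mul_mem hc (inv_mem hb)))
        (map_conj_mul_inv (mult ℚ_[ℓ]) (torus₄ ℓ i' j') b)
  refine exists_norm_apply_le (I := iwahoriGSp4 ℓ ⊓ stab σ' v₀) ?_ ?_ hσa Wσ (t₁ := torus₄ ℓ 1 0)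
    (t₂ := torus₄ ℓ 0 1) (s := fun i j => torus₄ ℓ i j) ?_ ?_ torus₄_zero
    (fun i j => key i j 1 0 zero_le_one le_rfl) (fun i j => key i j 0 1 le_rfl zero_le_one)
    fun k hk => hk.2
  · exact isOpen_iwahoriGSp4.inter (hσa.1.isOpen_stab v₀)
  · exact isCompact_iwahoriGSp4.inter_right
      (Subgroup.isClosed_of_isOpen _ (hσa.1.isOpen_stab v₀))
  · intro i j
    rw [← torus₄_add]; simp
  · intro i j
    rw [← torus₄_add]; simp

end WhittakerGrowth

/-! ### Convergence of the double sums -/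

section Convergence

variable {ℓ : ℕ} [Fact ℓ.Prime]
variable {V₁ V₂ : Type*} [AddCommGroup V₁] [Module ℂ V₁] [AddCommGroup V₂] [Module ℂ V₂]
  {σ' : Representation ℂ (GSp4 ℚ_[ℓ]) V₁} {τ' : Representation ℂ (GL (Fin 2) ℚ_[ℓ]) V₂}
  {Ψ : AddChar ℚ_[ℓ] ℂ} {Wσ : V₁ →ₗ[ℂ] ℂ} {Wτ : V₂ →ₗ[ℂ] ℂ} {v₀ : V₁} {w₀ : V₂}
  {η : ℚ_[ℓ]ˣ →* ℂˣ}

/-- The first factor of a `G(ℤ_ℓ)`-invariant pure tensor is fixed by `Sp₄(ℤ_ℓ)`, which is contained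
in `G(ℤ_ℓ)`. -/
lemma fixed_of_mult_eq_one (hsph : ∀ k ∈ GZ ℓ, boxRep σ' τ' k (v₀ ⊗ₜ[ℂ] w₀) = v₀ ⊗ₜ[ℂ] w₀)
    (hw : Wτ w₀ ≠ 0) (g : GSp4 ℚ_[ℓ]) (h₁ : ∀ i j, ‖mat g i j‖ ≤ 1) (h₂ : mult ℚ_[ℓ] g = 1) :
    σ' g v₀ = v₀ := by
  have hk : mkG g 1 (by rw [h₂, map_one]) ∈ GZ ℓ := by
    rw [mem_GZ_iff]
    refine ⟨h₁, fun i j => ?_, by rw [pr₁_mkG, h₂]; simp⟩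
    rw [pr₂_mkG, Units.val_one]
    fin_cases i <;> fin_cases j <;> simp
  have h : σ' g v₀ ⊗ₜ[ℂ] τ' 1 w₀ = v₀ ⊗ₜ[ℂ] w₀ := hsph _ hk
  have := congrArg (TensorProduct.rid ℂ V₁ ∘ LinearMap.lTensor V₁ Wτ) h
  simp only [Function.comp_apply, LinearMap.lTensor_tmul, TensorProduct.rid_tmul, map_one,
    Module.End.one_apply] at this
  exact smul_right_injective V₁ hw this

/-- The second factor of a `G(ℤ_ℓ)`-invariant pure tensor is fixed by `SL₂(ℤ_ℓ)`. -/
lemma fixed_of_det_eq_one (hsph : ∀ k ∈ GZ ℓ, boxRep σ' τ' k (v₀ ⊗ₜ[ℂ] w₀) = v₀ ⊗ₜ[ℂ] w₀)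
    (hv : Wσ v₀ ≠ 0) (g : GL (Fin 2) ℚ_[ℓ]) (h₁ : ∀ i j, ‖g i j‖ ≤ 1)
    (h₂ : (g : Matrix (Fin 2) (Fin 2) ℚ_[ℓ]).det = 1) : τ' g w₀ = w₀ := by
  have hd : Matrix.GeneralLinearGroup.det g = 1 := Units.ext h₂
  have hk : mkG 1 g (by rw [hd, map_one]) ∈ GZ ℓ := by
    rw [mem_GZ_iff]
    refine ⟨fun i j => ?_, h₁, by rw [pr₁_mkG, map_one]; simp⟩
    rw [pr₁_mkG, mat_one]
    fin_cases i <;> fin_cases j <;> simp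
  have h : σ' 1 v₀ ⊗ₜ[ℂ] τ' g w₀ = v₀ ⊗ₜ[ℂ] w₀ := hsph _ hk
  have := congrArg (TensorProduct.lid ℂ V₂ ∘ LinearMap.rTensor V₂ Wσ) h
  simp only [Function.comp_apply, LinearMap.rTensor_tmul, TensorProduct.lid_tmul, map_one,
    Module.End.one_apply] at this
  exact smul_right_injective V₂ hv this

lemma mul_torus₂_zero_left (g : GL (Fin 2) ℚ_[ℓ]) (b : ℤ) :
    g * torus₂ ℓ 0 b = torus₂ ℓ 0 b * g := by
  refine Units.ext ?_
  rw [Units.val_mul, Units.val_mul, torus₂, coe_diagGL]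
  ext i j
  rw [Matrix.mul_diagonal, Matrix.diagonal_mul, mul_comm]
  fin_cases i <;> fin_cases j <;> simp

lemma wGSp4_eq (i j : ℤ) : wGSp4 σ' Wσ v₀ i j = Wσ (σ' (torus₄ ℓ i j) v₀) := by
  rw [torus₄_eq i j (by group)]
  rfl

lemma wGL2_eq (i j b : ℤ) :
    wGL2 τ' Wτ w₀ i (j + b) = Wτ (τ' (torus₂ ℓ i j) (τ' (torus₂ ℓ 0 b) w₀)) := by
  rw [← Module.End.mul_apply, ← map_mul, ← torus₂_add, add_zero]
  rfl

/-- The terms vanish outside of the dominant cone. The condition on `a` and `b` says that the two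
diagonal elements have the same multiplier. -/
lemma term_eq_zero (hF : IsSphericalWhittaker Ψ (whit σ' τ' Wσ Wτ v₀ w₀))
    (hΨ : IsUnramifiedAddChar ℓ Ψ) (s : ℂ) {a b i j : ℤ} (hab : a + 2 * b = 0)
    (h : ¬ (0 ≤ i ∧ 0 ≤ j ∧ 0 ≤ i + a)) : term σ' τ' Wσ Wτ v₀ w₀ η s a b i j = 0 := by
  have ht : ϖ ℓ ^ (i + j) * ϖ ℓ ^ j = ϖ ℓ ^ (i + a + (j + b)) * ϖ ℓ ^ (j + b) := by
    rw [← zpow_add, ← zpow_add]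
    congr 1
    linear_combination -hab
  have h0 := hF.torus_eq_zero hΨ ht (by
    have hle : ∀ n : ℤ, (ℓ : ℝ) ^ (-n) ≤ 1 ↔ 0 ≤ n := by
      intro n
      rw [zpow_le_one_iff_right₀ one_lt_cast]
      omega
    rw [norm_ϖ_zpow_div, norm_ϖ_zpow_div, norm_ϖ_zpow, hle, hle, hle]
    tauto)
  rw [whit_torus hF ht (val_ϖ_zpow _) (val_ϖ_zpow _) (val_ϖ_zpow _) (val_ϖ_zpow _)] at h0
  rw [term, h0, zero_mul, zero_mul]

lemma exists_norm_term_le (hF : IsSphericalWhittaker Ψ (whit σ' τ' Wσ Wτ v₀ w₀))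
    (hσa : IsAdmissible σ') (hτa : IsAdmissible τ') (hΨ : IsUnramifiedAddChar ℓ Ψ)
    (hWσ : IsWhittaker₁ σ' Ψ Wσ) (hWτ : IsWhittaker₂ τ' Ψ Wτ)
    (hsph : ∀ k ∈ GZ ℓ, boxRep σ' τ' k (v₀ ⊗ₜ[ℂ] w₀) = v₀ ⊗ₜ[ℂ] w₀)
    (hv : Wσ v₀ ≠ 0) (hw : Wτ w₀ ≠ 0) (η : ℚ_[ℓ]ˣ →* ℂˣ) {a b : ℤ} (hab : a + 2 * b = 0) :
    ∃ C R : ℝ, 1 ≤ R ∧ ∀ (s : ℂ) (i j : ℕ),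
      ‖term σ' τ' Wσ Wτ v₀ w₀ η s a b i j‖ ≤ C * (R * ‖X η s‖) ^ (i + 2 * j) := by
  obtain ⟨C₁, R₁, hC₁, hR₁, h₁⟩ :=
    exists_norm_wGSp4_le hΨ hσa hWσ (fixed_of_mult_eq_one hsph hw)
  -- The shift by `b` is the action of a scalar matrix and is absorbed into the vector.
  obtain ⟨C₂, R₂, hC₂, hR₂, h₂⟩ := exists_norm_wGL2_le hΨ hτa hWτ (w := τ' (torus₂ ℓ 0 b) w₀) (by
    intro g hg hg'
    rw [← Module.End.mul_apply, ← map_mul, mul_torus₂_zero_left, map_mul, Module.End.mul_apply,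
      fixed_of_det_eq_one hsph hv g hg hg'])
  have hq : (1 : ℝ) ≤ (ℓ : ℝ) ^ 2 := one_le_pow₀ one_lt_cast.le
  have hR : 1 ≤ R₁ * R₂ * (ℓ : ℝ) ^ 2 :=
    one_le_mul_of_one_le_of_one_le (one_le_mul_of_one_le_of_one_le hR₁ hR₂) hq
  refine ⟨C₁ * C₂ * R₂ ^ a.natAbs, R₁ * R₂ * (ℓ : ℝ) ^ 2, hR, fun s i j => ?_⟩
  have h0 : 0 ≤ C₁ * C₂ * R₂ ^ a.natAbs := by positivity
  by_cases hc : 0 ≤ (i : ℤ) + a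
  swap
  · rw [term_eq_zero hF hΨ s hab (by tauto), norm_zero]
    exact mul_nonneg h0 (pow_nonneg (mul_nonneg (zero_le_one.trans hR) (norm_nonneg _)) _)
  obtain ⟨n, hn⟩ := Int.eq_ofNat_of_zero_le hc
  have e2 : (ℓ : ℂ) ^ (2 * ((i : ℤ) + j)) = ((ℓ : ℂ) ^ 2) ^ (i + j) := by
    rw [zpow_mul]
    norm_cast
  have e3 : X η s ^ ((i : ℤ) + 2 * j) = X η s ^ (i + 2 * j) := by norm_cast
  rw [term, wGSp4_eq, hn, wGL2_eq, e2, e3, norm_mul, norm_mul, norm_mul, norm_pow, norm_pow,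
    norm_pow, Complex.norm_natCast, mul_pow, ← mul_assoc]
  refine mul_le_mul_of_nonneg_right ?_ (by positivity)
  have hb₂ : ‖Wτ (τ' (torus₂ ℓ n j) (τ' (torus₂ ℓ 0 b) w₀))‖ ≤
      C₂ * R₂ ^ a.natAbs * R₂ ^ (i + j) := by
    refine (h₂ n j).trans ?_
    rw [mul_assoc, ← pow_add]
    exact mul_le_mul_of_nonneg_left (pow_le_pow_right₀ hR₂ (by omega)) hC₂
  calc _ ≤ (C₁ * R₁ ^ (i + j)) * (C₂ * R₂ ^ a.natAbs * R₂ ^ (i + j)) * ((ℓ : ℝ) ^ 2) ^ (i + j) := by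
        refine mul_le_mul_of_nonneg_right ?_ (by positivity)
        exact mul_le_mul (h₁ i j) hb₂ (norm_nonneg _) (by positivity)
    _ = C₁ * C₂ * R₂ ^ a.natAbs * (R₁ * R₂ * (ℓ : ℝ) ^ 2) ^ (i + j) := by
        rw [mul_pow, mul_pow]; ring
    _ ≤ _ := mul_le_mul_of_nonneg_left (pow_le_pow_right₀ hR (by omega)) h0

lemma norm_X (s : ℂ) : ‖X η s‖ = ‖(η (ϖ ℓ) : ℂ)‖ * (ℓ : ℝ) ^ (-s.re) := by
  rw [X, norm_mul, Complex.norm_natCast_cpow_of_pos (Fact.out : ℓ.Prime).pos, Complex.neg_re]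

/-- `X` becomes small in a right half plane. -/
lemma exists_mul_norm_X_lt_one (η : ℚ_[ℓ]ˣ →* ℂˣ) {R : ℝ} (hR : 1 ≤ R) :
    ∃ s₀ : ℝ, ∀ s : ℂ, s₀ < s.re → R * ‖X η s‖ < 1 := by
  have hη : 0 < ‖(η (ϖ ℓ) : ℂ)‖ := norm_pos_iff.mpr (Units.ne_zero _)
  have hK : 0 < R * ‖(η (ϖ ℓ) : ℂ)‖ := mul_pos (zero_lt_one.trans_le hR) hη
  have hℓ : (0 : ℝ) < ℓ := zero_lt_one.trans one_lt_cast
  refine ⟨Real.logb ℓ (R * ‖(η (ϖ ℓ) : ℂ)‖), fun s hs => ?_⟩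
  rw [norm_X, ← mul_assoc, Real.rpow_neg hℓ.le, ← div_eq_mul_inv,
    div_lt_one (Real.rpow_pos_of_pos hℓ _)]
  rwa [← Real.logb_lt_iff_lt_rpow one_lt_cast hK]

lemma summable_of_norm_le_geometric {g : ℤ → ℤ → ℂ} {C r : ℝ} (hr : 0 ≤ r) (hr' : r < 1)
    (hg : ∀ i j : ℕ, ‖g i j‖ ≤ C * r ^ (i + 2 * j)) (h0 : ∀ i j, ¬ (0 ≤ i ∧ 0 ≤ j) → g i j = 0) :
    Summable fun p : ℤ × ℤ => g p.1 p.2 := by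
  have hι : Function.Injective fun q : ℕ × ℕ => ((q.1 : ℤ), (q.2 : ℤ)) := by
    rintro ⟨i, j⟩ ⟨i', j'⟩ h
    simp only [Prod.mk.injEq] at h
    ext <;> simp <;> omega
  rw [← hι.summable_iff]
  · have hs := ((summable_geometric_of_lt_one hr hr').mul_of_nonneg
      (summable_geometric_of_lt_one (pow_nonneg hr 2) (pow_lt_one₀ hr hr' two_ne_zero))
      (fun i => pow_nonneg hr i) (fun i => pow_nonneg (pow_nonneg hr 2) i)).mul_left C
    refine Summable.of_norm_bounded hs fun q => ?_
    refine (hg q.1 q.2).trans_eq ?_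
    rw [pow_add, pow_mul]
  · intro p hp
    refine h0 _ _ fun h => hp ⟨(p.1.toNat, p.2.toNat), ?_⟩
    ext <;> simp <;> omega

/-- The double sums converge absolutely in a right half plane: by admissibility the Whittaker
values grow at most exponentially, so that a small `X` forces geometric decay. -/
lemma exists_summable_term (hF : IsSphericalWhittaker Ψ (whit σ' τ' Wσ Wτ v₀ w₀))
    (hσa : IsAdmissible σ') (hτa : IsAdmissible τ') (hΨ : IsUnramifiedAddChar ℓ Ψ)
    (hWσ : IsWhittaker₁ σ' Ψ Wσ) (hWτ : IsWhittaker₂ τ' Ψ Wτ)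
    (hsph : ∀ k ∈ GZ ℓ, boxRep σ' τ' k (v₀ ⊗ₜ[ℂ] w₀) = v₀ ⊗ₜ[ℂ] w₀)
    (hv : Wσ v₀ ≠ 0) (hw : Wτ w₀ ≠ 0) (η : ℚ_[ℓ]ˣ →* ℂˣ) {a b : ℤ} (hab : a + 2 * b = 0) :
    ∃ s₀ : ℝ, ∀ s : ℂ, s₀ < s.re →
      Summable fun p : ℤ × ℤ => term σ' τ' Wσ Wτ v₀ w₀ η s a b p.1 p.2 := by
  obtain ⟨C, R, hR, h⟩ := exists_norm_term_le hF hσa hτa hΨ hWσ hWτ hsph hv hw η hab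
  obtain ⟨s₀, hs₀⟩ := exists_mul_norm_X_lt_one η hR
  exact ⟨s₀, fun s hs => summable_of_norm_le_geometric
    (mul_nonneg (zero_le_one.trans hR) (norm_nonneg _)) (hs₀ s hs) (h s)
    fun i j hij => term_eq_zero hF hΨ s hab (by tauto)⟩

end Convergence

/-! ### The zeta integrals of the Hecke translates -/

section Formulas

lemma dsum_eq_add {g : ℤ → ℤ → ℂ} (hg : Summable fun p : ℤ × ℤ => g p.1 p.2) (a b : ℤ) :
    dsum a b g = ∑' j : ℕ, g a (b + j) + dsum (a + 1) b g := by
  have hι : Function.Injective fun q : ℕ × ℕ => (a + (q.1 : ℤ), b + (q.2 : ℤ)) := by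
    rintro ⟨i, j⟩ ⟨i', j'⟩ h
    simp only [Prod.mk.injEq] at h
    ext <;> simp <;> omega
  have hs : Summable fun q : ℕ × ℕ => g (a + q.1) (b + q.2) := hg.comp_injective hι
  rw [dsum, hs.prod.tsum_eq_zero_add, dsum]
  congr 1
  · simp
  · refine tsum_congr fun i => tsum_congr fun j => ?_
    congr 1
    push_cast
    ring

/-- Inclusion and exclusion for the four quadrants with corners in `{0, 1}²`. -/
lemma dsum_alternating {g : ℤ → ℤ → ℂ} (hg : Summable fun p : ℤ × ℤ => g p.1 p.2) :
    dsum 0 0 g - dsum 0 1 g - dsum 1 0 g + dsum 1 1 g = g 0 0 := by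
  have hι : Function.Injective fun j : ℕ => ((0 : ℤ), (j : ℤ)) := by
    intro i j h
    simpa using h
  have hs : Summable fun j : ℕ => g 0 (0 + j) := by
    simpa only [zero_add, Function.comp_def] using hg.comp_injective hι
  rw [dsum_eq_add hg 0 0, dsum_eq_add hg 0 1, hs.tsum_eq_zero_add, zero_add]
  have : ∀ j : ℕ, g 0 (0 + ((j + 1 : ℕ) : ℤ)) = g 0 (1 + j) := fun j => by
    congr 1
    push_cast
    ring
  rw [tsum_congr this, zero_add, Nat.cast_zero]
  ring

variable {ℓ : ℕ} [Fact ℓ.Prime]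
variable {V₁ V₂ : Type*} [AddCommGroup V₁] [Module ℂ V₁] [AddCommGroup V₂] [Module ℂ V₂]
  {σ' : Representation ℂ (GSp4 ℚ_[ℓ]) V₁} {τ' : Representation ℂ (GL (Fin 2) ℚ_[ℓ]) V₂}
  {Ψ : AddChar ℚ_[ℓ] ℂ} {Wσ : V₁ →ₗ[ℂ] ℂ} {Wτ : V₂ →ₗ[ℂ] ℂ} {v₀ : V₁} {w₀ : V₂}
  {η : ℚ_[ℓ]ˣ →* ℂˣ}

/-- The zeta integral of the translate of the invariant vector by `ζ` converges and has the value
`c`. -/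
def HasZeta (σ' : Representation ℂ (GSp4 ℚ_[ℓ]) V₁) (τ' : Representation ℂ (GL (Fin 2) ℚ_[ℓ]) V₂)
    (Wσ : V₁ →ₗ[ℂ] ℂ) (Wτ : V₂ →ₗ[ℂ] ℂ) (v₀ : V₁) (w₀ : V₂) (η : ℚ_[ℓ]ˣ →* ℂˣ) (s : ℂ)
    (ζ : G ℚ_[ℓ] → ℂ) (c : ℂ) : Prop :=
  Integrable (lIntegrand σ' τ' Wσ Wτ (heckeAct (GZ ℓ) (boxRep σ' τ') ζ (v₀ ⊗ₜ[ℂ] w₀)) η s)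
      ((mulHaar ℓ).prod (mulHaar ℓ)) ∧
    l σ' τ' Wσ Wτ (heckeAct (GZ ℓ) (boxRep σ' τ') ζ (v₀ ⊗ₜ[ℂ] w₀)) η s = c

/-- The zeta integral is linear in the Hecke operator. -/
lemma HasZeta.linear_comb {s : ℂ} {ι : Type*} {t : Finset ι} {ζ : ι → G ℚ_[ℓ] → ℂ} {c : ι → ℂ}
    (hsph : ∀ k ∈ GZ ℓ, boxRep σ' τ' k (v₀ ⊗ₜ[ℂ] w₀) = v₀ ⊗ₜ[ℂ] w₀)
    (hζ : ∀ i ∈ t, ζ i ∈ heckeFinite (GZ ℓ))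
    (h : ∀ i ∈ t, HasZeta σ' τ' Wσ Wτ v₀ w₀ η s (ζ i) (c i)) (d : ι → ℂ) :
    HasZeta σ' τ' Wσ Wτ v₀ w₀ η s (∑ i ∈ t, d i • ζ i) (∑ i ∈ t, d i * c i) := by
  have hact : heckeAct (GZ ℓ) (boxRep σ' τ') (∑ i ∈ t, d i • ζ i) (v₀ ⊗ₜ[ℂ] w₀) =
      ∑ i ∈ t, d i • heckeAct (GZ ℓ) (boxRep σ' τ') (ζ i) (v₀ ⊗ₜ[ℂ] w₀) := by
    have hmem : ∑ i ∈ t, d i • ζ i ∈ heckeFinite (GZ ℓ) :=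
      Submodule.sum_mem _ fun i hi => Submodule.smul_mem _ _ (hζ i hi)
    have e : (⟨_, hmem⟩ : heckeFinite (GZ ℓ)) =
        ∑ i ∈ t.attach, d i • ⟨ζ i, hζ i i.2⟩ := by
      refine Subtype.ext ?_
      rw [Submodule.coe_sum]
      exact (Finset.sum_attach t fun i => d i • ζ i).symm
    have := congrArg (heckeLinear hsph) e
    rw [map_sum, heckeLinear_apply] at this
    refine this.trans ?_
    rw [← Finset.sum_attach t]
    exact Finset.sum_congr rfl fun i _ => by rw [map_smul, heckeLinear_apply]
  have hI : lIntegrand σ' τ' Wσ Wτ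
      (heckeAct (GZ ℓ) (boxRep σ' τ') (∑ i ∈ t, d i • ζ i) (v₀ ⊗ₜ[ℂ] w₀)) η s =
      fun z => ∑ i ∈ t, d i * lIntegrand σ' τ' Wσ Wτ
        (heckeAct (GZ ℓ) (boxRep σ' τ') (ζ i) (v₀ ⊗ₜ[ℂ] w₀)) η s z := by
    funext z
    simp only [hact, lIntegrand, map_sum, map_smul, Finset.sum_mul, smul_eq_mul, mul_assoc]
  rw [HasZeta, l, hI]
  refine ⟨integrable_finsetSum _ fun i hi => (h i hi).1.const_mul (d i), ?_⟩
  rw [integral_finsetSum _ fun i hi => (h i hi).1.const_mul (d i)]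
  refine Finset.sum_congr rfl fun i hi => ?_
  rw [integral_const_mul]
  exact congrArg _ (h i hi).2

variable {s : ℂ}

lemma hasZeta_cosetUnion (hF : IsSphericalWhittaker Ψ (whit σ' τ' Wσ Wτ v₀ w₀))
    (hsph : ∀ k ∈ GZ ℓ, boxRep σ' τ' k (v₀ ⊗ₜ[ℂ] w₀) = v₀ ⊗ₜ[ℂ] w₀)
    (hΨ : IsUnramifiedAddChar ℓ Ψ) (hη : IsUnramifiedChar ℓ η)
    (hS : ∀ a b : ℤ, a + 2 * b = 0 → |a| ≤ 2 → Summable fun q : ℤ × ℤ =>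
        term σ' τ' Wσ Wτ v₀ w₀ η s a b q.1 q.2)
    {e f e' f' : ℕ} (hk : 2 * e + f = 2 * e' + f') (hff : f + f' ≤ 2) :
    HasZeta σ' τ' Wσ Wτ v₀ w₀ η s (Set.indicator (cosetUnion ℓ e f e' f') 1)
      (∑ P ∈ Finset.HasAntidiagonal.antidiagonal f, ∑ P' ∈ Finset.HasAntidiagonal.antidiagonal f',
      (ℓ : ℂ) ^ ((P'.1 + 2 * (2 * e + f) - P.1 - 2 * e : ℤ)) * X η s ^ (-(2 * e + f : ℤ)) *
        dsum (max P.1 (P.1 - P.2 + P'.2)) (P.2 + e)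
          (term σ' τ' Wσ Wτ v₀ w₀ η s (P'.1 - P'.2 - (P.1 - P.2)) (P'.2 + e' - (P.2 + e)))) := by
  refine l_cosetUnion hF hsph hΨ hη hk s fun P hP P' hP' => hS _ _ ?_ ?_
  all_goals
    replace hP := Finset.HasAntidiagonal.mem_antidiagonal.mp hP
    replace hP' := Finset.HasAntidiagonal.mem_antidiagonal.mp hP'
  · omega
  · rw [abs_le]
    omega

lemma antidiagonal_one :
    Finset.HasAntidiagonal.antidiagonal 1 = {((0 : ℕ), (1 : ℕ)), (1, 0)} := rfl

lemma antidiagonal_two : Finset.HasAntidiagonal.antidiagonal 2 =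
    {((0 : ℕ), (2 : ℕ)), (1, 1), (2, 0)} := rfl

section Values

variable (hF : IsSphericalWhittaker Ψ (whit σ' τ' Wσ Wτ v₀ w₀))
    (hsph : ∀ k ∈ GZ ℓ, boxRep σ' τ' k (v₀ ⊗ₜ[ℂ] w₀) = v₀ ⊗ₜ[ℂ] w₀)
    (hΨ : IsUnramifiedAddChar ℓ Ψ) (hη : IsUnramifiedChar ℓ η)
    (hS : ∀ a b : ℤ, a + 2 * b = 0 → |a| ≤ 2 → Summable fun q : ℤ × ℤ =>
        term σ' τ' Wσ Wτ v₀ w₀ η s a b q.1 q.2)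
    {m n : ℕ} (hn : 1 ≤ n)

include hF hsph hΨ hη hS hn

lemma hasZeta_U_zero : HasZeta σ' τ' Wσ Wτ v₀ w₀ η s (U ℓ m n 0)
    (dsum 0 0 (term σ' τ' Wσ Wτ v₀ w₀ η s 0 0)) := by
  rw [U, doubleCoset_u_zero hn]
  convert hasZeta_cosetUnion hF hsph hΨ hη hS (e := 0) (f := 0) (e' := 0) (f' := 0) rfl
    (by norm_num) using 1
  norm_num

lemma hasZeta_U_one : HasZeta σ' τ' Wσ Wτ v₀ w₀ η s (U ℓ m n 1)
    ((ℓ : ℂ) ^ 2 * X η s ^ (-1 : ℤ) * (dsum 0 1 (term σ' τ' Wσ Wτ v₀ w₀ η s 0 0) +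
        dsum 1 0 (term σ' τ' Wσ Wτ v₀ w₀ η s 0 0))
      + (ℓ : ℂ) * X η s ^ (-1 : ℤ) * dsum 2 0 (term σ' τ' Wσ Wτ v₀ w₀ η s (-2) 1)
      + (ℓ : ℂ) ^ 3 * X η s ^ (-1 : ℤ) * dsum 0 1 (term σ' τ' Wσ Wτ v₀ w₀ η s 2 (-1))) := by
  rw [U, doubleCoset_u_one hn]
  convert hasZeta_cosetUnion hF hsph hΨ hη hS (e := 0) (f := 1) (e' := 0) (f' := 1) rfl
    (by norm_num) using 1
  rw [antidiagonal_one]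
  norm_num [zpow_ofNat]
  ring

lemma hasZeta_U_two : HasZeta σ' τ' Wσ Wτ v₀ w₀ η s (U ℓ m n 2)
    ((ℓ : ℂ) ^ 2 * X η s ^ (-2 : ℤ) * dsum 0 1 (term σ' τ' Wσ Wτ v₀ w₀ η s 0 0)) := by
  rw [U, doubleCoset_u_two hn]
  convert hasZeta_cosetUnion hF hsph hΨ hη hS (e := 1) (f := 0) (e' := 1) (f' := 0) rfl
    (by norm_num) using 1
  norm_num [zpow_ofNat]

lemma hasZeta_U_three_add_two : HasZeta σ' τ' Wσ Wτ v₀ w₀ η s (U ℓ m n 3 + U ℓ m n 2)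
    ((ℓ : ℂ) ^ 3 * X η s ^ (-2 : ℤ) * dsum 1 1 (term σ' τ' Wσ Wτ v₀ w₀ η s 0 0)
      + (ℓ : ℂ) ^ 2 * X η s ^ (-2 : ℤ) * dsum 2 1 (term σ' τ' Wσ Wτ v₀ w₀ η s (-2) 1)
      + (ℓ : ℂ) ^ 4 * X η s ^ (-2 : ℤ) * dsum 0 1 (term σ' τ' Wσ Wτ v₀ w₀ η s 2 (-1))) := by
  rw [U_three_add_U_two hn]
  convert hasZeta_cosetUnion hF hsph hΨ hη hS (e := 1) (f := 0) (e' := 0) (f' := 2) rfl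
    (by norm_num) using 1
  rw [antidiagonal_two]
  norm_num [zpow_ofNat]
  ring

lemma hasZeta_U_four_add_two : HasZeta σ' τ' Wσ Wτ v₀ w₀ η s (U ℓ m n 4 + U ℓ m n 2)
    ((ℓ : ℂ) ^ 3 * X η s ^ (-2 : ℤ) * dsum 1 1 (term σ' τ' Wσ Wτ v₀ w₀ η s 0 0)
      + (ℓ : ℂ) ^ 2 * X η s ^ (-2 : ℤ) * dsum 2 0 (term σ' τ' Wσ Wτ v₀ w₀ η s (-2) 1)
      + (ℓ : ℂ) ^ 4 * X η s ^ (-2 : ℤ) * dsum 0 2 (term σ' τ' Wσ Wτ v₀ w₀ η s 2 (-1))) := by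
  rw [U_four_add_U_two hn]
  convert hasZeta_cosetUnion hF hsph hΨ hη hS (e := 0) (f := 2) (e' := 1) (f' := 0) rfl
    (by norm_num) using 1
  rw [antidiagonal_two]
  norm_num [zpow_ofNat]
  ring

lemma hasZeta_U_five : HasZeta σ' τ' Wσ Wτ v₀ w₀ η s (U ℓ m n 5)
    ((ℓ : ℂ) ^ 4 * X η s ^ (-3 : ℤ) * (dsum 1 1 (term σ' τ' Wσ Wτ v₀ w₀ η s 0 0) +
        dsum 0 2 (term σ' τ' Wσ Wτ v₀ w₀ η s 0 0))
      + (ℓ : ℂ) ^ 3 * X η s ^ (-3 : ℤ) * dsum 2 1 (term σ' τ' Wσ Wτ v₀ w₀ η s (-2) 1)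
      + (ℓ : ℂ) ^ 5 * X η s ^ (-3 : ℤ) * dsum 0 2 (term σ' τ' Wσ Wτ v₀ w₀ η s 2 (-1))) := by
  rw [U, doubleCoset_u_five hn]
  convert hasZeta_cosetUnion hF hsph hΨ hη hS (e := 1) (f := 1) (e' := 1) (f' := 1) rfl
    (by norm_num) using 1
  rw [antidiagonal_one]
  norm_num [zpow_ofNat]
  ring

lemma hasZeta_U_six : HasZeta σ' τ' Wσ Wτ v₀ w₀ η s (U ℓ m n 6)
    ((ℓ : ℂ) ^ 4 * X η s ^ (-4 : ℤ) * dsum 0 2 (term σ' τ' Wσ Wτ v₀ w₀ η s 0 0)) := by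
  rw [U, doubleCoset_u_six hn]
  convert hasZeta_cosetUnion hF hsph hΨ hη hS (e := 2) (f := 0) (e' := 2) (f' := 0) rfl
    (by norm_num) using 1
  norm_num [zpow_ofNat]

end Values

/-- The coefficients of `ξ_s` in terms of `X`. -/
lemma ξcoeff_eq (s : ℂ) : ξcoeff ℓ η s = ![1, -(X η s / (ℓ : ℂ) ^ 2), 2 * X η s ^ 2 / (ℓ : ℂ) ^ 3,
    X η s ^ 2 / (ℓ : ℂ) ^ 3, X η s ^ 2 / (ℓ : ℂ) ^ 3, -(X η s ^ 3 / (ℓ : ℂ) ^ 4),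
    X η s ^ 4 / (ℓ : ℂ) ^ 4] := by
  have hℓ := cast_ne_zero_complex (ℓ := ℓ)
  have h1 : ∀ k j : ℕ, (ℓ : ℂ) ^ (k * s + j) = ((ℓ : ℂ) ^ s) ^ k * (ℓ : ℂ) ^ j := by
    intro k j
    rw [Complex.cpow_add _ _ hℓ, Complex.cpow_natCast, Complex.cpow_nat_mul]
  have h2 : X η s = (η (ϖ ℓ) : ℂ) / (ℓ : ℂ) ^ s := by
    rw [X, Complex.cpow_neg, div_eq_mul_inv]
  have e1 := h1 1 2
  have e2 := h1 2 3
  have e3 := h1 3 4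
  have e4 := h1 4 4
  push_cast at e1 e2 e3 e4
  rw [one_mul, pow_one] at e1
  rw [ξcoeff, e1, e2, e3, e4, h2]
  simp only [div_pow, div_div, mul_div_assoc]

lemma differentiable_ξcoeff (i : Fin 7) : Differentiable ℂ fun s => ξcoeff ℓ η s i := by
  have hX : Differentiable ℂ fun s => X η s := by
    unfold X
    exact (differentiable_id.neg.const_cpow (Or.inl cast_ne_zero_complex)).const_mul _
  simp only [ξcoeff_eq]
  fin_cases i
  · exact differentiable_const _
  · exact (hX.div_const _).neg
  · exact ((hX.pow 2).const_mul 2).div_const _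
  · exact (hX.pow 2).div_const _
  · exact (hX.pow 2).div_const _
  · exact ((hX.pow 3).div_const _).neg
  · exact (hX.pow 4).div_const _

end Formulas

section Total

variable {ℓ : ℕ} [Fact ℓ.Prime]
variable {V₁ V₂ : Type*} [AddCommGroup V₁] [Module ℂ V₁] [AddCommGroup V₂] [Module ℂ V₂]
  {σ' : Representation ℂ (GSp4 ℚ_[ℓ]) V₁} {τ' : Representation ℂ (GL (Fin 2) ℚ_[ℓ]) V₂}
  {Ψ : AddChar ℚ_[ℓ] ℂ} {Wσ : V₁ →ₗ[ℂ] ℂ} {Wτ : V₂ →ₗ[ℂ] ℂ} {v₀ : V₁} {w₀ : V₂}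
  {η : ℚ_[ℓ]ˣ →* ℂˣ} {s : ℂ}

/-- The zeta integral is additive, so that those of `U₃` and `U₄` follow from those of `U₃ + U₂`,
`U₄ + U₂` and `U₂`. -/
lemma HasZeta.of_add {ζ ζ' : G ℚ_[ℓ] → ℂ} {c c' : ℂ}
    (hsph : ∀ k ∈ GZ ℓ, boxRep σ' τ' k (v₀ ⊗ₜ[ℂ] w₀) = v₀ ⊗ₜ[ℂ] w₀)
    (hζ : ζ ∈ heckeFinite (GZ ℓ)) (hζ' : ζ' ∈ heckeFinite (GZ ℓ))
    (h : HasZeta σ' τ' Wσ Wτ v₀ w₀ η s (ζ + ζ') c) (h' : HasZeta σ' τ' Wσ Wτ v₀ w₀ η s ζ' c') :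
    HasZeta σ' τ' Wσ Wτ v₀ w₀ η s ζ (c - c') := by
  have := HasZeta.linear_comb (t := Finset.univ) (ζ := ![ζ + ζ', ζ']) (c := ![c, c']) hsph
    (fun i _ => by fin_cases i; exacts [add_mem hζ hζ', hζ'])
    (fun i _ => by fin_cases i; exacts [h, h']) ![1, -1]
  simpa [Fin.sum_univ_two, sub_eq_add_neg] using this

variable (hF : IsSphericalWhittaker Ψ (whit σ' τ' Wσ Wτ v₀ w₀))
    (hsph : ∀ k ∈ GZ ℓ, boxRep σ' τ' k (v₀ ⊗ₜ[ℂ] w₀) = v₀ ⊗ₜ[ℂ] w₀)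
    (hnorm : Wσ v₀ * Wτ w₀ = 1)
    (hΨ : IsUnramifiedAddChar ℓ Ψ) (hη : IsUnramifiedChar ℓ η)
    (hS : ∀ a b : ℤ, a + 2 * b = 0 → |a| ≤ 2 → Summable fun q : ℤ × ℤ =>
        term σ' τ' Wσ Wτ v₀ w₀ η s a b q.1 q.2)
    {m n : ℕ} (hn : 1 ≤ n)

include hF hsph hΨ hη hS hn

lemma exists_hasZeta_U (i : Fin 7) : ∃ c, HasZeta σ' τ' Wσ Wτ v₀ w₀ η s (U ℓ m n i) c := by
  fin_cases i
  · exact ⟨_, hasZeta_U_zero hF hsph hΨ hη hS hn⟩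
  · exact ⟨_, hasZeta_U_one hF hsph hΨ hη hS hn⟩
  · exact ⟨_, hasZeta_U_two hF hsph hΨ hη hS hn⟩
  · exact ⟨_, .of_add hsph (U_mem_heckeFinite hn 3) (U_mem_heckeFinite hn 2)
      (hasZeta_U_three_add_two hF hsph hΨ hη hS hn) (hasZeta_U_two hF hsph hΨ hη hS hn)⟩
  · exact ⟨_, .of_add hsph (U_mem_heckeFinite hn 4) (U_mem_heckeFinite hn 2)
      (hasZeta_U_four_add_two hF hsph hΨ hη hS hn) (hasZeta_U_two hF hsph hΨ hη hS hn)⟩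
  · exact ⟨_, hasZeta_U_five hF hsph hΨ hη hS hn⟩
  · exact ⟨_, hasZeta_U_six hF hsph hΨ hη hS hn⟩

include hnorm in
/-- In the combination `ξ_s` everything cancels except for the alternating sum of the double sums
over the quadrants with corners in `{0, 1}²`, which is the term at the origin. -/
lemma hasZeta_ξ : HasZeta σ' τ' Wσ Wτ v₀ w₀ η s (ξ ℓ m n η s) 1 := by
  choose c hc using exists_hasZeta_U (m := m) hF hsph hΨ hη hS hn
  have hsum := HasZeta.linear_comb hsph (fun i (_ : i ∈ Finset.univ) => U_mem_heckeFinite hn i)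
    (fun i _ => hc i) (ξcoeff ℓ η s)
  have c0 := (hc 0).2.symm.trans (hasZeta_U_zero hF hsph hΨ hη hS hn).2
  have c1 := (hc 1).2.symm.trans (hasZeta_U_one hF hsph hΨ hη hS hn).2
  have c2 := (hc 2).2.symm.trans (hasZeta_U_two hF hsph hΨ hη hS hn).2
  have c3 := (hc 3).2.symm.trans (HasZeta.of_add hsph (U_mem_heckeFinite hn 3)
    (U_mem_heckeFinite hn 2) (hasZeta_U_three_add_two hF hsph hΨ hη hS hn)
    (hasZeta_U_two hF hsph hΨ hη hS hn)).2
  have c4 := (hc 4).2.symm.trans (HasZeta.of_add hsph (U_mem_heckeFinite hn 4)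
    (U_mem_heckeFinite hn 2) (hasZeta_U_four_add_two hF hsph hΨ hη hS hn)
    (hasZeta_U_two hF hsph hΨ hη hS hn)).2
  have c5 := (hc 5).2.symm.trans (hasZeta_U_five hF hsph hΨ hη hS hn).2
  have c6 := (hc 6).2.symm.trans (hasZeta_U_six hF hsph hΨ hη hS hn).2
  refine (show ∑ i, ξcoeff ℓ η s i * c i = 1 from ?_) ▸ hsum
  have hℓ := cast_ne_zero_complex (ℓ := ℓ)
  have hX := X_ne_zero (ℓ := ℓ) (η := η) s
  have h00 : term σ' τ' Wσ Wτ v₀ w₀ η s 0 0 0 0 = 1 := by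
    rw [term, wGSp4_eq, torus₄_zero]
    change Wσ (σ' 1 v₀) * Wτ (τ' (torus₂ ℓ 0 0) w₀) * _ * _ = 1
    rw [torus₂_zero]
    simpa using hnorm
  have hA := dsum_alternating (hS 0 0 (by norm_num) (by norm_num))
  rw [h00] at hA
  rw [← hA, ξcoeff_eq, Fin.sum_univ_seven, c0, c1, c2, c3, c4, c5, c6]
  simp only [Matrix.cons_val]
  simp only [zpow_neg, zpow_ofNat]
  field_simp
  ring

end Total

end GSp4GL2

open GSp4GL2 in
theorem mainTheorem8 (ℓ : ℕ) [Fact ℓ.Prime]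
    {V₁ V₂ : Type*} [AddCommGroup V₁] [Module ℂ V₁] [AddCommGroup V₂] [Module ℂ V₂]
    (σ' : Representation ℂ (GSp4 ℚ_[ℓ]) V₁) (τ' : Representation ℂ (GL (Fin 2) ℚ_[ℓ]) V₂)
    (hσ : σ'.IsIrreducible) (hσa : IsAdmissible σ')
    (hτ : τ'.IsIrreducible) (hτa : IsAdmissible τ')
    (Ψ : AddChar ℚ_[ℓ] ℂ) (hΨ : IsUnramifiedAddChar ℓ Ψ)
    (Wσ : V₁ →ₗ[ℂ] ℂ) (hWσ : IsWhittaker₁ σ' Ψ Wσ)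
    (Wτ : V₂ →ₗ[ℂ] ℂ) (hWτ : IsWhittaker₂ τ' Ψ Wτ)
    (v₀ : V₁) (w₀ : V₂)
    (hsph : ∀ k ∈ GZ ℓ, boxRep σ' τ' k (v₀ ⊗ₜ[ℂ] w₀) = v₀ ⊗ₜ[ℂ] w₀)
    (hnorm : Wσ v₀ * Wτ w₀ = 1)
    (η : ℚ_[ℓ]ˣ →* ℂˣ) (hη : IsUnramifiedChar ℓ η)
    (m n : ℕ) (hn : 1 ≤ n) :
    let φ₀ : V₁ ⊗[ℂ] V₂ := v₀ ⊗ₜ[ℂ] w₀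
    let act : (G ℚ_[ℓ] → ℂ) → V₁ ⊗[ℂ] V₂ → V₁ ⊗[ℂ] V₂ := heckeAct (GZ ℓ) (boxRep σ' τ')
    let L : V₁ ⊗[ℂ] V₂ → ℂ → ℂ := fun Φ s => l σ' τ' Wσ Wτ Φ η s
    let Converges : V₁ ⊗[ℂ] V₂ → ℂ → Prop := fun Φ s =>
      Integrable (lIntegrand σ' τ' Wσ Wτ Φ η s) ((mulHaar ℓ).prod (mulHaar ℓ))
    let X : ℂ → ℂ := X η
    let A : ℂ → ℤ → ℤ → ℂ := fun s => term σ' τ' Wσ Wτ v₀ w₀ η s 0 0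
    let B : ℂ → ℤ → ℤ → ℂ := fun s => term σ' τ' Wσ Wτ v₀ w₀ η s (-2) 1
    let C : ℂ → ℤ → ℤ → ℂ := fun s => term σ' τ' Wσ Wτ v₀ w₀ η s 2 (-1)
    (∃ s₀ : ℝ, ∀ s : ℂ, s₀ < s.re →
      ((∀ i, Converges (act (U ℓ m n i) φ₀) s) ∧
        Converges (act (U ℓ m n 3 + U ℓ m n 2) φ₀) s ∧
        Converges (act (U ℓ m n 4 + U ℓ m n 2) φ₀) s ∧
        Converges (act (ξ ℓ m n η s) φ₀) s ∧
        Summable (fun p : ℤ × ℤ => A s p.1 p.2) ∧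
        Summable (fun p : ℤ × ℤ => B s p.1 p.2) ∧
        Summable (fun p : ℤ × ℤ => C s p.1 p.2)) ∧
      L (act (U ℓ m n 1) φ₀) s =
        (ℓ : ℂ) ^ 2 * X s ^ (-1 : ℤ) * (dsum 0 1 (A s) + dsum 1 0 (A s))
        + (ℓ : ℂ) * X s ^ (-1 : ℤ) * dsum 2 0 (B s)
        + (ℓ : ℂ) ^ 3 * X s ^ (-1 : ℤ) * dsum 0 1 (C s) ∧
      L (act (U ℓ m n 2) φ₀) s =
        (ℓ : ℂ) ^ 2 * X s ^ (-2 : ℤ) * dsum 0 1 (A s) ∧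
      L (act (U ℓ m n 3 + U ℓ m n 2) φ₀) s =
        (ℓ : ℂ) ^ 3 * X s ^ (-2 : ℤ) * dsum 1 1 (A s)
        + (ℓ : ℂ) ^ 2 * X s ^ (-2 : ℤ) * dsum 2 1 (B s)
        + (ℓ : ℂ) ^ 4 * X s ^ (-2 : ℤ) * dsum 0 1 (C s) ∧
      L (act (U ℓ m n 4 + U ℓ m n 2) φ₀) s =
        (ℓ : ℂ) ^ 3 * X s ^ (-2 : ℤ) * dsum 1 1 (A s)
        + (ℓ : ℂ) ^ 2 * X s ^ (-2 : ℤ) * dsum 2 0 (B s)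
        + (ℓ : ℂ) ^ 4 * X s ^ (-2 : ℤ) * dsum 0 2 (C s) ∧
      L (act (U ℓ m n 5) φ₀) s =
        (ℓ : ℂ) ^ 4 * X s ^ (-3 : ℤ) * (dsum 1 1 (A s) + dsum 0 2 (A s))
        + (ℓ : ℂ) ^ 3 * X s ^ (-3 : ℤ) * dsum 2 1 (B s)
        + (ℓ : ℂ) ^ 5 * X s ^ (-3 : ℤ) * dsum 0 2 (C s) ∧
      L (act (U ℓ m n 6) φ₀) s =
        (ℓ : ℂ) ^ 4 * X s ^ (-4 : ℤ) * dsum 0 2 (A s) ∧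
      L (act (ξ ℓ m n η s) φ₀) s = 1) ∧
    (∀ (D : Set ℂ) (M : Fin 7 → ℂ → ℂ), IsOpen D → IsPreconnected D →
      (∀ i, DifferentiableOn ℂ (M i) D) →
      (∃ s₁ : ℝ, ∀ s : ℂ, s₁ < s.re → s ∈ D ∧ ∀ i, M i s = L (act (U ℓ m n i) φ₀) s) →
      ∀ s ∈ D, ∑ i, ξcoeff ℓ η s i * M i s = 1) := by
  intro φ₀ act L Converges X' A B C
  have hv : Wσ v₀ ≠ 0 := left_ne_zero_of_mul_eq_one hnorm
  have hw : Wτ w₀ ≠ 0 := right_ne_zero_of_mul_eq_one hnorm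
  have hF := isSphericalWhittaker_whit hWσ hWτ hsph
  obtain ⟨sA, hA⟩ := exists_summable_term hF hσa hτa hΨ hWσ hWτ hsph hv hw η
    (a := 0) (b := 0) (by norm_num)
  obtain ⟨sB, hB⟩ := exists_summable_term hF hσa hτa hΨ hWσ hWτ hsph hv hw η
    (a := -2) (b := 1) (by norm_num)
  obtain ⟨sC, hC⟩ := exists_summable_term hF hσa hτa hΨ hWσ hWτ hsph hv hw η
    (a := 2) (b := -1) (by norm_num)
  have hconv : ∃ s₀ : ℝ, ∀ s : ℂ, s₀ < s.re → ∀ a b : ℤ, a + 2 * b = 0 → |a| ≤ 2 →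
      Summable fun q : ℤ × ℤ => term σ' τ' Wσ Wτ v₀ w₀ η s a b q.1 q.2 := by
    refine ⟨max sA (max sB sC), fun s hs a b hab ha => ?_⟩
    rw [max_lt_iff, max_lt_iff] at hs
    obtain ⟨h1, h2⟩ := abs_le.mp ha
    obtain ⟨rfl, rfl⟩ | ⟨rfl, rfl⟩ | ⟨rfl, rfl⟩ :
        (a = 0 ∧ b = 0) ∨ (a = -2 ∧ b = 1) ∨ (a = 2 ∧ b = -1) := by omega
    · exact hA s hs.1
    · exact hB s hs.2.1
    · exact hC s hs.2.2
  obtain ⟨s₀, hs₀⟩ := hconv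
  have hξ : ∀ s : ℂ, s₀ < s.re → HasZeta σ' τ' Wσ Wτ v₀ w₀ η s (ξ ℓ m n η s) 1 := fun s hs =>
    hasZeta_ξ hF hsph hnorm hΨ hη (hs₀ s hs) hn
  have hU : ∀ s : ℂ, s₀ < s.re → ∀ i, ∃ c, HasZeta σ' τ' Wσ Wτ v₀ w₀ η s (U ℓ m n i) c :=
    fun s hs => exists_hasZeta_U hF hsph hΨ hη (hs₀ s hs) hn
  refine ⟨⟨s₀, fun s hs => ?_⟩, ?_⟩
  · have hS := hs₀ s hs
    have h1 := hasZeta_U_one hF hsph hΨ hη hS (m := m) hn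
    have h2 := hasZeta_U_two hF hsph hΨ hη hS (m := m) hn
    have h3 := hasZeta_U_three_add_two hF hsph hΨ hη hS (m := m) hn
    have h4 := hasZeta_U_four_add_two hF hsph hΨ hη hS (m := m) hn
    have h5 := hasZeta_U_five hF hsph hΨ hη hS (m := m) hn
    have h6 := hasZeta_U_six hF hsph hΨ hη hS (m := m) hn
    exact ⟨⟨fun i => (hU s hs i).choose_spec.1, h3.1, h4.1, (hξ s hs).1,
      hS 0 0 (by norm_num) (by norm_num), hS (-2) 1 (by norm_num) (by norm_num),
      hS 2 (-1) (by norm_num) (by norm_num)⟩,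
      h1.2, h2.2, h3.2, h4.2, h5.2, h6.2, (hξ s hs).2⟩
  · rintro D M hD hD' hM ⟨s₁, hs₁⟩
    have hlarge : ∀ s : ℂ, max s₀ s₁ < s.re → ∑ i, ξcoeff ℓ η s i * M i s = 1 := by
      intro s hs
      rw [max_lt_iff] at hs
      choose c hc using hU s hs.1
      have h := HasZeta.linear_comb hsph (fun i (_ : i ∈ Finset.univ) =>
        U_mem_heckeFinite (m := m) hn i) (fun i _ => hc i) (ξcoeff ℓ η s)
      rw [← (hξ s hs.1).2]
      refine Eq.trans ?_ h.2.symm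
      exact Finset.sum_congr rfl fun i _ => by rw [(hs₁ s hs.2).2 i, ← (hc i).2]
    have hdiff : DifferentiableOn ℂ (fun s => ∑ i, ξcoeff ℓ η s i * M i s) D :=
      DifferentiableOn.fun_sum fun i _ => (differentiable_ξcoeff i).differentiableOn.mul (hM i)
    -- A point of `D` in the half plane of convergence, where the two sides are known to agree.
    have hre : max s₀ s₁ < ((max s₀ s₁ + 1 : ℝ) : ℂ).re := by
      rw [Complex.ofReal_re]
      exact lt_add_one _
    have hmem : ((max s₀ s₁ + 1 : ℝ) : ℂ) ∈ D := (hs₁ _ ((le_max_right _ _).trans_lt hre)).1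
    have hev : (fun s => ∑ i, ξcoeff ℓ η s i * M i s) =ᶠ[nhds ((max s₀ s₁ + 1 : ℝ) : ℂ)]
        fun _ => 1 := by
      filter_upwards [(isOpen_lt continuous_const Complex.continuous_re).mem_nhds hre] with s hs
      exact hlarge s hs
    exact (hdiff.analyticOnNhd hD).eqOn_of_preconnected_of_eventuallyEq
      (differentiableOn_const 1 |>.analyticOnNhd hD) hD' hmem hev
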